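/- **Configurations.** Let $n\ge 0$ points lie on the unit circle, with a root on an arc between two consecutive points; equivalently the points are labeled $0,\dots,n-1$ along the circle. A *hyperchord* is (the convex hull of) a non-empty set of these points. Consider the families of: perfect matchings $\mathcal M$; partitions $\mathcal P$; partitions $\mathcal P^S$ with all block sizes in $S$; chord diagrams $\mathcal D$ (sets of $2$-element hyperchords); hyperchord diagrams $\mathcal H$ (sets of hyperchords); hyperchord diagrams $\mathcal H^S$ with all hyperchord sizes in $S$. Here $\emptyset\ne S\subseteq\mathbb N^*=\{1,2,\dots\}$; isolated points are allowed in diagrams. Two chords *cross* if their four endpoints are distinct and alternate along the circle. A *crossing* of two distinct hyperchords (or blocks) $U,V$ is a choice of a chord with ends in $U$ and a chord with ends in $V$ that cross; the number $k$ of crossings of a configuration is the total over all unordered pairs $\{U,V\}$. For a family $\mathcal C$ let $$\mathbf C_k(x,y)=\sum_{n,m\ge 0}\#\{C\in\mathcal C:\ n \text{ points},\ m \text{ hyperchords},\ k\text{ crossings}\}\;x^ny^m\in\mathbb Q[[x,y]],$$ and $\mathbf M_k(x)=\mathbf M_k(x,1)$. **Cores.** A *$k$-core* $K$ is a configuration with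 $k$ crossings in which every hyperchord is involved in a crossing and every point lies on a hyperchord; $n(K)$ and $m(K)$ are its numbers of points and hyperchords. Its *regions* are the connected components of the complement of its hyperchords in the disk; a region has $i$ boundary arcs and $j$ peaks if its closure meets the circle in $i$ arcs and $j$ isolated points. In addition, every uncrossed chord $vw$ along which two hyperchords of $K$ lying on opposite sides of $vw$ touch counts as one (flat) region with no boundary arc and two peaks (this occurs only for hyperchord diagrams). Let $n_i(K)$ be the number of regions with $i$ boundary arcs, and $n_{i,j}(K)$ the number with $i$ boundary arcs and $j$ peaks. For each family let $$\mathbf{KC}_k=\sum_{K}\frac{y^{m(K)}}{n(K)}\prod_{i\ge1}x_i^{n_i(K)}\ \ (\mathcal C=\mathcal P,\mathcal P^S),\qquad \mathbf{KC}_k=\sum_{K}\frac{y^{m(K)}}{n(K)}\prod_{(i,j)\ne(0,0)}x_{i,j}^{n_{i,j}(K)}\ \ (\mathcal C=\mathcal D,\mathcal H,\mathcal H^S),$$ the sums being over the $k$-cores $K$ in $\mathcal C$; $\mathbf{KM}_k$ is defined as the first sum without $y$. **Theorem.** (1) For every $k\ge 1$ each of the six families has only finitely many $k$-cores, and $$\mathbf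 M_k(x)=x\frac{d}{dx}\,\mathbf{KM}_k\Big(x_i\leftarrow \tfrac{x^i}{(i-1)!}\tfrac{d^{i-1}}{dx^{i-1}}\big(x^{i-1}\mathbf M_0(x)\big)\Big),$$ $$\mathbf C_k(x,y)=x\frac{\partial}{\partial x}\,\mathbf{KC}_k\Big(x_i\leftarrow \tfrac{x^i}{(i-1)!}\tfrac{\partial^{i-1}}{\partial x^{i-1}}\big(x^{i-1}\mathbf C_0(x,y)\big),\ y\Big)\qquad(\mathcal C=\mathcal P,\ \mathcal P^S),$$ $$\mathbf C_k(x,y)=x\frac{\partial}{\partial x}\,\mathbf{KC}_k\Big(x_{0,j}\leftarrow\tfrac{\mathbf C_0^{j}(y)}{(1+\delta y)^{j}},\ \ x_{i,j}\leftarrow \tfrac{x^i}{(i-1)!\,(1+\delta y)^{i+j}}\tfrac{\partial^{i-1}}{\partial x^{i-1}}\tfrac{\mathbf C_0(x,y)-\mathbf C_0^{\le i+j}(x,y)}{x^{i+j+1}}\ (i\ge1),\ \ y\Big)\qquad(\mathcal C=\mathcal D,\ \mathcal H,\ \mathcal H^S),$$ where $\mathbf C_0^{j}(y)=[x^j]\mathbf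 C_0(x,y)$, $\mathbf C_0^{\le p}(x,y)=\sum_{n\le p}\mathbf C_0^n(y)x^n$, and $\delta=1$ if hyperchords of size $1$ are allowed in $\mathcal C$ (that is, for $\mathcal H$, and for $\mathcal H^S$ with $1\in S$) and $\delta=0$ otherwise. (2) For every $k\ge 0$, $\mathbf C_k(x,y)$ is a rational function, with rational coefficients, of $\mathbf C_0(x,y)$, $x$ and $y$, for each of $\mathcal M,\mathcal P,\mathcal D,\mathcal H$, and for $\mathcal P^S$ and $\mathcal H^S$ whenever $S$ is finite or ultimately periodic (that is, $S=A\cup\bigcup_{b\in B}\{b+up: u\in\mathbb N\}$ with $A,B\subset\mathbb N^*$ finite and $p\ge 1$). More precisely, for $\mathcal M,\mathcal P,\mathcal P^S,\mathcal D$ it is a rational function of $\mathbf C_0(x,y)$ and $x$ only, and $\mathbf M_k(x)$ is a rational function of $\mathbf M_0(x)$ and $x$. -/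

import Mathlib

open PowerSeries

namespace ChordConfig

/-! ### Configurations on the circle, crossings, families -/

/-- A set of hyperchords on `n` points of the unit circle. The configuration is rooted on an arc
between two consecutive points, and the points are numbered `0, …, n - 1` along the circle, starting
just after the root. A hyperchord is recorded by its set of vertices, a chord by its two ends. -/
abbrev Configuration (n : ℕ) : Type := Finset (Finset (Fin n))

/-- The crossing pairs of a chord `ab` with ends in `U` and a chord `cd` with ends in `V`, where `a`
is the smallest of the four ends, so that `a < c < b < d`. The remaining crossings between `U` and
`V`, those whose smallest end comes from the chord of `V`, are `orientedCrossings V U`. -/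
def orientedCrossings {n : ℕ} (U V : Finset (Fin n)) :
    Finset ((Fin n × Fin n) × (Fin n × Fin n)) :=
  ((U ×ˢ U) ×ˢ (V ×ˢ V)).filter
    fun p => p.1.1 < p.2.1 ∧ p.2.1 < p.1.2 ∧ p.1.2 < p.2.2

/-- Two hyperchords cross: some chord of one crosses some chord of the other. -/
def Cross {n : ℕ} (U V : Finset (Fin n)) : Prop :=
  (orientedCrossings U V).Nonempty ∨ (orientedCrossings V U).Nonempty

/-- The number of crossings, counted with multiplicity: each unordered pair of distinct hyperchords
`U`, `V` contributes the number of pairs of a chord of `U` and a chord of `V` that cross. -/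
def crossingNumber {n : ℕ} (H : Configuration n) : ℕ :=
  ∑ U ∈ H, ∑ V ∈ H.erase U, (orientedCrossings U V).card

/-- A family of configurations. -/
abbrev Family : Type := ∀ n : ℕ, Set (Configuration n)

/-- Partitions of the points into (non-empty, disjoint) blocks. -/
def partitions : Family := fun n =>
  {H | ∃ P : Finpartition (Finset.univ : Finset (Fin n)), P.parts = H}

/-- Hyperchord diagrams: arbitrary sets of (non-empty) hyperchords; isolated points are allowed. -/
def hyperchordDiagrams : Family := fun _ => {H | ∀ U ∈ H, U.Nonempty}

/-- Partitions all of whose block sizes belong to `S`. -/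
def partitionsSizes (S : Set ℕ) : Family := fun n => {H ∈ partitions n | ∀ U ∈ H, U.card ∈ S}

/-- Hyperchord diagrams all of whose hyperchord sizes belong to `S`. -/
def hyperchordDiagramsSizes (S : Set ℕ) : Family := fun n =>
  {H ∈ hyperchordDiagrams n | ∀ U ∈ H, U.card ∈ S}

/-- Perfect matchings. -/
def matchings : Family := fun n => {H ∈ partitions n | ∀ U ∈ H, U.card = 2}

/-- Chord diagrams; isolated points are allowed, multiple chords are not. -/
def chordDiagrams : Family := fun _ => {H | ∀ U ∈ H, U.card = 2}

/-- `S = A ∪ ⋃ b ∈ B, {b + u p | u ∈ ℕ}` for finite sets `A`, `B` of positive integers and a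
period `p ≥ 1`. -/
def UltimatelyPeriodic (S : Set ℕ) : Prop :=
  ∃ (A B : Finset ℕ) (p : ℕ), 0 ∉ A ∧ 0 ∉ B ∧ 1 ≤ p ∧
    S = (A : Set ℕ) ∪ ⋃ b ∈ B, {s | ∃ u : ℕ, s = b + u * p}

/-! ### Generating functions

A series in `x` and `y` is a power series in `x` whose coefficients are power series in `y`. -/

/-- The variable `x`, which marks the points. -/
noncomputable def xVar : ℚ⟦X⟧⟦X⟧ := X

/-- The variable `y`, which marks the hyperchords. -/
noncomputable def yVar : ℚ⟦X⟧⟦X⟧ := C (X : ℚ⟦X⟧)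

/-- The generating function `F_k(x, y)` of the configurations of the family with `k` crossings. -/
noncomputable def genFun (F : Family) (k : ℕ) : ℚ⟦X⟧⟦X⟧ :=
  PowerSeries.mk fun n => PowerSeries.mk fun m =>
    (({H : Configuration n | H ∈ F n ∧ H.card = m ∧ crossingNumber H = k}.ncard : ℕ) : ℚ)

/-- The generating function `F_k(x)`, which does not record the number of hyperchords. -/
noncomputable def genFunX (F : Family) (k : ℕ) : ℚ⟦X⟧ :=
  PowerSeries.mk fun n =>
    (({H : Configuration n | H ∈ F n ∧ crossingNumber H = k}.ncard : ℕ) : ℚ)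

/-- `f` is a rational function, with rational coefficients, of the elements `g i`. (It is applied
in integral domains.) -/
def IsRationalFunctionOf {A : Type*} [CommRing A] [Algebra ℚ A] {ι : Type*}
    (f : A) (g : ι → A) : Prop :=
  ∃ p q : MvPolynomial ι ℚ,
    MvPolynomial.aeval g q ≠ 0 ∧ MvPolynomial.aeval g q * f = MvPolynomial.aeval g p

/-! ### Cores and their regions -/

/-- Each hyperchord is involved in a crossing, and each point lies on a hyperchord. -/
def IsCore {n : ℕ} (K : Configuration n) : Prop :=
  (∀ U ∈ K, ∃ V ∈ K, V ≠ U ∧ Cross U V) ∧ ∀ v : Fin n, ∃ U ∈ K, v ∈ U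

/-- The cores with `k` crossings in a family. -/
def cores (F : Family) (k : ℕ) : Set (Σ n : ℕ, Configuration n) :=
  {K | K.2 ∈ F K.1 ∧ IsCore K.2 ∧ crossingNumber K.2 = k}

/-- The points met when walking along the circle from `a` to `b`, without `a` and with `b` (no
point if `a = b`). -/
def walk {n : ℕ} (a b : Fin n) : Finset (Fin n) :=
  if a ≤ b then Finset.univ.filter (fun u => a < u ∧ u ≤ b)
  else Finset.univ.filter (fun u => a < u ∨ u ≤ b)

/-- *Arc `a`* is the open arc of the circle from the point `a` to the next one. The hyperchord `U`
separates arc `a` from arc `b` in the disk iff it has vertices on both of the two pieces of the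
circle that lie between these arcs. -/
def Separates {n : ℕ} (U : Finset (Fin n)) (a b : Fin n) : Prop :=
  (U ∩ walk a b).Nonempty ∧ (U \ walk a b).Nonempty

instance {n : ℕ} (U : Finset (Fin n)) (a b : Fin n) : Decidable (Separates U a b) :=
  inferInstanceAs (Decidable (_ ∧ _))

/-- The regions of `K` (connected components of the complement of its hyperchords in the disk) are
observed near the circle. The pair `(v, c)` stands for the germ at the point `v` of the segment from
`v` to arc `c`. The germ avoids the hyperchords of `K` iff no hyperchord at `v` has vertices on both
sides of this segment. The germ `(a, a)` runs along arc `a`. -/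
def IsFree {n : ℕ} (K : Configuration n) (s : Fin n × Fin n) : Prop :=
  ∀ U ∈ K, s.1 ∈ U → ¬ ((U ∩ walk s.1 s.2).Nonempty ∧ ((U \ walk s.1 s.2).erase s.1).Nonempty)

instance {n : ℕ} (K : Configuration n) (s : Fin n × Fin n) : Decidable (IsFree K s) :=
  inferInstanceAs (Decidable (∀ U ∈ K, _))

/-- An arc on the same side of `U` as the free germ `(v, c)`: if `v` is a vertex of `U`, the
whole segment from `v` to arc `c` is on one side of `U`; otherwise `v` itself is on the same side
as arc `v`. -/
def sideArc {n : ℕ} (U : Finset (Fin n)) (s : Fin n × Fin n) : Fin n :=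
  if s.1 ∈ U then s.2 else s.1

/-- The free germs in the same region of `K` as `s`, that is, those which no hyperchord of `K`
separates from `s`. (The complement of a hyperchord in the disk is a disjoint union of convex
sets, hence the regions are convex, and are determined by their side of each hyperchord.) -/
def regionOf {n : ℕ} (K : Configuration n) (s : Fin n × Fin n) : Finset (Fin n × Fin n) :=
  Finset.univ.filter fun t =>
    IsFree K t ∧ ∀ U ∈ K, ¬ Separates U (sideArc U s) (sideArc U t)

/-- The regions of `K` whose closure meets the circle, each given by its set of free germs. -/
def regions {n : ℕ} (K : Configuration n) : Finset (Finset (Fin n × Fin n)) :=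
  (Finset.univ.filter (IsFree K)).image (regionOf K)

/-- The boundary arcs of a region: the arcs in which it meets the circle. -/
def boundaryArcs {n : ℕ} (R : Finset (Fin n × Fin n)) : Finset (Fin n) :=
  Finset.univ.filter fun a => (a, a) ∈ R

/-- The peaks of a region: the isolated points in which its closure meets the circle, that is, the
points that it touches and that are not an end of one of its boundary arcs. -/
def peaks {n : ℕ} (R : Finset (Fin n × Fin n)) : Finset (Fin n) :=
  Finset.univ.filter fun v =>
    (∃ c, (v, c) ∈ R) ∧ ∀ a ∈ boundaryArcs R, v ≠ a ∧ v ≠ finRotate n a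

/-- The chords `vw` (`v < w`) that are crossed by no chord of a hyperchord of `K` and along which
two hyperchords of `K`, one on each side of `vw`, touch each other. Such a pair of hyperchords
leaves between them a region that is flattened to the chord `vw`. -/
def flatRegions {n : ℕ} (K : Configuration n) : Finset (Fin n × Fin n) :=
  Finset.univ.filter fun e => e.1 < e.2 ∧
    (∀ U ∈ K, ¬ ((∃ a ∈ U, e.1 < a ∧ a < e.2) ∧ ∃ b ∈ U, b < e.1 ∨ e.2 < b)) ∧
    (∃ U ∈ K, e.1 ∈ U ∧ e.2 ∈ U ∧ ∃ a ∈ U, e.1 < a ∧ a < e.2) ∧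
    (∃ U ∈ K, e.1 ∈ U ∧ e.2 ∈ U ∧ ∃ b ∈ U, b < e.1 ∨ e.2 < b)

/-- `n_i(K)`: the number of regions with `i` boundary arcs. -/
def numRegions {n : ℕ} (K : Configuration n) (i : ℕ) : ℕ :=
  ((regions K).filter fun R => (boundaryArcs R).card = i).card

/-- `n_{i,j}(K)`: the number of regions with `i` boundary arcs and `j` peaks, where a flat region
is a region with no boundary arc and two peaks. It is used for `(i, j) ≠ (0, 0)`. -/
def numRegionsPeaks {n : ℕ} (K : Configuration n) (i j : ℕ) : ℕ :=
  ((regions K).filter fun R => (boundaryArcs R).card = i ∧ (peaks R).card = j).card +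
    if i = 0 ∧ j = 2 then (flatRegions K).card else 0

/-! ### Core polynomials -/

/-- `∑_K (1 / n(K)) ∏_i x_i ^ n_i(K)`, over the cores `K` with `k` crossings of the family; the
variable `x_i` is `X i`. -/
noncomputable def corePolynomialX (F : Family) (k : ℕ) : MvPolynomial ℕ ℚ :=
  ∑ᶠ K ∈ cores F k, MvPolynomial.C ((K.1 : ℚ)⁻¹) *
    ∏ i ∈ Finset.Icc 1 K.1, MvPolynomial.X i ^ numRegions K.2 i

/-- `∑_K (1 / n(K)) y ^ m(K) ∏_i x_i ^ n_i(K)`, over the cores `K` with `k` crossings of the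
family; the variable `x_i` is `X (some i)` and `y` is `X none`. -/
noncomputable def corePolynomial (F : Family) (k : ℕ) : MvPolynomial (Option ℕ) ℚ :=
  ∑ᶠ K ∈ cores F k, MvPolynomial.C ((K.1 : ℚ)⁻¹) * MvPolynomial.X none ^ K.2.card *
    ∏ i ∈ Finset.Icc 1 K.1, MvPolynomial.X (some i) ^ numRegions K.2 i

/-- `∑_K (1 / n(K)) y ^ m(K) ∏_{i,j} x_{i,j} ^ n_{i,j}(K)`, over the cores `K` with `k` crossings of
the family; the variable `x_{i,j}` is `X (some (i, j))` and `y` is `X none`. -/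
noncomputable def corePolynomialPeaks (F : Family) (k : ℕ) : MvPolynomial (Option (ℕ × ℕ)) ℚ :=
  ∑ᶠ K ∈ cores F k, MvPolynomial.C ((K.1 : ℚ)⁻¹) * MvPolynomial.X none ^ K.2.card *
    ∏ i ∈ Finset.range (K.1 + 1), ∏ j ∈ Finset.range (K.1 + 1),
      MvPolynomial.X (some (i, j)) ^ numRegionsPeaks K.2 i j

/-! ### The substituted series -/

/-- `x ∂f/∂x`. -/
noncomputable def xDiff {R : Type*} [CommRing R] (f : R⟦X⟧) : R⟦X⟧ := X * derivative R f

/-- `x^i / (i-1)! · ∂^{i-1}/∂x^{i-1} (x^{i-1} f)`, for `i ≥ 1`. -/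
noncomputable def regionSeries {R : Type*} [CommRing R] [Algebra ℚ R] (f : R⟦X⟧) (i : ℕ) : R⟦X⟧ :=
  (((i - 1).factorial : ℚ)⁻¹) • (X ^ i * (derivative R)^[i - 1] (X ^ (i - 1) * f))

/-- `(f - f^{≤ p}) / x^{p+1}`, where `f^{≤ p}` is the part of `f` of degree at most `p` in `x`. -/
noncomputable def tailQuotient {R : Type*} [CommRing R] (f : R⟦X⟧) (p : ℕ) : R⟦X⟧ :=
  PowerSeries.mk fun n => coeff (n + (p + 1)) f

theorem X_pow_mul_tailQuotient {R : Type*} [CommRing R] (f : R⟦X⟧) (p : ℕ) :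
    X ^ (p + 1) * tailQuotient f p = f - ((trunc (p + 1) f : Polynomial R) : R⟦X⟧) := by
  ext n
  rw [coeff_X_pow_mul']
  simp only [tailQuotient, coeff_mk, map_sub, Polynomial.coeff_coe, coeff_trunc]
  by_cases h : p + 1 ≤ n
  · simp [h, not_lt.mpr h]
  · simp [h, not_le.mp h]

/-- The coefficient of `x^j` in `f` if `i = 0`, and
`x^i / (i-1)! · ∂^{i-1}/∂x^{i-1} ((f - f^{≤ i+j}) / x^{i+j+1})` if `i ≥ 1`. -/
noncomputable def regionSeriesPeaks {R : Type*} [CommRing R] [Algebra ℚ R] (f : R⟦X⟧) (i j : ℕ) :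
    R⟦X⟧ :=
  if i = 0 then C (coeff j f)
  else (((i - 1).factorial : ℚ)⁻¹) •
    (X ^ i * (derivative R)^[i - 1] (tailQuotient f (i + j)))

open Classical in
/-- `1 + y` if hyperchords of size `1` are allowed by `S`, and `1` otherwise. -/
noncomputable def singletonFactor (S : Set ℕ) : ℚ⟦X⟧ := if 1 ∈ S then 1 + X else 1

/-- `(1 + δ y)^{-(i+j)} · regionSeriesPeaks f i j`, where `δ = 1` if `1 ∈ S` and `δ = 0` otherwise. -/
noncomputable def regionSeriesHyper (S : Set ℕ) (f : ℚ⟦X⟧⟦X⟧) (i j : ℕ) : ℚ⟦X⟧⟦X⟧ :=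
  C ((singletonFactor S)⁻¹ ^ (i + j)) * regionSeriesPeaks f i j

/-- Substitution in a core polynomial: `a` for the variables indexed by regions, and `y` for `y`. -/
noncomputable def substXY {ι : Type*} (P : MvPolynomial (Option ι) ℚ) (a : ι → ℚ⟦X⟧⟦X⟧) :
    ℚ⟦X⟧⟦X⟧ :=
  MvPolynomial.aeval (fun o : Option ι => o.elim yVar a) P

end ChordConfig

open ChordConfig

/-! Discard every hyperchord that crosses nothing. What remains, on the points it covers, is a core
with the same number of crossings. Conversely, a configuration is the same thing as a core, an
increasing embedding of its points, and a noncrossing completion; `sum_rooted_eq` states this for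
embeddings fixing the first point. Rotating the circle preserves crossings, so counting pairs
(configuration, point of its core) in two ways shows that c times the number of configurations whose
core has c points is n times the number of those whose first point lies on the core
(`card_mul_sum_eq`). The factor n becomes `x d/dx`, and 1/c is the weight of a core in the core
polynomial.

The completions factor over the regions of the core. A new hyperchord with at least two vertices
lies in the closure of exactly one region, flat regions included (`exists_subset_cell`,
`cell_eq_of_subset`), and hyperchords in different regions do not cross (`not_cross_of_cells`).
Hence the number of completions is a product of noncrossing counts (`fillingSum_partition`,
`fillingSum_diagram`). For partitions only the points inside the arcs of a region are available. For
diagrams a region with i arcs and j peaks offers 2i + j core points in addition. One-vertex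
hyperchords at core points would be shared by several regions, so they are split off as a factor 1 +
y for each point of the circle; this is the origin of the powers of 1 + δy. Distributing m points
over i arcs gives a binomial coefficient, that is, a derivative of order i - 1
(`sum_rooted_prod_eq`, `regionSeries_eq`, `regionSeriesPeaks_eq`). A core with k crossings has at
most 12k points (`IsCore.points_le`), whence finiteness.

For rationality, the formulas involve only ring operations, derivatives in x, coefficients of the
noncrossing series (polynomials in y) and divisions by x and 1 + y. It is therefore enough that the
derivative of the noncrossing series is a rational function of the allowed data. The product
formula, applied to a single block in place of a core, yields functional equations for noncrossing
partitions (`genSeries_partition_zero_eq`) and noncrossing diagrams (`polygonSeries_eq`). The size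
series entering them is a quotient of polynomials because sizes are eventually periodic.
Differentiating these equations gives a linear equation for the derivative whose leading factor has
constant coefficient 1. For partitions and for chord diagrams the equation is moreover linear in y,
so y itself can be eliminated.

Hyperchords carry a weight `w` in an arbitrary ring, so that the series in one variable (`w = 1`)
and in two variables (`w = y`) are instances of the same statements. -/

namespace ChordConfig

/-! ### Crossings under relabelling and rotation of the points -/

section Crossing

variable {n c : ℕ}

/-- The two orientations in `Cross` merge: `q < a` is the case where the chord of `V` has the
smallest end, `b < q` the case where the chord of `U` has it. -/
theorem cross_iff {U V : Finset (Fin n)} :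
    Cross U V ↔ ∃ a ∈ U, ∃ b ∈ U, ∃ p ∈ V, ∃ q ∈ V, (a < p ∧ p < b) ∧ (q < a ∨ b < q) := by
  simp only [Cross, orientedCrossings, Finset.Nonempty, Finset.mem_filter, Finset.mem_product]
  constructor
  · rintro (⟨⟨⟨a, b⟩, p, q⟩, ⟨⟨ha, hb⟩, hp, hq⟩, h1, h2, h3⟩ |
      ⟨⟨⟨q, p⟩, a, b⟩, ⟨⟨hq, hp⟩, ha, hb⟩, h1, h2, h3⟩)
    · exact ⟨a, ha, b, hb, p, hp, q, hq, ⟨h1, h2⟩, Or.inr h3⟩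
    · exact ⟨a, ha, b, hb, p, hp, q, hq, ⟨h2, h3⟩, Or.inl h1⟩
  · rintro ⟨a, ha, b, hb, p, hp, q, hq, ⟨h1, h2⟩, h3 | h3⟩
    · exact Or.inr ⟨⟨⟨q, p⟩, a, b⟩, ⟨⟨hq, hp⟩, ha, hb⟩, h3, h1, h2⟩
    · exact Or.inl ⟨⟨⟨a, b⟩, p, q⟩, ⟨⟨ha, hb⟩, hp, hq⟩, h1, h2, h3⟩

theorem cross_comm {U V : Finset (Fin n)} : Cross U V ↔ Cross V U := Or.comm

theorem Cross.two_le_card {U V : Finset (Fin n)} (h : Cross U V) : 2 ≤ U.card := by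
  obtain ⟨a, ha, b, hb, p, -, q, -, ⟨h1, h2⟩, -⟩ := cross_iff.1 h
  exact Finset.one_lt_card.2 ⟨a, ha, b, hb, (h1.trans h2).ne⟩

/-- The image of a configuration under an injective map of the points. -/
def mapConfig (f : Fin c ↪ Fin n) (K : Configuration c) : Configuration n :=
  K.map (Finset.mapEmbedding f).toEmbedding

theorem mem_mapConfig {f : Fin c ↪ Fin n} {K : Configuration c} {W : Finset (Fin n)} :
    W ∈ mapConfig f K ↔ ∃ U ∈ K, U.map f = W := by
  simp [mapConfig]

theorem map_mem_mapConfig {f : Fin c ↪ Fin n} {K : Configuration c} {U : Finset (Fin c)} :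
    U.map f ∈ mapConfig f K ↔ U ∈ K := by
  simp [mapConfig]

theorem card_mapConfig (f : Fin c ↪ Fin n) (K : Configuration c) :
    (mapConfig f K).card = K.card := Finset.card_map _

theorem mapConfig_injective (f : Fin c ↪ Fin n) : Function.Injective (mapConfig f) :=
  Finset.map_injective _

theorem crossingNumber_mapConfig (f : Fin c ↪ Fin n) (K : Configuration c) :
    crossingNumber (mapConfig f K) =
      ∑ U ∈ K, ∑ V ∈ K.erase U, (orientedCrossings (U.map f) (V.map f)).card := by
  simp only [crossingNumber, mapConfig, Finset.sum_map]
  refine Finset.sum_congr rfl fun U _ => ?_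
  rw [← Finset.map_erase, Finset.sum_map]
  rfl

theorem cross_map_orderEmbedding (e : Fin c ↪o Fin n) {U V : Finset (Fin c)} :
    Cross (U.map e.toEmbedding) (V.map e.toEmbedding) ↔ Cross U V := by
  simp [cross_iff, -Finset.mem_map_equiv]

theorem card_orientedCrossings_map_orderEmbedding (e : Fin c ↪o Fin n) (U V : Finset (Fin c)) :
    (orientedCrossings (U.map e.toEmbedding) (V.map e.toEmbedding)).card =
      (orientedCrossings U V).card := by
  symm
  refine Finset.card_nbij (fun p => ((e p.1.1, e p.1.2), (e p.2.1, e p.2.2))) ?_ ?_ ?_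
  · rintro ⟨⟨a, b⟩, p, q⟩ h
    simpa [orientedCrossings] using h
  · rintro ⟨⟨a, b⟩, p, q⟩ - ⟨⟨a', b'⟩, p', q'⟩ - h
    simpa [and_assoc] using h
  · rintro ⟨⟨a, b⟩, p, q⟩ h
    simp only [orientedCrossings, Finset.coe_filter, Finset.mem_product, Finset.mem_map,
      Set.mem_ofPred_eq] at h
    obtain ⟨⟨⟨⟨a, ha, rfl⟩, b, hb, rfl⟩, ⟨p, hp, rfl⟩, q, hq, rfl⟩, h⟩ := h
    refine ⟨⟨⟨a, b⟩, p, q⟩, ?_, rfl⟩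
    simpa [orientedCrossings, ha, hb, hp, hq] using h

theorem crossingNumber_mapConfig_orderEmbedding (e : Fin c ↪o Fin n) (K : Configuration c) :
    crossingNumber (mapConfig e.toEmbedding K) = crossingNumber K := by
  simp only [crossingNumber_mapConfig, card_orientedCrossings_map_orderEmbedding]
  rfl

/-! ### Rotation -/

theorem sum_erase_comm {α : Type*} [DecidableEq α] (s : Finset α) (f : α → α → ℕ) :
    ∑ U ∈ s, ∑ V ∈ s.erase U, f V U = ∑ U ∈ s, ∑ V ∈ s.erase U, f U V := by
  refine Finset.sum_comm' fun x y => ?_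
  simp only [Finset.mem_erase, ne_eq]
  tauto

/-- Rotation may exchange the two orientations of a crossing, so only this symmetrised count can be
compared pair by pair. -/
theorem two_mul_crossingNumber (C : Configuration n) :
    2 * crossingNumber C = ∑ U ∈ C, ∑ V ∈ C.erase U,
      ((orientedCrossings U V).card + (orientedCrossings V U).card) := by
  simp only [Finset.sum_add_distrib]
  rw [sum_erase_comm C fun U V => (orientedCrossings U V).card, two_mul]
  rfl

theorem finRotate_lt_finRotate {a b : Fin (n + 1)} (hb : b ≠ Fin.last n) :
    finRotate (n + 1) a < finRotate (n + 1) b ↔ a < b ∨ a = Fin.last n := by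
  rw [Fin.lt_def, Fin.lt_def, coe_finRotate, coe_finRotate, if_neg hb]
  split_ifs with ha
  · simp [ha]
  · simp [ha]

theorem not_lt_finRotate_last (a : Fin (n + 1)) :
    ¬ a < finRotate (n + 1) (Fin.last n) := by
  rw [finRotate_last]; exact Fin.not_lt_zero a

theorem finRotate_eq_zero {a : Fin (n + 1)} : finRotate (n + 1) a = 0 ↔ a = Fin.last n := by
  rw [← finRotate_last, (finRotate (n + 1)).injective.eq_iff]

theorem finRotate_last_lt {a : Fin (n + 1)} :
    finRotate (n + 1) (Fin.last n) < finRotate (n + 1) a ↔ a ≠ Fin.last n := by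
  rw [finRotate_last, Fin.pos_iff_ne_zero, Ne, finRotate_eq_zero]

/-- Rotation preserves the order of all points but the last one. A crossing whose largest end is not
the last point keeps its orientation, and its smallest end moves away from the first point. -/
theorem card_orientedCrossings_rotate_ne (U V : Finset (Fin (n + 1))) :
    ((orientedCrossings (U.map (finRotate (n + 1)).toEmbedding)
      (V.map (finRotate (n + 1)).toEmbedding)).filter fun p => p.1.1 ≠ 0).card =
    ((orientedCrossings U V).filter fun p => p.2.2 ≠ Fin.last n).card := by
  set r := finRotate (n + 1) with hr
  symm
  refine Finset.card_nbij (fun p => ((r p.1.1, r p.1.2), (r p.2.1, r p.2.2))) ?_ ?_ ?_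
  · rintro ⟨⟨a, b⟩, p, q⟩ h
    simp only [orientedCrossings, Finset.coe_filter, Finset.mem_filter, Finset.mem_product,
      Set.mem_ofPred_eq, Finset.mem_map_equiv, Equiv.symm_apply_apply] at h ⊢
    obtain ⟨⟨hm, h1, h2, h3⟩, hq⟩ := h
    have hb := (h3.trans_le (Fin.le_last q)).ne
    have hp := (h2.trans_le (Fin.le_last b)).ne
    have ha := (h1.trans_le (Fin.le_last p)).ne
    refine ⟨⟨hm, ?_, ?_, ?_⟩, ?_⟩
    · exact (finRotate_lt_finRotate hp).2 (Or.inl h1)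
    · exact (finRotate_lt_finRotate hb).2 (Or.inl h2)
    · exact (finRotate_lt_finRotate hq).2 (Or.inl h3)
    · rwa [Ne, finRotate_eq_zero]
  · rintro ⟨⟨a, b⟩, p, q⟩ - ⟨⟨a', b'⟩, p', q'⟩ - h
    simpa [and_assoc] using h
  · rintro ⟨⟨a, b⟩, p, q⟩ h
    simp only [orientedCrossings, Finset.coe_filter, Finset.mem_filter, Finset.mem_product,
      Set.mem_ofPred_eq, Finset.mem_map] at h
    obtain ⟨⟨⟨⟨⟨a, ha, rfl⟩, b, hb, rfl⟩, ⟨p, hp, rfl⟩, q, hq, rfl⟩, h1, h2, h3⟩, h0⟩ := h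
    simp only [Equiv.coe_toEmbedding] at h1 h2 h3 h0
    rw [Ne, finRotate_eq_zero] at h0
    have hql : q ≠ Fin.last n := by rintro rfl; exact not_lt_finRotate_last _ h3
    have hbl : b ≠ Fin.last n := by rintro rfl; exact not_lt_finRotate_last _ h2
    have hpl : p ≠ Fin.last n := by rintro rfl; exact not_lt_finRotate_last _ h1
    rw [finRotate_lt_finRotate hpl] at h1
    rw [finRotate_lt_finRotate hbl] at h2
    rw [finRotate_lt_finRotate hql] at h3
    refine ⟨⟨⟨a, b⟩, p, q⟩, ?_, rfl⟩
    simp only [orientedCrossings, Finset.coe_filter, Finset.mem_filter, Finset.mem_product,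
      Set.mem_ofPred_eq]
    exact ⟨⟨⟨⟨ha, hb⟩, hp, hq⟩, h1.resolve_right h0, h2.resolve_right hpl,
      h3.resolve_right hbl⟩, hql⟩

/-- If the largest end is the last point, rotation makes it the smallest end. The chord through it
then comes first, which exchanges the roles of the two hyperchords. -/
theorem card_orientedCrossings_rotate_eq (U V : Finset (Fin (n + 1))) :
    ((orientedCrossings (U.map (finRotate (n + 1)).toEmbedding)
      (V.map (finRotate (n + 1)).toEmbedding)).filter fun p => ¬ p.1.1 ≠ 0).card =
    ((orientedCrossings V U).filter fun p => ¬ p.2.2 ≠ Fin.last n).card := by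
  set r := finRotate (n + 1) with hr
  symm
  refine Finset.card_nbij (fun p => ((r p.2.2, r p.2.1), (r p.1.1, r p.1.2))) ?_ ?_ ?_
  · rintro ⟨⟨a, b⟩, p, q⟩ h
    simp only [orientedCrossings, Finset.coe_filter, Finset.mem_filter, Finset.mem_product,
      Set.mem_ofPred_eq, Finset.mem_map_equiv, Equiv.symm_apply_apply, not_not] at h ⊢
    obtain ⟨⟨⟨⟨ha', hb'⟩, hp', hq'⟩, h1, h2, h3⟩, rfl⟩ := h
    have hb := h3.ne
    have hp := (h2.trans_le (Fin.le_last b)).ne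
    have ha := (h1.trans_le (Fin.le_last p)).ne
    refine ⟨⟨⟨⟨hq', hp'⟩, ha', hb'⟩, ?_, ?_, ?_⟩, ?_⟩
    · exact finRotate_last_lt.2 ha
    · exact (finRotate_lt_finRotate hp).2 (Or.inl h1)
    · exact (finRotate_lt_finRotate hb).2 (Or.inl h2)
    · exact finRotate_last
  · rintro ⟨⟨a, b⟩, p, q⟩ - ⟨⟨a', b'⟩, p', q'⟩ - h
    simp only [Prod.mk.injEq, EmbeddingLike.apply_eq_iff_eq] at h ⊢
    tauto
  · rintro ⟨⟨a, b⟩, p, q⟩ h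
    simp only [orientedCrossings, Finset.coe_filter, Finset.mem_filter, Finset.mem_product,
      Set.mem_ofPred_eq, Finset.mem_map, not_not] at h
    obtain ⟨⟨⟨⟨⟨a, ha, rfl⟩, b, hb, rfl⟩, ⟨p, hp, rfl⟩, q, hq, rfl⟩, h1, h2, h3⟩, h0⟩ := h
    simp only [Equiv.coe_toEmbedding] at h1 h2 h3 h0
    rw [finRotate_eq_zero] at h0
    have hql : q ≠ Fin.last n := by rintro rfl; exact not_lt_finRotate_last _ h3
    have hbl : b ≠ Fin.last n := by rintro rfl; exact not_lt_finRotate_last _ h2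
    have hpl : p ≠ Fin.last n := by rintro rfl; exact not_lt_finRotate_last _ h1
    rw [finRotate_lt_finRotate hbl] at h2
    rw [finRotate_lt_finRotate hql] at h3
    subst h0
    refine ⟨⟨⟨p, q⟩, b, Fin.last n⟩, ?_, rfl⟩
    simp only [orientedCrossings, Finset.coe_filter, Finset.mem_filter, Finset.mem_product,
      Set.mem_ofPred_eq, not_not, and_true]
    exact ⟨⟨⟨hp, hq⟩, hb, ha⟩, h2.resolve_right hpl, h3.resolve_right hbl,
      lt_of_le_of_ne (Fin.le_last q) hql⟩

theorem card_orientedCrossings_rotate (U V : Finset (Fin (n + 1))) :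
    (orientedCrossings (U.map (finRotate (n + 1)).toEmbedding)
        (V.map (finRotate (n + 1)).toEmbedding)).card +
      (orientedCrossings (V.map (finRotate (n + 1)).toEmbedding)
        (U.map (finRotate (n + 1)).toEmbedding)).card =
    (orientedCrossings U V).card + (orientedCrossings V U).card := by
  have key : ∀ U V : Finset (Fin (n + 1)),
      (orientedCrossings (U.map (finRotate (n + 1)).toEmbedding)
        (V.map (finRotate (n + 1)).toEmbedding)).card =
      ((orientedCrossings U V).filter fun p => p.2.2 ≠ Fin.last n).card +
      ((orientedCrossings V U).filter fun p => ¬ p.2.2 ≠ Fin.last n).card := fun U V => by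
    rw [← card_orientedCrossings_rotate_ne, ← card_orientedCrossings_rotate_eq,
      Finset.card_filter_add_card_filter_not]
  have h1 := Finset.card_filter_add_card_filter_not (s := orientedCrossings U V)
    (fun p => p.2.2 ≠ Fin.last n)
  have h2 := Finset.card_filter_add_card_filter_not (s := orientedCrossings V U)
    (fun p => p.2.2 ≠ Fin.last n)
  rw [key U V, key V U]
  omega

theorem crossingNumber_rotate (C : Configuration (n + 1)) :
    crossingNumber (mapConfig (finRotate (n + 1)).toEmbedding C) = crossingNumber C := by
  have h1 := two_mul_crossingNumber C
  have h2 := crossingNumber_mapConfig (finRotate (n + 1)).toEmbedding C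
  have h3 := sum_erase_comm C fun U V =>
    (orientedCrossings (U.map (finRotate (n + 1)).toEmbedding)
        (V.map (finRotate (n + 1)).toEmbedding)).card
  have h4 : ∑ U ∈ C, ∑ V ∈ C.erase U,
      ((orientedCrossings (U.map (finRotate (n + 1)).toEmbedding)
        (V.map (finRotate (n + 1)).toEmbedding)).card +
      (orientedCrossings (V.map (finRotate (n + 1)).toEmbedding)
        (U.map (finRotate (n + 1)).toEmbedding)).card) = 2 * crossingNumber C := by
    rw [h1]
    simp only [card_orientedCrossings_rotate]
  simp only [Finset.sum_add_distrib] at h4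
  omega

theorem cross_rotate {U V : Finset (Fin (n + 1))} :
    Cross (U.map (finRotate (n + 1)).toEmbedding) (V.map (finRotate (n + 1)).toEmbedding) ↔
      Cross U V := by
  have h := card_orientedCrossings_rotate U V
  simp only [Cross, ← Finset.card_pos]
  omega

end Crossing

end ChordConfig

namespace ChordConfig

/-! ### Splitting a configuration into its core, an embedding and a completion -/

section CoreDecomposition

variable {n c : ℕ}

/-- No two distinct hyperchords cross. -/
def NonCrossing (D : Configuration n) : Prop := ∀ U ∈ D, ∀ V ∈ D, V ≠ U → ¬ Cross U V

/-- The set of points that lie on a hyperchord. -/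
def support (C : Configuration n) : Finset (Fin n) := C.biUnion id

theorem mem_support {C : Configuration n} {v : Fin n} : v ∈ support C ↔ ∃ U ∈ C, v ∈ U := by
  simp [support]

open Classical in
/-- The hyperchords that are involved in a crossing. -/
noncomputable def coreOf (C : Configuration n) : Configuration n :=
  C.filter fun U => ∃ V ∈ C, V ≠ U ∧ Cross U V

theorem mem_coreOf {C : Configuration n} {U : Finset (Fin n)} :
    U ∈ coreOf C ↔ U ∈ C ∧ ∃ V ∈ C, V ≠ U ∧ Cross U V := by
  simp [coreOf]

theorem coreOf_subset (C : Configuration n) : coreOf C ⊆ C := fun _ h => (mem_coreOf.1 h).1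

theorem card_orientedCrossings_eq_zero {U V : Finset (Fin n)} (h : ¬ Cross U V) :
    (orientedCrossings U V).card = 0 := by
  rw [Finset.card_eq_zero, ← Finset.not_nonempty_iff_eq_empty]
  exact fun h' => h (Or.inl h')

theorem mem_coreOf_of_cross {C : Configuration n} {U V : Finset (Fin n)} (hU : U ∈ C) (hV : V ∈ C)
    (hne : V ≠ U) (h : Cross U V) : U ∈ coreOf C ∧ V ∈ coreOf C :=
  ⟨mem_coreOf.2 ⟨hU, V, hV, hne, h⟩, mem_coreOf.2 ⟨hV, U, hU, hne.symm, cross_comm.1 h⟩⟩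

/-- Both members of a crossing pair belong to the core, so all the discarded terms vanish. -/
theorem crossingNumber_coreOf (C : Configuration n) :
    crossingNumber (coreOf C) = crossingNumber C := by
  refine (Finset.sum_congr rfl fun U hU => ?_).trans
    (Finset.sum_subset (coreOf_subset C) fun U hU hU' => ?_)
  · refine Finset.sum_subset (Finset.erase_subset_erase U (coreOf_subset C)) fun V hV hV' => ?_
    refine card_orientedCrossings_eq_zero fun h => hV' ?_
    rw [Finset.mem_erase] at hV ⊢
    exact ⟨hV.1, (mem_coreOf_of_cross (mem_coreOf.1 hU).1 hV.2 hV.1 h).2⟩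
  · refine Finset.sum_eq_zero fun V hV => card_orientedCrossings_eq_zero fun h => hU' ?_
    rw [Finset.mem_erase] at hV
    exact (mem_coreOf_of_cross hU hV.2 hV.1 h).1

theorem crossingNumber_eq_zero_iff {C : Configuration n} :
    crossingNumber C = 0 ↔ NonCrossing C := by
  constructor
  · intro h U hU V hV hne hc
    simp only [crossingNumber, Finset.sum_eq_zero_iff, Finset.card_eq_zero] at h
    rcases hc with hc | hc
    · exact hc.ne_empty (h U hU V (Finset.mem_erase.2 ⟨hne, hV⟩))
    · exact hc.ne_empty (h V hV U (Finset.mem_erase.2 ⟨hne.symm, hU⟩))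
  · intro h
    refine Finset.sum_eq_zero fun U hU => Finset.sum_eq_zero fun V hV => ?_
    rw [Finset.mem_erase] at hV
    exact card_orientedCrossings_eq_zero (h U hU V hV.2 hV.1)

theorem coreOf_mapConfig {f : Fin c ↪ Fin n}
    (hf : ∀ U V : Finset (Fin c), Cross (U.map f) (V.map f) ↔ Cross U V) (C : Configuration c) :
    coreOf (mapConfig f C) = mapConfig f (coreOf C) := by
  ext W
  simp only [mem_coreOf, mem_mapConfig]
  constructor
  · rintro ⟨⟨U, hU, rfl⟩, _, ⟨V, hV, rfl⟩, hne, h⟩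
    exact ⟨U, ⟨hU, V, hV, fun h' => hne (h' ▸ rfl), (hf U V).1 h⟩, rfl⟩
  · rintro ⟨U, ⟨hU, V, hV, hne, h⟩, rfl⟩
    exact ⟨⟨U, hU, rfl⟩, _, ⟨V, hV, rfl⟩, fun h' => hne (Finset.map_injective f h'),
      (hf U V).2 h⟩

theorem support_mapConfig (f : Fin c ↪ Fin n) (C : Configuration c) :
    support (mapConfig f C) = (support C).map f := by
  ext v
  simp only [mem_support, mem_mapConfig, Finset.mem_map]
  constructor
  · rintro ⟨_, ⟨U, hU, rfl⟩, hv⟩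
    obtain ⟨a, ha, rfl⟩ := Finset.mem_map.1 hv
    exact ⟨a, ⟨U, hU, ha⟩, rfl⟩
  · rintro ⟨a, ⟨U, hU, ha⟩, rfl⟩
    exact ⟨_, ⟨U, hU, rfl⟩, Finset.mem_map_of_mem f ha⟩

/-- All sizes of hyperchords of `D` belong to `S` and, if `part` holds, `D` is a partition of `A`.
-/
structure IsFilling (part : Prop) (S : Set ℕ) (A : Finset (Fin n)) (D : Configuration n) :
    Prop where
  card_mem : ∀ W ∈ D, W.card ∈ S
  subset : part → ∀ W ∈ D, W ⊆ A
  disjoint : part → ∀ W ∈ D, ∀ W' ∈ D, W' ≠ W → Disjoint W W'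
  cover : part → ∀ v ∈ A, ∃ W ∈ D, v ∈ W

/-- `D` is noncrossing, and its hyperchords neither cross nor belong to the image of `K`. -/
structure Compatible (K : Configuration c) (e : Fin c ↪o Fin n) (D : Configuration n) :
    Prop where
  nonCrossing : NonCrossing D
  not_cross : ∀ W ∈ D, ∀ U ∈ K, ¬ Cross W (U.map e.toEmbedding)
  notMem : ∀ W ∈ D, W ∉ mapConfig e.toEmbedding K

open Classical in
/-- The sum of `w ^ |D|` over the sets `D` of hyperchords that complete the image of `K`. -/
noncomputable def fillingSum {R : Type*} [CommRing R] (part : Prop) (S : Set ℕ) (w : R)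
    (K : Configuration c) (e : Fin c ↪o Fin n) : R :=
  ∑ D : Configuration n with
    Compatible K e D ∧ IsFilling part S (Finset.univ.map e.toEmbedding)ᶜ D, w ^ D.card

theorem isFilling_mapConfig_equiv {part : Prop} {S : Set ℕ} (f : Fin n ≃ Fin n)
    {C : Configuration n} :
    IsFilling part S Finset.univ (mapConfig f.toEmbedding C) ↔
      IsFilling part S Finset.univ C := by
  constructor
  · rintro ⟨h1, h2, h3, h4⟩
    refine ⟨fun W hW => ?_, fun _ _ _ => Finset.subset_univ _, fun hp W hW W' hW' hne => ?_,
      fun hp v _ => ?_⟩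
    · simpa using h1 _ (map_mem_mapConfig.2 hW)
    · simpa using h3 hp _ (map_mem_mapConfig.2 hW) _ (map_mem_mapConfig.2 hW')
        (fun h => hne (Finset.map_injective _ h))
    · obtain ⟨W, hW, hv⟩ := h4 hp (f v) (Finset.mem_univ _)
      obtain ⟨U, hU, rfl⟩ := mem_mapConfig.1 hW
      exact ⟨U, hU, by simpa using hv⟩
  · rintro ⟨h1, h2, h3, h4⟩
    refine ⟨fun W hW => ?_, fun _ _ _ => Finset.subset_univ _, fun hp W hW W' hW' hne => ?_,
      fun hp v _ => ?_⟩
    · obtain ⟨U, hU, rfl⟩ := mem_mapConfig.1 hW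
      simpa using h1 _ hU
    · obtain ⟨U, hU, rfl⟩ := mem_mapConfig.1 hW
      obtain ⟨U', hU', rfl⟩ := mem_mapConfig.1 hW'
      simpa using h3 hp U hU U' hU' (fun h => hne (h ▸ rfl))
    · obtain ⟨W, hW, hv⟩ := h4 hp (f.symm v) (Finset.mem_univ _)
      exact ⟨_, map_mem_mapConfig.2 hW, by simpa using hv⟩

/-- For partitions, the blocks of `K` already cover the whole image of `e`, so the remaining blocks
must form a partition of its complement. For diagrams only the sizes matter. -/
theorem isFilling_union_iff {part : Prop} {S : Set ℕ} {K : Configuration c} {e : Fin c ↪o Fin n}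
    {D : Configuration n} (hK : ∀ v : Fin c, ∃ U ∈ K, v ∈ U)
    (hD : ∀ W ∈ D, W ∉ mapConfig e.toEmbedding K) :
    IsFilling part S Finset.univ (mapConfig e.toEmbedding K ∪ D) ↔
      IsFilling part S Finset.univ K ∧
        IsFilling part S (Finset.univ.map e.toEmbedding)ᶜ D := by
  constructor
  · rintro ⟨h1, h2, h3, h4⟩
    have hl : ∀ {U}, U ∈ K → U.map e.toEmbedding ∈ mapConfig e.toEmbedding K ∪ D := fun hU =>
      Finset.mem_union_left _ (map_mem_mapConfig.2 hU)
    have hr : ∀ {W}, W ∈ D → W ∈ mapConfig e.toEmbedding K ∪ D := fun hU =>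
      Finset.mem_union_right _ hU
    have hdis : part → ∀ W ∈ D, W ⊆ (Finset.univ.map e.toEmbedding)ᶜ := by
      intro hp W hW v hv
      rw [Finset.mem_compl, Finset.mem_map]
      rintro ⟨a, -, rfl⟩
      obtain ⟨U, hU, ha⟩ := hK a
      have := h3 hp _ (hl hU) W (hr hW) (fun h => hD W hW (h ▸ map_mem_mapConfig.2 hU))
      exact Finset.disjoint_left.1 this (Finset.mem_map_of_mem _ ha) hv
    refine ⟨⟨fun W hW => ?_, fun _ _ _ => Finset.subset_univ _, fun hp W hW W' hW' hne => ?_,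
      fun _ v _ => hK v⟩, ⟨fun W hW => h1 W (hr hW), hdis,
      fun hp W hW W' hW' hne => h3 hp W (hr hW) W' (hr hW') hne, fun hp v hv => ?_⟩⟩
    · simpa using h1 _ (hl hW)
    · simpa using h3 hp _ (hl hW) _ (hl hW') (fun h => hne (Finset.map_injective _ h))
    · obtain ⟨W, hW, hvW⟩ := h4 hp v (Finset.mem_univ _)
      rcases Finset.mem_union.1 hW with hW | hW
      · obtain ⟨U, hU, rfl⟩ := mem_mapConfig.1 hW
        obtain ⟨a, ha, rfl⟩ := Finset.mem_map.1 hvW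
        simp at hv
      · exact ⟨W, hW, hvW⟩
  · rintro ⟨⟨h1, h2, h3, h4⟩, ⟨g1, g2, g3, g4⟩⟩
    have hdis : part → ∀ U ∈ K, ∀ W ∈ D, Disjoint (U.map e.toEmbedding) W := by
      intro hp U hU W hW
      rw [Finset.disjoint_left]
      intro v hv hv'
      have := g2 hp W hW hv'
      obtain ⟨a, ha, rfl⟩ := Finset.mem_map.1 hv
      simp at this
    refine ⟨fun W hW => ?_, fun _ _ _ => Finset.subset_univ _, fun hp W hW W' hW' hne => ?_,
      fun hp v _ => ?_⟩
    · rcases Finset.mem_union.1 hW with hW | hW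
      · obtain ⟨U, hU, rfl⟩ := mem_mapConfig.1 hW
        simpa using h1 U hU
      · exact g1 W hW
    · rcases Finset.mem_union.1 hW with hW | hW <;> rcases Finset.mem_union.1 hW' with hW' | hW'
      · obtain ⟨U, hU, rfl⟩ := mem_mapConfig.1 hW
        obtain ⟨U', hU', rfl⟩ := mem_mapConfig.1 hW'
        simpa using h3 hp U hU U' hU' (fun h => hne (h ▸ rfl))
      · obtain ⟨U, hU, rfl⟩ := mem_mapConfig.1 hW
        exact hdis hp U hU W' hW'
      · obtain ⟨U, hU, rfl⟩ := mem_mapConfig.1 hW'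
        exact (hdis hp U hU W hW).symm
      · exact g3 hp W hW W' hW' hne
    · by_cases hv : v ∈ Finset.univ.map e.toEmbedding
      · obtain ⟨a, -, rfl⟩ := Finset.mem_map.1 hv
        obtain ⟨U, hU, ha⟩ := hK a
        exact ⟨_, Finset.mem_union_left _ (map_mem_mapConfig.2 hU), Finset.mem_map_of_mem _ ha⟩
      · obtain ⟨W, hW, hvW⟩ := g4 hp v (Finset.mem_compl.2 hv)
        exact ⟨W, Finset.mem_union_right _ hW, hvW⟩

theorem support_eq_univ {K : Configuration c} (hK : IsCore K) : support K = Finset.univ := by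
  ext v
  simpa [mem_support] using hK.2 v

/-- Nothing in `D` is crossed, while each hyperchord of `K` is already crossed inside `K`. This
makes the decomposition unique: the core can be read off the union. -/
theorem coreOf_union {K : Configuration c} (hK : IsCore K) {e : Fin c ↪o Fin n}
    {D : Configuration n} (hD : Compatible K e D) :
    coreOf (mapConfig e.toEmbedding K ∪ D) = mapConfig e.toEmbedding K := by
  ext W
  constructor
  · intro h
    obtain ⟨h, V, hV, hne, hc⟩ := mem_coreOf.1 h
    rcases Finset.mem_union.1 h with h | h
    · exact h
    · exfalso
      rcases Finset.mem_union.1 hV with hV | hV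
      · obtain ⟨U, hU, rfl⟩ := mem_mapConfig.1 hV
        exact hD.not_cross W h U hU hc
      · exact hD.nonCrossing W h V hV hne hc
  · intro h
    obtain ⟨U, hU, rfl⟩ := mem_mapConfig.1 h
    obtain ⟨V, hV, hne, hc⟩ := hK.1 U hU
    exact mem_coreOf.2 ⟨Finset.mem_union_left _ h, _,
      Finset.mem_union_left _ (map_mem_mapConfig.2 hV), fun h => hne (Finset.map_injective _ h),
      (cross_map_orderEmbedding e).2 hc⟩

/-- The first point is sent to the first point. -/
def Rooted (e : Fin c ↪o Fin n) : Prop := ∀ a : Fin c, (a : ℕ) = 0 → (e a : ℕ) = 0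

theorem orderEmbedding_eq_of_map_univ_eq {e e' : Fin c ↪o Fin n}
    (h : Finset.univ.map e.toEmbedding = Finset.univ.map e'.toEmbedding) : e = e' := by
  have key : ∀ f : Fin c ↪o Fin n, ∀ hf : (Finset.univ.map e.toEmbedding).card = c,
      Finset.univ.map f.toEmbedding = Finset.univ.map e.toEmbedding →
      f = (Finset.univ.map e.toEmbedding).orderEmbOfFin hf := by
    intro f hf hmap
    refine Finset.orderEmbOfFin_unique' hf fun x => ?_
    rw [← hmap]
    exact Finset.mem_map_of_mem f.toEmbedding (Finset.mem_univ x)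
  exact (key e (by simp) rfl).trans (key e' (by simp) h.symm).symm

theorem exists_mapConfig_eq {C : Configuration n} (e : Fin c ↪o Fin n)
    (h : ∀ U ∈ C, U ⊆ Finset.univ.map e.toEmbedding) :
    ∃ K : Configuration c, mapConfig e.toEmbedding K = C := by
  classical
  refine ⟨Finset.univ.filter fun U => U.map e.toEmbedding ∈ C, ?_⟩
  ext W
  rw [mem_mapConfig]
  constructor
  · rintro ⟨U, hU, rfl⟩
    exact (Finset.mem_filter.1 hU).2
  · intro hW
    obtain ⟨U, -, rfl⟩ := Finset.subset_map_iff.1 (h W hW)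
    exact ⟨U, Finset.mem_filter.2 ⟨Finset.mem_univ _, hW⟩, rfl⟩

theorem isCore_of_mapConfig_eq {C : Configuration n} {e : Fin c ↪o Fin n} {K : Configuration c}
    (hK : mapConfig e.toEmbedding K = coreOf C)
    (he : Finset.univ.map e.toEmbedding = support (coreOf C)) : IsCore K := by
  constructor
  · intro U hU
    have hU' : U.map e.toEmbedding ∈ coreOf C := hK ▸ map_mem_mapConfig.2 hU
    obtain ⟨hUC, V, hV, hne, hc⟩ := mem_coreOf.1 hU'
    have := (mem_coreOf_of_cross hUC hV hne hc).2
    rw [← hK, mem_mapConfig] at this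
    obtain ⟨V, hVK, rfl⟩ := this
    exact ⟨V, hVK, fun h => hne (h ▸ rfl), (cross_map_orderEmbedding e).1 hc⟩
  · intro v
    have : e v ∈ support (coreOf C) :=
      he ▸ Finset.mem_map_of_mem e.toEmbedding (Finset.mem_univ v)
    rw [← hK, support_mapConfig] at this
    obtain ⟨v', hv', h⟩ := Finset.mem_map.1 this
    rw [← mem_support]
    rwa [← e.injective h]

open Classical in
/-- A configuration whose first point lies on its core is the same as its core, the position of
the points of the core, and a completion. -/
theorem sum_rooted_eq {R : Type*} [CommRing R] (part : Prop) (S : Set ℕ) (w : R) (k n c : ℕ) :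
    ∑ C : Configuration n with (IsFilling part S Finset.univ C ∧ crossingNumber C = k) ∧
        (support (coreOf C)).card = c + 1 ∧ ∃ v ∈ support (coreOf C), (v : ℕ) = 0,
      w ^ C.card =
    ∑ K : Configuration (c + 1) with
        IsFilling part S Finset.univ K ∧ IsCore K ∧ crossingNumber K = k,
      w ^ K.card * ∑ e : Fin (c + 1) ↪o Fin n with Rooted e, fillingSum part S w K e := by
  simp only [fillingSum, Finset.mul_sum]
  simp only [Finset.sum_sigma']
  symm
  refine Finset.sum_bij (fun x _ => mapConfig x.2.1.toEmbedding x.1 ∪ x.2.2) ?_ ?_ ?_ ?_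
  · rintro ⟨K, e, D⟩ h
    simp only [Finset.mem_sigma, Finset.mem_filter, Finset.mem_univ, true_and] at h ⊢
    obtain ⟨⟨h1, h2, h3⟩, h4, h5, h6⟩ := h
    have hsup : support (coreOf (mapConfig e.toEmbedding K ∪ D)) =
        Finset.univ.map e.toEmbedding := by
      rw [coreOf_union h2 h5, support_mapConfig, support_eq_univ h2]
    refine ⟨⟨(isFilling_union_iff h2.2 h5.notMem).2 ⟨h1, h6⟩, ?_⟩, ?_, ?_⟩
    · rw [← crossingNumber_coreOf, coreOf_union h2 h5, crossingNumber_mapConfig_orderEmbedding, h3]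
    · rw [hsup]; simp
    · exact ⟨e 0, hsup ▸ Finset.mem_map_of_mem e.toEmbedding (Finset.mem_univ _), h4 0 rfl⟩
  · rintro ⟨K, e, D⟩ h ⟨K', e', D'⟩ h' heq
    simp only [Finset.mem_sigma, Finset.mem_filter, Finset.mem_univ, true_and] at h h' heq
    obtain ⟨⟨h1, h2, h3⟩, h4, h5, h6⟩ := h
    obtain ⟨⟨h1', h2', h3'⟩, h4', h5', h6'⟩ := h'
    have hc := congrArg coreOf heq
    rw [coreOf_union h2 h5, coreOf_union h2' h5'] at hc
    have he : e = e' := by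
      apply orderEmbedding_eq_of_map_univ_eq
      have := congrArg support hc
      rwa [support_mapConfig, support_mapConfig, support_eq_univ h2, support_eq_univ h2'] at this
    subst he
    have hKK := mapConfig_injective _ hc
    subst hKK
    have hd : ∀ {D : Configuration n}, (∀ W ∈ D, W ∉ mapConfig e.toEmbedding K) →
        (mapConfig e.toEmbedding K ∪ D) \ mapConfig e.toEmbedding K = D := fun {D} hD => by
      rw [Finset.union_sdiff_left, Finset.sdiff_eq_self_iff_disjoint, Finset.disjoint_left]
      exact hD
    have hDD : D = D' := by rw [← hd h5.notMem, heq, hd h5'.notMem]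
    rw [hDD]
  · intro C hC
    simp only [Finset.mem_filter, Finset.mem_univ, true_and] at hC
    obtain ⟨⟨h1, h2⟩, h3, v, hv, hv0⟩ := hC
    -- The embedding is the increasing enumeration of the points of the core.
    have he : Finset.univ.map ((support (coreOf C)).orderEmbOfFin h3).toEmbedding =
        support (coreOf C) := by
      apply Finset.coe_injective
      simp
    set e := (support (coreOf C)).orderEmbOfFin h3
    obtain ⟨K, hK⟩ := exists_mapConfig_eq (C := coreOf C) e fun U hU => by
      rw [he]
      exact fun v hv => mem_support.2 ⟨U, hU, hv⟩
    have hcore : IsCore K := isCore_of_mapConfig_eq hK he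
    have hunion : mapConfig e.toEmbedding K ∪ (C \ coreOf C) = C := by
      rw [hK, Finset.union_sdiff_of_subset (coreOf_subset C)]
    have hcomp : Compatible K e (C \ coreOf C) := by
      have hnot : ∀ W ∈ C \ coreOf C, ∀ V ∈ C, V ≠ W → ¬ Cross W V := fun W hW V hV hne hc =>
        (Finset.mem_sdiff.1 hW).2 (mem_coreOf_of_cross (Finset.mem_sdiff.1 hW).1 hV hne hc).1
      refine ⟨fun U hU V hV hne => hnot U hU V (Finset.mem_sdiff.1 hV).1 hne, fun W hW U hU => ?_,
        fun W hW => ?_⟩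
      · have hUc : U.map e.toEmbedding ∈ coreOf C := hK ▸ map_mem_mapConfig.2 hU
        exact hnot W hW _ (coreOf_subset C hUc)
          fun h => (Finset.mem_sdiff.1 hW).2 (h ▸ hUc)
      · rw [hK]; exact (Finset.mem_sdiff.1 hW).2
    have hfill := (isFilling_union_iff (part := part) (S := S) hcore.2 hcomp.notMem).1
      (hunion.symm ▸ h1)
    refine ⟨⟨K, e, C \ coreOf C⟩, ?_, hunion⟩
    simp only [Finset.mem_sigma, Finset.mem_filter, Finset.mem_univ, true_and]
    refine ⟨⟨hfill.1, hcore, ?_⟩, ?_, hcomp, hfill.2⟩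
    · rw [← h2, ← crossingNumber_coreOf C, ← hK, crossingNumber_mapConfig_orderEmbedding]
    -- The first point lies in the image, and an increasing map takes its least value at index 0.
    · intro a ha
      rw [← he] at hv
      obtain ⟨b, -, rfl⟩ := Finset.mem_map.1 hv
      have : e a ≤ e b := e.monotone (Fin.le_def.2 (by omega))
      have := Fin.le_def.1 this
      simp only [RelEmbedding.coe_toEmbedding] at hv0
      omega
  · rintro ⟨K, e, D⟩ h
    simp only [Finset.mem_sigma, Finset.mem_filter, Finset.mem_univ, true_and] at h
    obtain ⟨⟨h1, h2, h3⟩, h4, h5, h6⟩ := h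
    rw [Finset.card_union_of_disjoint, card_mapConfig, pow_add]
    rw [Finset.disjoint_right]
    exact h5.notMem

-- Rotation is a bijection of configurations that commutes with taking cores and moves `v` to the
-- next point. Iterating it makes the sum independent of `v`.
open Classical in
theorem sum_rotate {R : Type*} [CommRing R] (part : Prop) (S : Set ℕ) (w : R) (k n c : ℕ)
    (v : Fin (n + 1)) :
    ∑ C : Configuration (n + 1) with (IsFilling part S Finset.univ C ∧ crossingNumber C = k) ∧
        (support (coreOf C)).card = c ∧ v ∈ support (coreOf C), w ^ C.card =
    ∑ C : Configuration (n + 1) with (IsFilling part S Finset.univ C ∧ crossingNumber C = k) ∧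
        (support (coreOf C)).card = c ∧ finRotate (n + 1) v ∈ support (coreOf C), w ^ C.card := by
  have hsup : ∀ C : Configuration (n + 1),
      support (coreOf (mapConfig (finRotate (n + 1)).toEmbedding C)) =
        (support (coreOf C)).map (finRotate (n + 1)).toEmbedding := fun C => by
    rw [coreOf_mapConfig (fun U V => cross_rotate), support_mapConfig]
  have hmem : ∀ C : Configuration (n + 1),
      ((IsFilling part S Finset.univ (mapConfig (finRotate (n + 1)).toEmbedding C) ∧
        crossingNumber (mapConfig (finRotate (n + 1)).toEmbedding C) = k) ∧
      (support (coreOf (mapConfig (finRotate (n + 1)).toEmbedding C))).card = c ∧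
        finRotate (n + 1) v ∈ support (coreOf (mapConfig (finRotate (n + 1)).toEmbedding C))) ↔
      ((IsFilling part S Finset.univ C ∧ crossingNumber C = k) ∧
        (support (coreOf C)).card = c ∧ v ∈ support (coreOf C)) := fun C => by
    rw [hsup, Finset.card_map, crossingNumber_rotate, isFilling_mapConfig_equiv]
    simp
  refine Finset.sum_bij (fun C _ => mapConfig (finRotate (n + 1)).toEmbedding C) ?_ ?_ ?_ ?_
  · intro C hC
    simp only [Finset.mem_filter, Finset.mem_univ, true_and] at hC ⊢
    exact (hmem C).2 hC
  · intro C _ C' _ h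
    exact mapConfig_injective _ h
  · intro C hC
    obtain ⟨C', rfl⟩ := Finite.surjective_of_injective
      (mapConfig_injective (finRotate (n + 1)).toEmbedding) C
    refine ⟨C', ?_, rfl⟩
    simp only [Finset.mem_filter, Finset.mem_univ, true_and] at hC ⊢
    exact (hmem C').1 hC
  · intro C _
    rw [card_mapConfig]

-- Double counting of pairs (configuration, point of its core): by rotation each of the `n` points
-- contributes as much as the first one.
open Classical in
theorem card_mul_sum_eq {R : Type*} [CommRing R] (part : Prop) (S : Set ℕ) (w : R) (k n c : ℕ) :
    (c : R) * ∑ C : Configuration n with (IsFilling part S Finset.univ C ∧ crossingNumber C = k) ∧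
        (support (coreOf C)).card = c, w ^ C.card =
    n * ∑ C : Configuration n with (IsFilling part S Finset.univ C ∧ crossingNumber C = k) ∧
        (support (coreOf C)).card = c ∧ ∃ v ∈ support (coreOf C), (v : ℕ) = 0, w ^ C.card := by
  cases n with
  | zero =>
    have : ∀ C : Configuration 0, (support (coreOf C)).card = 0 := fun C =>
      Finset.card_eq_zero.2 (Finset.eq_empty_of_isEmpty _)
    rcases Nat.eq_zero_or_pos c with rfl | hc
    · simp
    · simp [this, hc.ne]
  | succ n =>
    have h0 : ∀ v : Fin (n + 1),
        ∑ C : Configuration (n + 1) with (IsFilling part S Finset.univ C ∧ crossingNumber C = k) ∧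
          (support (coreOf C)).card = c ∧ v ∈ support (coreOf C), w ^ C.card =
        ∑ C : Configuration (n + 1) with (IsFilling part S Finset.univ C ∧ crossingNumber C = k) ∧
          (support (coreOf C)).card = c ∧ 0 ∈ support (coreOf C), w ^ C.card := by
      intro v
      induction v using Fin.induction with
      | zero => rfl
      | succ i ih =>
        rw [← ih, sum_rotate part S w k n c i.castSucc, finRotate_apply, Fin.coeSucc_eq_succ]
    have h1 : ∀ C : Configuration (n + 1), (∃ v ∈ support (coreOf C), (v : ℕ) = 0) ↔
        0 ∈ support (coreOf C) := fun C => by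
      constructor
      · rintro ⟨v, hv, h⟩
        rwa [show v = 0 from Fin.ext h] at hv
      · exact fun h => ⟨0, h, rfl⟩
    simp only [h1]
    -- Exchanging the sums, each configuration is counted once for each of its `c` core points.
    have h2 : ∑ v : Fin (n + 1), ∑ C : Configuration (n + 1) with
        (IsFilling part S Finset.univ C ∧ crossingNumber C = k) ∧
          (support (coreOf C)).card = c ∧ v ∈ support (coreOf C), w ^ C.card =
        (c : R) * ∑ C : Configuration (n + 1) with
        (IsFilling part S Finset.univ C ∧ crossingNumber C = k) ∧
        (support (coreOf C)).card = c, w ^ C.card := by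
      rw [Finset.mul_sum]
      rw [Finset.sum_comm' (t' := Finset.univ.filter fun C : Configuration (n + 1) =>
        (IsFilling part S Finset.univ C ∧ crossingNumber C = k) ∧
        (support (coreOf C)).card = c) (s' := fun C => support (coreOf C))]
      · refine Finset.sum_congr rfl fun C hC => ?_
        rw [Finset.sum_const, (Finset.mem_filter.1 hC).2.2, nsmul_eq_mul]
      · intro v C
        simp only [Finset.mem_filter, Finset.mem_univ, true_and]
        tauto
    rw [← h2, Finset.sum_congr rfl fun v _ => h0 v]
    simp

end CoreDecomposition

end ChordConfig

namespace ChordConfig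

/-! ### Regions described by positions, their convexity and mutual separation -/

section Positions

variable {n c : ℕ}

/-! ### Positions on the circle

The point `v` has position `2 * v`, the arc `a` has position `2 * a + 1`. -/

/-- `x` lies strictly between `s` and `t`. -/
def Btw (s t x : ℕ) : Prop := (s < x ∧ x < t) ∨ (t < x ∧ x < s)

/-- `x` lies strictly outside of the interval with ends `s` and `t`. -/
def Out (s t x : ℕ) : Prop := (x < s ∧ x < t) ∨ (s < x ∧ t < x)

/-- The chord between the positions `s` and `t` does not cross the hyperchord `U`. -/
def Uncrossed (U : Finset (Fin c)) (s t : ℕ) : Prop :=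
  ∀ u ∈ U, ∀ u' ∈ U, Btw s t (2 * u) → ¬ Out s t (2 * u')

theorem Uncrossed.symm {U : Finset (Fin c)} {s t : ℕ} (h : Uncrossed U s t) :
    Uncrossed U t s := by
  intro u hu u' hu'
  have := h u hu u' hu'
  unfold Btw Out at *
  omega

theorem uncrossed_self (U : Finset (Fin c)) (s : ℕ) : Uncrossed U s s := by
  intro u hu u' hu'
  unfold Btw
  omega

theorem uncrossed_succ (U : Finset (Fin c)) (s : ℕ) : Uncrossed U s (s + 1) := by
  intro u hu u' hu'
  unfold Btw
  omega

/-- A position `t` that is not a vertex of `U` lies strictly on one side of each chord of `U`, and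
`s` and `r` both lie on the closed side containing `t`. At a vertex `t` this would fail, since a
path may change sides there. -/
theorem Uncrossed.trans {U : Finset (Fin c)} {s t r : ℕ} (h : Uncrossed U s t)
    (h' : Uncrossed U t r) (ht : ∀ u ∈ U, 2 * (u : ℕ) ≠ t) : Uncrossed U s r := by
  intro u hu u' hu'
  have h1 := h u hu u' hu'
  have h2 := h u' hu' u hu
  have h3 := h' u hu u' hu'
  have h4 := h' u' hu' u hu
  have h5 := ht u hu
  have h6 := ht u' hu'
  unfold Btw Out at *
  omega

theorem Uncrossed.trans_odd {U : Finset (Fin c)} {s a r : ℕ} (h : Uncrossed U s (2 * a + 1))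
    (h' : Uncrossed U (2 * a + 1) r) : Uncrossed U s r :=
  h.trans h' fun u _ => by omega

theorem Uncrossed.trans_notMem {U : Finset (Fin c)} {s r : ℕ} {a : Fin c}
    (h : Uncrossed U s (2 * a)) (h' : Uncrossed U (2 * a) r) (ha : a ∉ U) : Uncrossed U s r :=
  h.trans h' fun u hu h => ha (by rwa [show a = u from Fin.ext (by omega)])

theorem mem_walk {a b u : Fin c} :
    u ∈ walk a b ↔ (a ≤ b ∧ a < u ∧ u ≤ b) ∨ (b < a ∧ (a < u ∨ u ≤ b)) := by
  unfold walk
  split_ifs with h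
  · simp [h, not_lt.2 h]
  · simp [h, not_le.1 h]

theorem separates_iff {U : Finset (Fin c)} {a b : Fin c} :
    Separates U a b ↔ ¬ Uncrossed U (2 * a + 1) (2 * b + 1) := by
  simp only [Separates, Uncrossed, Finset.Nonempty, Finset.mem_inter, Finset.mem_sdiff, mem_walk,
    not_forall, not_not, Btw, Out, Fin.lt_def, Fin.le_def]
  constructor
  · rintro ⟨⟨u, hu, h⟩, u', hu', h'⟩
    rcases le_or_gt (a : ℕ) b with hab | hab
    · exact ⟨u, hu, u', hu', by omega, by omega⟩
    · exact ⟨u', hu', u, hu, by omega, by omega⟩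
  · rintro ⟨u, hu, u', hu', h, h'⟩
    rcases le_or_gt (a : ℕ) b with hab | hab
    · exact ⟨⟨u, hu, by omega⟩, u', hu', by omega⟩
    · exact ⟨⟨u', hu', by omega⟩, u, hu, by omega⟩

theorem not_separates_iff {U : Finset (Fin c)} {a b : Fin c} :
    ¬ Separates U a b ↔ Uncrossed U (2 * a + 1) (2 * b + 1) := by
  rw [separates_iff, not_not]

/-- The erasure of the base point is automatic on the right: an end of a segment is neither strictly
between its ends nor strictly outside. -/
theorem isFree_iff {K : Configuration c} {g : Fin c × Fin c} :
    IsFree K g ↔ ∀ U ∈ K, g.1 ∈ U → Uncrossed U (2 * g.1) (2 * g.2 + 1) := by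
  obtain ⟨v, a⟩ := g
  unfold IsFree
  refine forall₂_congr fun U _ => imp_congr_right fun _ => ?_
  rw [← not_iff_not, not_not]
  simp only [Uncrossed, Finset.Nonempty, Finset.mem_inter, Finset.mem_sdiff, mem_walk,
    Finset.mem_erase, not_forall, not_not, Btw, Out, Fin.lt_def, Fin.le_def, ne_eq, Fin.ext_iff]
  constructor
  · rintro ⟨⟨u, hu, h⟩, u', hne, hu', h'⟩
    rcases le_or_gt (v : ℕ) a with hab | hab
    · exact ⟨u, hu, u', hu', by omega, by omega⟩
    · exact ⟨u', hu', u, hu, by omega, by omega⟩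
  · rintro ⟨u, hu, u', hu', h, h'⟩
    rcases le_or_gt (v : ℕ) a with hab | hab
    · exact ⟨⟨u, hu, by omega⟩, u', by omega, hu', by omega⟩
    · exact ⟨⟨u', hu', by omega⟩, u, by omega, hu, by omega⟩

/-- If `s` and `s'` are on different sides of the chord `u u'`, then `t` is on the closed side of
this chord that contains `s`. -/
def ClosedSide (u u' s t : ℕ) : Prop :=
  ((s < u ∧ s < u' ∨ u < s ∧ u' < s) ∧ (t ≤ u ∧ t ≤ u' ∨ u ≤ t ∧ u' ≤ t)) ∨
    ((u < s ∧ s < u' ∨ u' < s ∧ s < u) ∧ (u ≤ t ∧ t ≤ u' ∨ u' ≤ t ∧ t ≤ u))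

theorem Uncrossed.closedSide {U : Finset (Fin c)} {s s' t : ℕ} {u u' : Fin c} (hu : u ∈ U)
    (hu' : u' ∈ U) (hb : Btw s s' (2 * u)) (ho : Out s s' (2 * u')) (h : Uncrossed U t s) :
    ClosedSide (2 * u) (2 * u') s t := by
  have h1 := h u hu u' hu'
  have h2 := h u' hu' u hu
  unfold Btw Out ClosedSide at *
  omega

theorem ClosedSide.not_alternate {s s' u u' t₁ t₂ t₃ t₄ : ℕ} (hb : Btw s s' u) (ho : Out s s' u')
    (h₁ : ClosedSide u u' s t₁) (h₂ : ClosedSide u u' s t₂) (h₃ : ClosedSide u u' s' t₃)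
    (h₄ : ClosedSide u u' s' t₄) : Btw t₁ t₂ t₃ → ¬ Out t₁ t₂ t₄ := by
  unfold Btw Out ClosedSide at *
  rcases h₁ with h₁ | h₁ <;> rcases h₂ with h₂ | h₂ <;> rcases h₃ with h₃ | h₃ <;>
    rcases h₄ with h₄ | h₄ <;> omega

theorem btw_comm_odd {s s' : ℕ} {u u' : ℕ} (hb : Btw s s' u) (ho : Out s s' u') :
    Btw s' s u ∧ Out s' s u' := by
  unfold Btw Out at *
  omega

/-- Some chord of `U` separates `s` from `s'`. What is visible from `s` lies on one closed side of
this chord and what is visible from `s'` on the other, and segments on opposite closed sides do not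
cross. -/
theorem not_alternate {U : Finset (Fin c)} {s s' t₁ t₂ t₃ t₄ : ℕ} (h : ¬ Uncrossed U s s')
    (h₁ : Uncrossed U t₁ s) (h₂ : Uncrossed U t₂ s) (h₃ : Uncrossed U t₃ s')
    (h₄ : Uncrossed U t₄ s') : Btw t₁ t₂ t₃ → ¬ Out t₁ t₂ t₄ := by
  simp only [Uncrossed, not_forall, not_not] at h
  obtain ⟨u, hu, u', hu', hb, ho⟩ := h
  obtain ⟨hb', ho'⟩ := btw_comm_odd hb ho
  exact ClosedSide.not_alternate hb ho (h₁.closedSide hu hu' hb ho) (h₂.closedSide hu hu' hb ho)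
    (h₃.closedSide hu hu' hb' ho') (h₄.closedSide hu hu' hb' ho')

theorem mem_regionOf {K : Configuration c} {g h : Fin c × Fin c} :
    h ∈ regionOf K g ↔ IsFree K h ∧
      ∀ U ∈ K, Uncrossed U (2 * sideArc U g + 1) (2 * sideArc U h + 1) := by
  simp [regionOf, not_separates_iff]

/-- Sides of hyperchords are compared at arcs, whose positions are odd, and there the relation is
transitive. -/
theorem regionOf_eq {K : Configuration c} {g g' : Fin c × Fin c}
    (h : ∀ U ∈ K, Uncrossed U (2 * sideArc U g + 1) (2 * sideArc U g' + 1)) :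
    regionOf K g = regionOf K g' := by
  ext x
  rw [mem_regionOf, mem_regionOf]
  refine and_congr_right fun _ => forall₂_congr fun U hU => ?_
  exact ⟨fun hx => (h U hU).symm.trans_odd hx, fun hx => (h U hU).trans_odd hx⟩

theorem mem_regions {K : Configuration c} {R : Finset (Fin c × Fin c)} :
    R ∈ regions K ↔ ∃ g, IsFree K g ∧ regionOf K g = R := by
  simp [regions]

theorem regionOf_eq_of_mem {K : Configuration c} {g : Fin c × Fin c} {R : Finset (Fin c × Fin c)}
    (hR : R ∈ regions K) (hg : g ∈ R) : regionOf K g = R := by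
  obtain ⟨g', -, rfl⟩ := mem_regions.1 hR
  exact (regionOf_eq (mem_regionOf.1 hg).2).symm

theorem mem_regionOf_self {K : Configuration c} {g : Fin c × Fin c} (hg : IsFree K g) :
    g ∈ regionOf K g :=
  mem_regionOf.2 ⟨hg, fun _ _ => uncrossed_self _ _⟩

theorem sideArc_self (U : Finset (Fin c)) (a : Fin c) : sideArc U (a, a) = a := by
  simp [sideArc]

theorem isFree_self (K : Configuration c) (a : Fin c) : IsFree K (a, a) :=
  isFree_iff.2 fun _ _ _ => uncrossed_succ _ _

theorem uncrossed_sideArc {K : Configuration c} {g : Fin c × Fin c} (hg : IsFree K g)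
    {U : Finset (Fin c)} (hU : U ∈ K) : Uncrossed U (2 * g.1) (2 * sideArc U g + 1) := by
  unfold sideArc
  split_ifs with h
  · exact isFree_iff.1 hg U hU h
  · exact uncrossed_succ _ _

/-- The position `t` belongs to the closure of the region `R`. -/
def InCell (R : Finset (Fin c × Fin c)) (t : ℕ) : Prop :=
  ∃ g ∈ R, t = 2 * (g.1 : ℕ) ∨ (g.1 = g.2 ∧ t = 2 * (g.1 : ℕ) + 1)

theorem inCell_odd {R : Finset (Fin c × Fin c)} {a : Fin c} :
    InCell R (2 * a + 1) ↔ (a, a) ∈ R := by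
  constructor
  · rintro ⟨⟨v, b⟩, hg, h | ⟨h, h'⟩⟩
    · simp only at h; omega
    · simp only at h h'
      obtain rfl : a = v := Fin.ext (by omega)
      subst h
      exact hg
  · exact fun h => ⟨_, h, Or.inr ⟨rfl, rfl⟩⟩

theorem inCell_even {R : Finset (Fin c × Fin c)} {v : Fin c} :
    InCell R (2 * v) ↔ ∃ a, (v, a) ∈ R := by
  constructor
  · rintro ⟨⟨w, b⟩, hg, h | ⟨h, h'⟩⟩
    · simp only at h
      obtain rfl : v = w := Fin.ext (by omega)
      exact ⟨b, hg⟩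
    · simp only at h'; omega
  · rintro ⟨a, h⟩
    exact ⟨_, h, Or.inl rfl⟩

theorem InCell.uncrossed_sideArc {K : Configuration c} {g : Fin c × Fin c} {t : ℕ}
    (ht : InCell (regionOf K g) t) {U : Finset (Fin c)} (hU : U ∈ K) :
    Uncrossed U t (2 * sideArc U g + 1) := by
  obtain ⟨h, hh, rfl | ⟨heq, rfl⟩⟩ := ht
  · obtain ⟨h1, h2⟩ := mem_regionOf.1 hh
    exact (ChordConfig.uncrossed_sideArc h1 hU).trans_odd (h2 U hU).symm
  · obtain ⟨h1, h2⟩ := mem_regionOf.1 hh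
    obtain ⟨v, a⟩ := h
    simp only at heq
    subst heq
    simpa only [sideArc_self] using (h2 U hU).symm

/-- Convexity of a region: both positions see the same arc on their side of `U`. -/
theorem InCell.uncrossed {K : Configuration c} {R : Finset (Fin c × Fin c)} (hR : R ∈ regions K)
    {t t' : ℕ} (ht : InCell R t) (ht' : InCell R t') {U : Finset (Fin c)} (hU : U ∈ K) :
    Uncrossed U t t' := by
  obtain ⟨g, -, rfl⟩ := mem_regions.1 hR
  exact (ht.uncrossed_sideArc hU).trans_odd (ht'.uncrossed_sideArc hU).symm

/-- Two distinct regions are separated by a single hyperchord of `K`, to which the comparison of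
closed sides applies. -/
theorem InCell.not_alternate {K : Configuration c} {R R' : Finset (Fin c × Fin c)}
    (hR : R ∈ regions K) (hR' : R' ∈ regions K) (hne : R ≠ R') {t₁ t₂ t₃ t₄ : ℕ}
    (h₁ : InCell R t₁) (h₂ : InCell R t₂) (h₃ : InCell R' t₃) (h₄ : InCell R' t₄) :
    Btw t₁ t₂ t₃ → ¬ Out t₁ t₂ t₄ := by
  obtain ⟨g, -, rfl⟩ := mem_regions.1 hR
  obtain ⟨g', -, rfl⟩ := mem_regions.1 hR'
  have : ∃ U ∈ K, ¬ Uncrossed U (2 * sideArc U g + 1) (2 * sideArc U g' + 1) := by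
    by_contra! hcon
    exact hne (regionOf_eq hcon)
  obtain ⟨U, hU, h⟩ := this
  exact ChordConfig.not_alternate h (h₁.uncrossed_sideArc hU) (h₂.uncrossed_sideArc hU)
    (h₃.uncrossed_sideArc hU) (h₄.uncrossed_sideArc hU)

theorem region_eq_of_inCell_odd {K : Configuration c} {R R' : Finset (Fin c × Fin c)}
    (hR : R ∈ regions K) (hR' : R' ∈ regions K) {a : Fin c} (h : InCell R (2 * a + 1))
    (hodd : InCell R' (2 * a + 1)) : R = R' := by
  rw [inCell_odd] at h hodd
  exact (regionOf_eq_of_mem hR h).symm.trans (regionOf_eq_of_mem hR' hodd)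

/-- Each hyperchord has at least three vertices or is crossed. -/
def Spread (K : Configuration c) : Prop := ∀ U ∈ K, 3 ≤ U.card ∨ ∃ V ∈ K, Cross U V

theorem exists_btw_of_cross {U V : Finset (Fin c)} (h : Cross U V) :
    ∃ a ∈ U, ∃ b ∈ U, ¬ Uncrossed V (2 * a) (2 * b) := by
  obtain ⟨a, ha, b, hb, p, hp, q, hq, h1, h2⟩ := cross_iff.1 h
  refine ⟨a, ha, b, hb, fun h => h p hp q hq ?_ ?_⟩
  · simp only [Btw, Fin.lt_def] at *; omega
  · simp only [Out, Fin.lt_def] at *; omega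

theorem eq_or_eq_of_closedSide {s s' t u u' : ℕ} (hb : Btw s s' u) (ho : Out s s' u')
    (h : ClosedSide u u' s t) (h' : ClosedSide u u' s' t) : t = u ∨ t = u' := by
  unfold Btw Out ClosedSide at *
  rcases h with h | h <;> rcases h' with h' | h' <;> omega

/-- If two different regions met in `t` and `t'`, a hyperchord separating them would be the bare
chord `tt'`, which nothing crosses because it joins two positions of one region. Exactly this is
excluded by `Spread`. -/
theorem region_eq_of_inCell {K : Configuration c} (hK : Spread K)
    {R R' : Finset (Fin c × Fin c)} (hR : R ∈ regions K) (hR' : R' ∈ regions K) {t t' : ℕ}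
    (hne : t ≠ t') (h₁ : InCell R t) (h₂ : InCell R t') (h₃ : InCell R' t) (h₄ : InCell R' t') :
    R = R' := by
  by_contra hRR
  have hu := fun {U : Finset (Fin c)} hU => h₁.uncrossed hR h₂ (U := U) hU
  obtain ⟨g, -, rfl⟩ := mem_regions.1 hR
  obtain ⟨g', -, rfl⟩ := mem_regions.1 hR'
  have : ∃ U ∈ K, ¬ Uncrossed U (2 * sideArc U g + 1) (2 * sideArc U g' + 1) := by
    by_contra! hcon
    exact hRR (regionOf_eq hcon)
  obtain ⟨U, hU, h⟩ := this
  replace h₁ := h₁.uncrossed_sideArc hU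
  replace h₂ := h₂.uncrossed_sideArc hU
  replace h₃ := h₃.uncrossed_sideArc hU
  replace h₄ := h₄.uncrossed_sideArc hU
  simp only [Uncrossed, not_forall, not_not] at h
  obtain ⟨u, hu1, u', hu', hb, ho⟩ := h
  -- A position on both closed sides of a separating chord is an end of that chord. Replacing either
  -- end of the chord by another vertex of `U` on the same side shows that no further vertex exists.
  have hall : ∀ z ∈ U, 2 * (z : ℕ) = t ∨ 2 * (z : ℕ) = t' := by
    intro z hz
    have key : ∀ x ∈ U, ∀ y ∈ U, Btw (2 * sideArc U g + 1) (2 * sideArc U g' + 1) (2 * x) →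
        Out (2 * sideArc U g + 1) (2 * sideArc U g' + 1) (2 * y) →
        (t = 2 * x ∨ t = 2 * y) ∧ (t' = 2 * x ∨ t' = 2 * y) := by
      intro x hx y hy hb ho
      obtain ⟨hb', ho'⟩ := btw_comm_odd hb ho
      exact ⟨eq_or_eq_of_closedSide hb ho (h₁.closedSide hx hy hb ho)
        (h₃.closedSide hx hy hb' ho'), eq_or_eq_of_closedSide hb ho
        (h₂.closedSide hx hy hb ho) (h₄.closedSide hx hy hb' ho')⟩
    have k1 := key u hu1 u' hu' hb ho
    have hz' : Btw (2 * sideArc U g + 1) (2 * sideArc U g' + 1) (2 * z) ∨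
        Out (2 * sideArc U g + 1) (2 * sideArc U g' + 1) (2 * z) := by
      unfold Btw Out; omega
    rcases hz' with hz' | hz'
    · have k2 := key z hz u' hu' hz' ho
      omega
    · have k2 := key u hu1 z hz hb hz'
      omega
  rcases hK U hU with h3 | ⟨V, hV, hc⟩
  · obtain ⟨x, y, z, hx, hy, hz, hxy, hxz, hyz⟩ := Finset.two_lt_card_iff.1 h3
    have h1 := hall x hx
    have h2 := hall y hy
    have h3 := hall z hz
    have := Fin.val_injective.ne hxy
    have := Fin.val_injective.ne hxz
    have := Fin.val_injective.ne hyz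
    omega
  · obtain ⟨a, ha, b, hb, hab⟩ := exists_btw_of_cross hc
    rcases hall a ha with h1 | h1 <;> rcases hall b hb with h2 | h2
    · exact hab (by rw [h1, h2]; exact uncrossed_self _ _)
    · exact hab (by rw [h1, h2]; exact hu hV)
    · exact hab (by rw [h1, h2]; exact (hu hV).symm)
    · exact hab (by rw [h1, h2]; exact uncrossed_self _ _)

/-! ### Flat regions -/

theorem mem_flatRegions {K : Configuration c} {f : Fin c × Fin c} :
    f ∈ flatRegions K ↔ f.1 < f.2 ∧ (∀ U ∈ K, Uncrossed U (2 * f.1) (2 * f.2)) ∧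
      (∃ U ∈ K, f.1 ∈ U ∧ f.2 ∈ U ∧ ∃ a ∈ U, f.1 < a ∧ a < f.2) ∧
      (∃ U ∈ K, f.1 ∈ U ∧ f.2 ∈ U ∧ ∃ b ∈ U, b < f.1 ∨ f.2 < b) := by
  simp only [flatRegions, Finset.mem_filter, Finset.mem_univ, true_and]
  refine and_congr_right fun hlt => and_congr_left fun _ => forall₂_congr fun U _ => ?_
  simp only [Uncrossed, Btw, Out, Fin.lt_def] at *
  constructor
  · intro h u hu u' hu' h1 h2
    exact h ⟨⟨u, hu, by omega⟩, u', hu', by omega⟩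
  · rintro h ⟨⟨u, hu, h1⟩, u', hu', h2⟩
    exact h u hu u' hu' (by omega) (by omega)

/-- Both ends of a flat region are vertices of one hyperchord of `K`, so crossing the flat chord
means crossing `K`. -/
theorem flatRegion_not_alternate {K : Configuration c} {f : Fin c × Fin c}
    (hf : f ∈ flatRegions K) {t t' : ℕ} (h : ∀ U ∈ K, Uncrossed U t t') :
    (Btw t t' (2 * f.1) → ¬ Out t t' (2 * f.2)) ∧ (Btw t t' (2 * f.2) → ¬ Out t t' (2 * f.1)) := by
  obtain ⟨-, -, ⟨U, hU, h1, h2, -⟩, -⟩ := mem_flatRegions.1 hf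
  exact ⟨h U hU _ h1 _ h2, h U hU _ h2 _ h1⟩

/-- A region touching both ends lies on one side of the chord. On either side a hyperchord of `K`
has this chord as an edge and a further vertex, and so blocks the region. -/
theorem flatRegion_not_inCell {K : Configuration c} {f : Fin c × Fin c} (hf : f ∈ flatRegions K)
    {R : Finset (Fin c × Fin c)} (hR : R ∈ regions K) (h₁ : InCell R (2 * f.1)) :
    ¬ InCell R (2 * f.2) := by
  intro h₂
  obtain ⟨hlt, -, ⟨U, hU, h1, h2, a, ha, ha'⟩, ⟨U', hU', h1', h2', b, hb, hb'⟩⟩ :=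
    mem_flatRegions.1 hf
  obtain ⟨q, hq⟩ := inCell_even.1 h₁
  rw [← regionOf_eq_of_mem hR hq] at h₁ h₂
  have k1 := h₁.uncrossed_sideArc hU
  have k2 := h₂.uncrossed_sideArc hU
  have k3 := h₁.uncrossed_sideArc hU'
  have k4 := h₂.uncrossed_sideArc hU'
  simp only [sideArc, h1, h1', if_true] at k1 k2 k3 k4
  have := k1 a ha _ h2
  have := k1 _ h2 a ha
  have := k2 a ha _ h1
  have := k2 _ h1 a ha
  have := k3 b hb _ h2'
  have := k3 _ h2' b hb
  have := k4 b hb _ h1'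
  have := k4 _ h1' b hb
  simp only [Btw, Out, Fin.lt_def] at *
  omega

end Positions

end ChordConfig

namespace ChordConfig

/-! ### Locating uncrossed hyperchords and inserted points relative to the core -/

section Cells

variable {n c : ℕ}

/-! ### Finding the cell of an uncrossed hyperchord -/

theorem exists_lt_lt_of_two_lt_card {V : Finset (Fin c)} (h : 2 < V.card) :
    ∃ x ∈ V, ∃ y ∈ V, ∃ z ∈ V, x < y ∧ y < z := by
  refine ⟨V.orderEmbOfFin rfl ⟨0, by omega⟩, Finset.orderEmbOfFin_mem _ _ _,
    V.orderEmbOfFin rfl ⟨1, by omega⟩, Finset.orderEmbOfFin_mem _ _ _,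
    V.orderEmbOfFin rfl ⟨2, h⟩, Finset.orderEmbOfFin_mem _ _ _, ?_, ?_⟩ <;> simp

/-- If a vertex of `V` is not a vertex of `U`, the arc that starts at it works. Otherwise `V` is a
proper part of `U` and must be an edge of `U`, and an arc on the free side of that edge works. -/
theorem exists_side {U V : Finset (Fin c)} (hV : 2 ≤ V.card) (hne : V ≠ U)
    (h : ∀ x ∈ V, ∀ y ∈ V, Uncrossed U (2 * x) (2 * y)) :
    ∃ a : Fin c, ∀ x ∈ V, Uncrossed U (2 * x) (2 * a + 1) := by
  by_cases hVU : V ⊆ U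
  · obtain ⟨z, hz, hzV⟩ := Finset.exists_of_ssubset (hVU.ssubset_of_ne hne)
    have hzne : ∀ x ∈ V, (x : ℕ) ≠ z := fun x hx hxz => hzV (Fin.ext hxz ▸ hx)
    rcases hV.eq_or_lt with h2 | h3
    · obtain ⟨x, y, hxy, rfl⟩ := Finset.card_eq_two.1 h2.symm
      wlog hlt : x < y generalizing x y
      · have hlt' : y < x := lt_of_le_of_ne (not_lt.1 hlt) hxy.symm
        rw [Finset.pair_comm] at *
        exact this y x hxy.symm hV hne h hVU hzV hzne h2 hlt'
      have hx : x ∈ ({x, y} : Finset (Fin c)) := by simp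
      have hy : y ∈ ({x, y} : Finset (Fin c)) := by simp
      have hzx := hzne x hx
      have hzy := hzne y hy
      -- All vertices of `U` off the chord `xy` lie on the side of `z`; the arc is taken on the
      -- other side.
      by_cases hz' : x < z ∧ z < y
      · refine ⟨y, fun v hv => ?_⟩
        rw [Finset.mem_insert, Finset.mem_singleton] at hv
        rcases hv with rfl | rfl
        · intro u hu u' hu'
          have := h v hx y hy z hz u' hu'
          simp only [Btw, Out, Fin.lt_def] at *
          omega
        · exact uncrossed_succ _ _
      · refine ⟨x, fun v hv => ?_⟩
        rw [Finset.mem_insert, Finset.mem_singleton] at hv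
        rcases hv with rfl | rfl
        · exact uncrossed_succ _ _
        · intro u hu u' hu'
          have := h x hx v hy u hu z hz
          simp only [Btw, Out, Fin.lt_def] at *
          omega
    -- With three vertices of `V` in `U`, wherever `z` lies, two of them span a chord that separates
    -- `z` from the third.
    · exfalso
      obtain ⟨x, hx, y, hy, w, hw, hxy, hyw⟩ := exists_lt_lt_of_two_lt_card h3
      have := hzne x hx
      have := hzne y hy
      have := hzne w hw
      rw [Fin.lt_def] at hxy hyw
      rcases lt_or_ge (z : ℕ) x with h1 | h1
      · exact h x hx w hw y (hVU hy) z hz (Or.inl (by omega)) (Or.inl (by omega))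
      rcases lt_or_ge (z : ℕ) y with h2 | h2
      · exact h x hx y hy z hz w (hVU hw) (Or.inl (by omega)) (Or.inr (by omega))
      rcases lt_or_ge (z : ℕ) w with h3 | h3
      · exact h y hy w hw z hz x (hVU hx) (Or.inl (by omega)) (Or.inl (by omega))
      · exact h x hx w hw y (hVU hy) z hz (Or.inl (by omega)) (Or.inr (by omega))
  · obtain ⟨x, hx, hxU⟩ := Finset.not_subset.1 hVU
    exact ⟨x, fun y hy => (h y hy x hx).trans_notMem (uncrossed_succ _ _) hxU⟩

/-- `t` is on the closed arc of the circle from `y` to `x`. -/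
def OnArc (y x t : ℕ) : Prop := (y < x ∧ y ≤ t ∧ t ≤ x) ∨ (x < y ∧ (y ≤ t ∨ t ≤ x))

/-- The point `y` sees arc `a` but the arc just after `y` does not, so `U` starts at `y` there.
Since `x` is a vertex that also sees arc `a`, the chord `xy` is an edge of `U`: all of `U` is on one
side of it and everything that sees arc `a` on the other. -/
theorem onArc_of_crossed_after {U : Finset (Fin c)} {x y : Fin c} {a : ℕ} (hx : x ∈ U)
    (hxy : (x : ℕ) ≠ y) (hxa : Uncrossed U (2 * x) (2 * a + 1))
    (hya : Uncrossed U (2 * y) (2 * a + 1))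
    (h : ¬ Uncrossed U (2 * y + 1) (2 * a + 1)) :
    y ∈ U ∧ (∀ u ∈ U, OnArc y x u) ∧
      ∀ t : Fin c, Uncrossed U (2 * t) (2 * a + 1) → OnArc x y t := by
  have hy : y ∈ U := by
    by_contra hy
    exact h ((uncrossed_succ _ _).symm.trans_notMem hya hy)
  simp only [Uncrossed, not_forall, not_not] at h
  obtain ⟨p, hp, q, hq, hb, ho⟩ := h
  have hpq : (p : ℕ) = y ∨ (q : ℕ) = y := by
    have := hya p hp q hq
    unfold Btw Out at *
    omega
  obtain ⟨z, hz, hz'⟩ : ∃ z ∈ U, (Btw (2 * y + 1) (2 * a + 1) (2 * z) ∧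
      Out (2 * y + 1) (2 * a + 1) (2 * y)) ∨ (Btw (2 * y + 1) (2 * a + 1) (2 * y) ∧
      Out (2 * y + 1) (2 * a + 1) (2 * z)) := by
    rcases hpq with h | h
    · exact ⟨q, hq, Or.inr ⟨h ▸ hb, ho⟩⟩
    · exact ⟨p, hp, Or.inl ⟨hb, h ▸ ho⟩⟩
  rcases lt_or_ge a y with hay | hay
  · have hz1 : (z : ℕ) ≤ a ∨ y < (z : ℕ) := by
      unfold Btw Out at hz'; omega
    have side : ∀ u ∈ U, (u : ℕ) ≤ a ∨ y ≤ (u : ℕ) := fun u hu => by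
      have := hya u hu z hz
      unfold Btw Out at this; omega
    have hx1 := side x hx
    refine ⟨hy, fun u hu => ?_, fun t ht => ?_⟩
    · have h1 := side u hu
      have h5 := hxa u hu y hy
      have h6 := hxa y hy u hu
      unfold Btw Out at h5 h6
      unfold OnArc
      omega
    · have h3 := ht x hx y hy
      have h4 := ht y hy x hx
      unfold Btw Out at h3 h4
      unfold OnArc
      omega
  · have hz1 : y < (z : ℕ) ∧ (z : ℕ) ≤ a := by
      unfold Btw Out at hz'; omega
    have side : ∀ u ∈ U, y ≤ (u : ℕ) ∧ (u : ℕ) ≤ a := fun u hu => by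
      have := hya z hz u hu
      unfold Btw Out at this; omega
    have hx1 := side x hx
    refine ⟨hy, fun u hu => ?_, fun t ht => ?_⟩
    · have h1 := side u hu
      have h5 := hxa u hu y hy
      unfold Btw Out at h5
      unfold OnArc
      omega
    · have h3 := ht x hx y hy
      have h4 := ht y hy x hx
      unfold Btw Out at h3 h4
      unfold OnArc
      omega

/-- Mirror image of `onArc_of_crossed_after`, where `p` is the arc that ends at `y`, cyclically. -/
theorem onArc_of_crossed_before {U : Finset (Fin c)} {x y p : Fin c} {a : ℕ}
    (hp : (p : ℕ) + 1 = y ∨ ((y : ℕ) = 0 ∧ (p : ℕ) + 1 = c)) (hx : x ∈ U)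
    (hxy : (x : ℕ) ≠ y) (hxa : Uncrossed U (2 * x) (2 * a + 1))
    (hya : Uncrossed U (2 * y) (2 * a + 1))
    (h : ¬ Uncrossed U (2 * p + 1) (2 * a + 1)) :
    y ∈ U ∧ (∀ u ∈ U, OnArc x y u) ∧
      ∀ t : Fin c, Uncrossed U (2 * t) (2 * a + 1) → OnArc y x t := by
  have hy : y ∈ U := by
    by_contra hy
    refine h (Uncrossed.trans_notMem (fun u hu u' hu' => ?_) hya hy)
    have := u.2
    have := u'.2
    unfold Btw Out
    omega
  simp only [Uncrossed, not_forall, not_not] at h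
  obtain ⟨r, hr, q, hq, hb, ho⟩ := h
  have hpq : (r : ℕ) = y ∨ (q : ℕ) = y := by
    have := hya r hr q hq
    have := hya q hq r hr
    have := r.2
    have := q.2
    unfold Btw Out at *
    omega
  obtain ⟨z, hz, hz'⟩ : ∃ z ∈ U, (Btw (2 * p + 1) (2 * a + 1) (2 * z) ∧
      Out (2 * p + 1) (2 * a + 1) (2 * y)) ∨ (Btw (2 * p + 1) (2 * a + 1) (2 * y) ∧
      Out (2 * p + 1) (2 * a + 1) (2 * z)) := by
    rcases hpq with h | h
    · exact ⟨q, hq, Or.inr ⟨h ▸ hb, ho⟩⟩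
    · exact ⟨r, hr, Or.inl ⟨hb, h ▸ ho⟩⟩
  have hzc := z.2
  rcases lt_or_ge a y with hay | hay
  · have hz1 : a < (z : ℕ) ∧ (z : ℕ) < y := by
      unfold Btw Out at hz'; omega
    have side : ∀ u ∈ U, a < (u : ℕ) ∧ (u : ℕ) ≤ y := fun u hu => by
      have := hya z hz u hu
      unfold Btw Out at this; omega
    have hx1 := side x hx
    refine ⟨hy, fun u hu => ?_, fun t ht => ?_⟩
    · have h1 := side u hu
      have h5 := hxa u hu y hy
      unfold Btw Out at h5
      unfold OnArc
      omega
    · have h3 := ht x hx y hy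
      have h4 := ht y hy x hx
      unfold Btw Out at h3 h4
      unfold OnArc
      omega
  · have hz1 : (z : ℕ) < y ∨ a < (z : ℕ) := by
      unfold Btw Out at hz'; omega
    have side : ∀ u ∈ U, (u : ℕ) ≤ y ∨ a < (u : ℕ) := fun u hu => by
      have := hya u hu z hz
      unfold Btw Out at this; omega
    have hx1 := side x hx
    refine ⟨hy, fun u hu => ?_, fun t ht => ?_⟩
    · have h1 := side u hu
      have h5 := hxa u hu y hy
      have h6 := hxa y hy u hu
      unfold Btw Out at h5 h6
      unfold OnArc
      omega
    · have h3 := ht x hx y hy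
      have h4 := ht y hy x hx
      unfold Btw Out at h3 h4
      unfold OnArc
      omega

theorem exists_pred (y : Fin c) :
    ∃ p : Fin c, (p : ℕ) + 1 = y ∨ ((y : ℕ) = 0 ∧ (p : ℕ) + 1 = c) := by
  have := y.2
  rcases Nat.eq_zero_or_pos (y : ℕ) with h | h
  · exact ⟨⟨c - 1, by omega⟩, Or.inr ⟨h, by simp only; omega⟩⟩
  · exact ⟨⟨y - 1, by omega⟩, Or.inl (by simp only; omega)⟩

/-- For each hyperchord of `K` fix the side on which `V` lies. If at each vertex of `V` some germ is
on all these sides, the germs determine one region touched by all of `V`. If there is no such germ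
at some vertex, `V` is squeezed between two hyperchords that share an edge, which is a flat region.
-/
theorem exists_cell_of_points {K : Configuration c} {V : Finset (Fin c)} (hV : 2 ≤ V.card)
    (hVK : V ∉ K) (h : ∀ U ∈ K, ∀ x ∈ V, ∀ y ∈ V, Uncrossed U (2 * x) (2 * y)) :
    (∃ R ∈ regions K, ∀ x ∈ V, InCell R (2 * x)) ∨
      ∃ f ∈ flatRegions K, V = {f.1, f.2} := by
  have hside : ∀ U, ∃ a : Fin c, U ∈ K → ∀ x ∈ V, Uncrossed U (2 * x) (2 * a + 1) := by
    intro U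
    by_cases hU : U ∈ K
    · obtain ⟨a, ha⟩ := exists_side hV (fun heq => hVK (heq ▸ hU)) (h U hU)
      exact ⟨a, fun _ => ha⟩
    · obtain ⟨a, -⟩ := Finset.card_pos.1 (by omega : 0 < V.card)
      exact ⟨a, fun h => absurd h hU⟩
  choose s hs using hside
  by_cases hgerm : ∀ x ∈ V, ∃ a : Fin c, ∀ U ∈ K, x ∈ U → Uncrossed U (2 * a + 1) (2 * s U + 1)
  · left
    have hfree : ∀ x ∈ V, ∀ a : Fin c,
        (∀ U ∈ K, x ∈ U → Uncrossed U (2 * a + 1) (2 * s U + 1)) → IsFree K (x, a) ∧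
        ∀ U ∈ K, Uncrossed U (2 * sideArc U (x, a) + 1) (2 * s U + 1) := by
      intro x hx a ha
      refine ⟨isFree_iff.2 fun U hU hxU => (hs U hU x hx).trans_odd (ha U hU hxU).symm,
        fun U hU => ?_⟩
      unfold sideArc
      split_ifs with hxU
      · exact ha U hU hxU
      · exact (uncrossed_succ _ _).symm.trans_notMem (hs U hU x hx) hxU
    obtain ⟨x₀, hx₀⟩ := Finset.card_pos.1 (by omega : 0 < V.card)
    obtain ⟨a₀, ha₀⟩ := hgerm x₀ hx₀
    obtain ⟨hf, hside⟩ := hfree x₀ hx₀ a₀ ha₀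
    refine ⟨regionOf K (x₀, a₀), mem_regions.2 ⟨_, hf, rfl⟩, fun x hx => ?_⟩
    obtain ⟨a, ha⟩ := hgerm x hx
    obtain ⟨hf', hside'⟩ := hfree x hx a ha
    exact inCell_even.2 ⟨a, mem_regionOf.2 ⟨hf', fun U hU =>
      (hside U hU).trans_odd (hside' U hU).symm⟩⟩
  -- No germ is available at `x`. The germs aimed just after and just before another vertex `y` are
  -- blocked by hyperchords `U` and `U'`, which have `xy` as an edge and lie on opposite sides of
  -- it.
  · right
    push Not at hgerm
    obtain ⟨x, hx, hno⟩ := hgerm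
    obtain ⟨y, hy, hxy⟩ := Finset.exists_mem_ne (by omega : 1 < V.card) x
    obtain ⟨p, hp⟩ := exists_pred y
    obtain ⟨U, hU, hxU, hcU⟩ := hno y
    obtain ⟨U', hU', hxU', hcU'⟩ := hno p
    have hne : (x : ℕ) ≠ y := fun h => hxy (Fin.ext h.symm)
    obtain ⟨hyU, k1, k2⟩ :=
      onArc_of_crossed_after hxU hne (hs U hU x hx) (hs U hU y hy) hcU
    obtain ⟨hyU', k1', k2'⟩ :=
      onArc_of_crossed_before hp hxU' hne (hs U' hU' x hx) (hs U' hU' y hy) hcU'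
    have hVxy : V = {x, y} := by
      ext t
      rw [Finset.mem_insert, Finset.mem_singleton]
      constructor
      · intro ht
        have h1 := k2 t (hs U hU t ht)
        have h2 := k2' t (hs U' hU' t ht)
        rw [Fin.ext_iff, Fin.ext_iff]
        unfold OnArc at *
        omega
      · rintro (rfl | rfl) <;> assumption
    -- Since `V = {x, y}` is not in `K`, hyperchords through both points have another vertex, as
    -- flat regions require.
    have third : ∀ U ∈ K, x ∈ U → y ∈ U → ∃ u ∈ U, (u : ℕ) ≠ x ∧ (u : ℕ) ≠ y := by
      intro U hU hxU hyU
      by_contra! hcon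
      refine hVK ?_
      rw [show V = U from ?_]
      · exact hU
      rw [hVxy]
      ext u
      rw [Finset.mem_insert, Finset.mem_singleton]
      constructor
      · rintro (rfl | rfl) <;> assumption
      · intro hu
        have := hcon u hu
        rw [Fin.ext_iff, Fin.ext_iff]
        tauto
    obtain ⟨u, hu, hux, huy⟩ := third U hU hxU hyU
    obtain ⟨u', hu', hux', huy'⟩ := third U' hU' hxU' hyU'
    have ku := k1 u hu
    have ku' := k1' u' hu'
    rcases lt_or_gt_of_ne hne with hlt | hlt
    · refine ⟨(x, y), mem_flatRegions.2 ⟨hlt, fun U hU => h U hU x hx y hy,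
        ⟨U', hU', hxU', hyU', u', hu', ?_⟩, ⟨U, hU, hxU, hyU, u, hu, ?_⟩⟩, hVxy⟩
      all_goals
        simp only [Fin.lt_def, OnArc] at *
        omega
    · refine ⟨(y, x), mem_flatRegions.2 ⟨hlt, fun U hU => h U hU y hy x hx,
        ⟨U, hU, hyU, hxU, u, hu, ?_⟩, ⟨U', hU', hyU', hxU', u', hu', ?_⟩⟩,
        hVxy.trans (Finset.pair_comm _ _)⟩
      all_goals
        simp only [Fin.lt_def, OnArc] at *
        omega

/-! ### Positions of the points with respect to the points of the core -/

theorem lt_card_filter_iff {P : Fin c → Prop} [DecidablePred P]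
    (hP : ∀ a b, a ≤ b → P b → P a) (b : Fin c) :
    (b : ℕ) < (Finset.univ.filter P).card ↔ P b := by
  constructor
  · intro h
    by_contra hb
    have : (Finset.univ.filter P) ⊆ Finset.Iio b := by
      intro a ha
      rw [Finset.mem_Iio]
      by_contra hab
      exact hb (hP b a (not_lt.1 hab) (Finset.mem_filter.1 ha).2)
    have := Finset.card_le_card this
    rw [Fin.card_Iio] at this
    omega
  · intro hb
    have : Finset.Iic b ⊆ Finset.univ.filter P := by
      intro a ha
      exact Finset.mem_filter.2 ⟨Finset.mem_univ _, hP a b (Finset.mem_Iic.1 ha) hb⟩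
    have := Finset.card_le_card this
    rw [Fin.card_Iic] at this
    omega

/-- The position of the point `p` with respect to the image of `e`. -/
def pos (e : Fin c ↪o Fin n) (p : Fin n) : ℕ :=
  (Finset.univ.filter fun b => e b < p).card + (Finset.univ.filter fun b => e b ≤ p).card - 1

/-- At `e b` the two counts in `pos` are b and b + 1, while on the arc after `e b` both equal b + 1.
Rootedness puts an image point weakly before `p`, so the truncated subtraction of 1 is exact and no
point falls before the first arc. -/
theorem pos_spec {e : Fin c ↪o Fin n} (he : Rooted e) (p : Fin n) (b : Fin c) :
    (2 * (b : ℕ) < pos e p ↔ e b < p) ∧ (pos e p < 2 * (b : ℕ) ↔ p < e b) ∧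
      pos e p < 2 * c := by
  have h1 := lt_card_filter_iff (P := fun b => e b < p)
    (fun a b hab hb => (e.monotone hab).trans_lt hb)
  have h2 := lt_card_filter_iff (P := fun b => e b ≤ p)
    (fun a b hab hb => (e.monotone hab).trans hb)
  have hle : (Finset.univ.filter fun b => e b < p).card ≤
      (Finset.univ.filter fun b => e b ≤ p).card :=
    Finset.card_le_card fun b hb => by
      simp only [Finset.mem_filter, Finset.mem_univ, true_and] at hb ⊢; exact hb.le
  have hle' : (Finset.univ.filter fun b => e b ≤ p).card ≤ c :=
    (Finset.card_le_univ _).trans (by simp)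
  have hlt' : (Finset.univ.filter fun b => e b ≤ p).card ≤
      (Finset.univ.filter fun b => e b < p).card + 1 := by
    by_contra hcon
    have hA : (Finset.univ.filter fun b => e b < p).card < c := by omega
    have hB : (Finset.univ.filter fun b => e b < p).card + 1 < c := by omega
    have k1 := (h2 ⟨_, hB⟩).1 (by simp only; omega)
    have k2 := (h1 ⟨_, hA⟩).not.1 (by simp)
    have k3 : e ⟨_, hA⟩ < e ⟨_, hB⟩ := e.strictMono (Fin.lt_def.2 (by simp))
    exact k2 (k3.trans_le k1)
  have hpos : 0 < (Finset.univ.filter fun b => e b ≤ p).card := by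
    have hc : 0 < c := b.pos
    refine (h2 ⟨0, hc⟩).2 (Fin.le_def.2 ?_)
    rw [he ⟨0, hc⟩ rfl]
    omega
  have h1b := h1 b
  have h2b := h2 b
  refine ⟨?_, ?_, ?_⟩
  · rw [← h1b, pos]; omega
  · rw [← not_le, ← not_le, not_iff_not, ← h2b, pos]; omega
  · rw [pos]; omega

theorem two_mul_lt_pos {e : Fin c ↪o Fin n} (he : Rooted e) {p : Fin n} {b : Fin c} :
    2 * (b : ℕ) < pos e p ↔ e b < p := (pos_spec he p b).1

theorem pos_lt_two_mul {e : Fin c ↪o Fin n} (he : Rooted e) {p : Fin n} {b : Fin c} :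
    pos e p < 2 * (b : ℕ) ↔ p < e b := (pos_spec he p b).2.1

theorem pos_lt {e : Fin c ↪o Fin n} (hc : 0 < c) (he : Rooted e) (p : Fin n) :
    pos e p < 2 * c := (pos_spec he p ⟨0, hc⟩).2.2

theorem pos_eq_two_mul {e : Fin c ↪o Fin n} (he : Rooted e) {p : Fin n} {b : Fin c} :
    pos e p = 2 * (b : ℕ) ↔ p = e b := by
  have h1 := two_mul_lt_pos he (p := p) (b := b)
  have h2 := pos_lt_two_mul he (p := p) (b := b)
  constructor
  · intro h
    exact le_antisymm (not_lt.1 fun h' => by have := h1.2 h'; omega)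
      (not_lt.1 fun h' => by have := h2.2 h'; omega)
  · rintro rfl
    have := h1.not.2 (lt_irrefl _)
    have := h2.not.2 (lt_irrefl _)
    omega

theorem pos_apply {e : Fin c ↪o Fin n} (he : Rooted e) (b : Fin c) : pos e (e b) = 2 * (b : ℕ) :=
  (pos_eq_two_mul he).2 rfl

theorem pos_mono {e : Fin c ↪o Fin n} : Monotone (pos e) := by
  intro p q hpq
  unfold pos
  gcongr

/-- Whether a point of `W` lies before or after a vertex of the core depends only on its position,
so crossings with the core are decided by positions. -/
theorem cross_map_iff {e : Fin c ↪o Fin n} (he : Rooted e) {W : Finset (Fin n)}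
    {U : Finset (Fin c)} : Cross W (U.map e.toEmbedding) ↔
      ∃ p ∈ W, ∃ q ∈ W, ¬ Uncrossed U (pos e p) (pos e q) := by
  rw [cross_iff]
  constructor
  · rintro ⟨a, ha, b, hb, p, hp, q, hq, h1, h2⟩
    obtain ⟨p, hp', rfl⟩ := Finset.mem_map.1 hp
    obtain ⟨q, hq', rfl⟩ := Finset.mem_map.1 hq
    simp only [RelEmbedding.coe_toEmbedding, ← two_mul_lt_pos he, ← pos_lt_two_mul he] at h1 h2
    refine ⟨a, ha, b, hb, fun h => h p hp' q hq' (Or.inl h1) ?_⟩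
    unfold Out
    omega
  · rintro ⟨a, ha, b, hb, h⟩
    simp only [Uncrossed, not_forall, not_not] at h
    obtain ⟨u, hu, u', hu', hb', ho⟩ := h
    rcases lt_or_ge (pos e a) (pos e b) with hlt | hlt
    · refine ⟨a, ha, b, hb, e u, Finset.mem_map_of_mem e.toEmbedding hu, e u',
        Finset.mem_map_of_mem e.toEmbedding hu', ?_⟩
      simp only [← two_mul_lt_pos he, ← pos_lt_two_mul he]
      unfold Btw Out at *
      omega
    · refine ⟨b, hb, a, ha, e u, Finset.mem_map_of_mem e.toEmbedding hu, e u',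
        Finset.mem_map_of_mem e.toEmbedding hu', ?_⟩
      simp only [← two_mul_lt_pos he, ← pos_lt_two_mul he]
      unfold Btw Out at *
      omega

theorem exists_pos_eq {e : Fin c ↪o Fin n} (hc : 0 < c) (he : Rooted e) (p : Fin n) :
    (∃ a : Fin c, p = e a) ∨ ∃ a : Fin c, pos e p = 2 * (a : ℕ) + 1 := by
  have hlt := pos_lt hc he p
  rcases Nat.even_or_odd' (pos e p) with ⟨a, h | h⟩
  · exact Or.inl ⟨⟨a, by omega⟩, (pos_eq_two_mul he).1 h⟩
  · exact Or.inr ⟨⟨a, by omega⟩, h⟩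

end Cells

end ChordConfig

namespace ChordConfig

/-! ### The sets of points available to completions -/

section CellSets

variable {n c : ℕ}

/-- The regions of `K`, followed by its flat regions. -/
def allRegions (K : Configuration c) : Finset (Finset (Fin c × Fin c) ⊕ Fin c × Fin c) :=
  (regions K).disjSum (flatRegions K)

open Classical in
/-- The points in the closure of a region or of a flat region. -/
noncomputable def cell (e : Fin c ↪o Fin n) :
    Finset (Fin c × Fin c) ⊕ Fin c × Fin c → Finset (Fin n)
  | Sum.inl R => Finset.univ.filter fun p => InCell R (pos e p)
  | Sum.inr f => {e f.1, e f.2}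

open Classical in
/-- The points on the boundary arcs of a region. -/
noncomputable def gapCell (e : Fin c ↪o Fin n) (R : Finset (Fin c × Fin c)) : Finset (Fin n) :=
  Finset.univ.filter fun p => ∃ a ∈ boundaryArcs R, pos e p = 2 * (a : ℕ) + 1

theorem mem_boundaryArcs {R : Finset (Fin c × Fin c)} {a : Fin c} :
    a ∈ boundaryArcs R ↔ (a, a) ∈ R := by
  simp [boundaryArcs]

theorem gapCell_subset_cell (e : Fin c ↪o Fin n) (R : Finset (Fin c × Fin c)) :
    gapCell e R ⊆ cell e (Sum.inl R) := by
  intro p hp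
  simp only [gapCell, cell, Finset.mem_filter, Finset.mem_univ, true_and] at hp ⊢
  obtain ⟨a, ha, h⟩ := hp
  rw [h]
  exact inCell_odd.2 (mem_boundaryArcs.1 ha)

theorem uncrossed_of_mem_cell {K : Configuration c} {e : Fin c ↪o Fin n} (he : Rooted e)
    {i : Finset (Fin c × Fin c) ⊕ Fin c × Fin c} (hi : i ∈ allRegions K) {p q : Fin n}
    (hp : p ∈ cell e i) (hq : q ∈ cell e i) {U : Finset (Fin c)} (hU : U ∈ K) :
    Uncrossed U (pos e p) (pos e q) := by
  cases i with
  | inl R =>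
    simp only [cell, Finset.mem_filter, Finset.mem_univ, true_and] at hp hq
    exact hp.uncrossed (Finset.inl_mem_disjSum.1 hi) hq hU
  | inr f =>
    have hf := (mem_flatRegions.1 (Finset.inr_mem_disjSum.1 hi)).2.1 U hU
    simp only [cell, Finset.mem_insert, Finset.mem_singleton] at hp hq
    rcases hp with rfl | rfl <;> rcases hq with rfl | rfl <;> simp only [pos_apply he]
    exacts [uncrossed_self _ _, hf, hf.symm, uncrossed_self _ _]

theorem not_cross_of_subset_cell {K : Configuration c} {e : Fin c ↪o Fin n} (he : Rooted e)
    {i : Finset (Fin c × Fin c) ⊕ Fin c × Fin c} (hi : i ∈ allRegions K) {W : Finset (Fin n)}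
    (hW : W ⊆ cell e i) {U : Finset (Fin c)} (hU : U ∈ K) : ¬ Cross W (U.map e.toEmbedding) := by
  rw [cross_map_iff he]
  rintro ⟨p, hp, q, hq, h⟩
  exact h (uncrossed_of_mem_cell he hi (hW hp) (hW hq) hU)

/-- A region touches at most two vertices of any hyperchord of `K`, and a flat cell has only two
points; this disposes of hyperchords with three vertices. The others are crossed inside `K`, whereas
subsets of a cell are not. -/
theorem notMem_of_subset_cell {K : Configuration c} (hK : Spread K) {e : Fin c ↪o Fin n}
    (he : Rooted e) {i : Finset (Fin c × Fin c) ⊕ Fin c × Fin c} (hi : i ∈ allRegions K)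
    {W : Finset (Fin n)} (hW : W ⊆ cell e i) : W ∉ mapConfig e.toEmbedding K := by
  intro hmem
  obtain ⟨U, hU, rfl⟩ := mem_mapConfig.1 hmem
  rcases hK U hU with h3 | ⟨V, hV, hc⟩
  · cases i with
    | inl R =>
      obtain ⟨x, hx, y, hy, z, hz, hxy, hyz⟩ := exists_lt_lt_of_two_lt_card h3
      have hin : ∀ u ∈ U, InCell R (2 * u) := fun u hu => by
        have := hW (Finset.mem_map_of_mem e.toEmbedding hu)
        simpa [cell, pos_apply he] using this
      obtain ⟨g, -, rfl⟩ := mem_regions.1 (Finset.inl_mem_disjSum.1 hi)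
      have h1 := (hin x hx).uncrossed_sideArc hU
      have h2 := (hin y hy).uncrossed_sideArc hU
      have h3 := (hin z hz).uncrossed_sideArc hU
      have k1 := h1 y hy z hz
      have k2 := h2 x hx z hz
      have k3 := h2 z hz x hx
      have k4 := h3 y hy x hx
      have k5 := h1 z hz y hy
      have k6 := h3 x hx y hy
      simp only [Btw, Out, Fin.lt_def] at *
      omega
    | inr f =>
      have := (Finset.card_le_card hW).trans Finset.card_le_two
      rw [Finset.card_map] at this
      omega
  · exact not_cross_of_subset_cell he hi hW hV ((cross_map_orderEmbedding e).2 hc)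

/-- If `W` has a point inside an arc, the region of that arc sees all of `W`. Otherwise `W` consists
of core points, and `exists_cell_of_points` applies. -/
theorem exists_subset_cell {K : Configuration c} (hc : 0 < c) {e : Fin c ↪o Fin n}
    (he : Rooted e) {W : Finset (Fin n)} (hcard : 2 ≤ W.card)
    (hW : ∀ U ∈ K, ¬ Cross W (U.map e.toEmbedding)) (hWK : W ∉ mapConfig e.toEmbedding K) :
    ∃ i ∈ allRegions K, W ⊆ cell e i := by
  have hunc : ∀ U ∈ K, ∀ p ∈ W, ∀ q ∈ W, Uncrossed U (pos e p) (pos e q) := by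
    intro U hU p hp q hq
    by_contra h
    exact hW U hU ((cross_map_iff he).2 ⟨p, hp, q, hq, h⟩)
  by_cases hodd : ∃ p ∈ W, ∃ a : Fin c, pos e p = 2 * (a : ℕ) + 1
  · obtain ⟨p, hp, a, ha⟩ := hodd
    refine ⟨Sum.inl (regionOf K (a, a)),
      Finset.inl_mem_disjSum.2 (mem_regions.2 ⟨_, isFree_self K a, rfl⟩), fun q hq => ?_⟩
    simp only [cell, Finset.mem_filter, Finset.mem_univ, true_and]
    have hu := fun U hU => hunc U hU p hp q hq
    rw [ha] at hu
    rcases exists_pos_eq hc he q with ⟨v, rfl⟩ | ⟨b, hb⟩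
    · rw [pos_apply he] at hu ⊢
      refine inCell_even.2 ⟨a, mem_regionOf.2 ⟨isFree_iff.2 fun U hU _ => (hu U hU).symm,
        fun U hU => ?_⟩⟩
      rw [sideArc_self]
      unfold sideArc
      split_ifs with hv
      · exact uncrossed_self _ _
      · exact (hu U hU).trans_notMem (uncrossed_succ _ _) hv
    · rw [hb] at hu ⊢
      refine inCell_odd.2 (mem_regionOf.2 ⟨isFree_self K b, fun U hU => ?_⟩)
      rw [sideArc_self, sideArc_self]
      exact hu U hU
  · push Not at hodd
    have hsub : W ⊆ Finset.univ.map e.toEmbedding := by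
      intro p hp
      rcases exists_pos_eq hc he p with ⟨v, rfl⟩ | ⟨b, hb⟩
      · exact Finset.mem_map_of_mem e.toEmbedding (Finset.mem_univ v)
      · exact absurd hb (hodd p hp b)
    obtain ⟨V, -, rfl⟩ := Finset.subset_map_iff.1 hsub
    rw [Finset.card_map] at hcard
    rw [map_mem_mapConfig] at hWK
    have hV : ∀ U ∈ K, ∀ x ∈ V, ∀ y ∈ V, Uncrossed U (2 * x) (2 * y) := by
      intro U hU x hx y hy
      have := hunc U hU _ (Finset.mem_map_of_mem e.toEmbedding hx) _
        (Finset.mem_map_of_mem e.toEmbedding hy)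
      simpa only [RelEmbedding.coe_toEmbedding, pos_apply he] using this
    rcases exists_cell_of_points hcard hWK hV with ⟨R, hR, h⟩ | ⟨f, hf, h⟩
    · refine ⟨Sum.inl R, Finset.inl_mem_disjSum.2 hR, fun p hp => ?_⟩
      obtain ⟨x, hx, rfl⟩ := Finset.mem_map.1 hp
      simpa [cell, pos_apply he] using h x hx
    · refine ⟨Sum.inr f, Finset.inr_mem_disjSum.2 hf, ?_⟩
      rw [h]
      simp [cell, Finset.map_insert]

/-- An arc belongs to one region only, and an even position is occupied by a single point. Hence
strict inequalities between points of different cells survive passage to positions. -/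
theorem pos_ne_of_cells {K : Configuration c} (hc : 0 < c) {e : Fin c ↪o Fin n} (he : Rooted e)
    {R R' : Finset (Fin c × Fin c)} (hR : R ∈ regions K) (hR' : R' ∈ regions K) (hne : R ≠ R')
    {p q : Fin n} (hp : p ∈ cell e (Sum.inl R)) (hq : q ∈ cell e (Sum.inl R')) (hpq : p ≠ q) :
    pos e p ≠ pos e q := by
  intro heq
  simp only [cell, Finset.mem_filter, Finset.mem_univ, true_and] at hp hq
  rcases exists_pos_eq hc he p with ⟨v, rfl⟩ | ⟨b, hb⟩
  · rw [pos_apply he] at heq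
    exact hpq ((pos_eq_two_mul he).1 heq.symm).symm
  · rw [← heq] at hq
    rw [hb] at hp hq
    exact hne (region_eq_of_inCell_odd hR hR' hp hq)

/-- A crossing of points becomes an alternation of positions, which is impossible for two regions,
and also for a flat cell since its ends belong to a common hyperchord of the core. -/
theorem not_cross_of_cells {K : Configuration c} (hc : 0 < c) {e : Fin c ↪o Fin n}
    (he : Rooted e) {i j : Finset (Fin c × Fin c) ⊕ Fin c × Fin c} (hi : i ∈ allRegions K)
    (hj : j ∈ allRegions K) (hij : i ≠ j) {W W' : Finset (Fin n)} (hW : W ⊆ cell e i)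
    (hW' : W' ⊆ cell e j) : ¬ Cross W W' := by
  have flat : ∀ {i : Finset (Fin c × Fin c) ⊕ Fin c × Fin c} {f : Fin c × Fin c}
      {W W' : Finset (Fin n)}, i ∈ allRegions K → f ∈ flatRegions K → W ⊆ cell e i →
      W' ⊆ cell e (Sum.inr f) → ¬ Cross W W' := by
    intro i f W W' hi hf hW hW' h
    obtain ⟨a, ha, b, hb, p, hp, q, hq, ⟨h1, h2⟩, h3⟩ := cross_iff.1 h
    have hu := fun U hU => uncrossed_of_mem_cell he hi (hW ha) (hW hb) (U := U) hU
    obtain ⟨k1, k2⟩ := flatRegion_not_alternate hf hu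
    have hp' := hW' hp
    have hq' := hW' hq
    simp only [cell, Finset.mem_insert, Finset.mem_singleton] at hp' hq'
    rcases hp' with rfl | rfl <;> rcases hq' with rfl | rfl <;>
      simp only [← two_mul_lt_pos he, ← pos_lt_two_mul he] at h1 h2 h3 <;>
      unfold Btw Out at k1 k2 <;> omega
  cases j with
  | inr f => exact flat hi (Finset.inr_mem_disjSum.1 hj) hW hW'
  | inl R' =>
    cases i with
    | inr f => exact fun h => flat hj (Finset.inr_mem_disjSum.1 hi) hW' hW (cross_comm.1 h)
    | inl R =>
      intro h
      obtain ⟨a, ha, b, hb, p, hp, q, hq, ⟨h1, h2⟩, h3⟩ := cross_iff.1 h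
      have hR := Finset.inl_mem_disjSum.1 hi
      have hR' := Finset.inl_mem_disjSum.1 hj
      have hne : R ≠ R' := fun h => hij (h ▸ rfl)
      have hlt : ∀ {x y}, x ∈ W → y ∈ W' → x < y → pos e x < pos e y := fun hx hy hxy =>
        lt_of_le_of_ne (pos_mono hxy.le)
          (pos_ne_of_cells hc he hR hR' hne (hW hx) (hW' hy) hxy.ne)
      have hgt : ∀ {x y}, x ∈ W' → y ∈ W → x < y → pos e x < pos e y := fun hx hy hxy =>
        lt_of_le_of_ne (pos_mono hxy.le)
          (pos_ne_of_cells hc he hR' hR hne.symm (hW' hx) (hW hy) hxy.ne)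
      have hmem : ∀ {x}, x ∈ W → InCell R (pos e x) := fun hx => by
        simpa [cell] using hW hx
      have hmem' : ∀ {x}, x ∈ W' → InCell R' (pos e x) := fun hx => by
        simpa [cell] using hW' hx
      have k1 := hlt ha hp h1
      have k2 := hgt hp hb h2
      refine InCell.not_alternate hR hR' hne (hmem ha) (hmem hb) (hmem' hp) (hmem' hq)
        (Or.inl ⟨k1, k2⟩) ?_
      rcases h3 with h3 | h3
      · exact Or.inl ⟨hgt hq ha h3, (hgt hq ha h3).trans (k1.trans k2)⟩
      · exact Or.inr ⟨(k1.trans k2).trans (hlt hb hq h3), hlt hb hq h3⟩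

/-- Two vertices already determine the cell: distinct regions share at most one position, a region
does not touch both ends of a flat chord, and a flat cell is its pair of ends. -/
theorem cell_eq_of_subset {K : Configuration c} (hK : Spread K) (hc : 0 < c)
    {e : Fin c ↪o Fin n} (he : Rooted e) {i j : Finset (Fin c × Fin c) ⊕ Fin c × Fin c}
    (hi : i ∈ allRegions K) (hj : j ∈ allRegions K) {W : Finset (Fin n)} (hcard : 2 ≤ W.card)
    (hW : W ⊆ cell e i) (hW' : W ⊆ cell e j) : i = j := by
  have flat : ∀ {f : Fin c × Fin c}, f ∈ flatRegions K → W ⊆ cell e (Sum.inr f) →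
      W = {e f.1, e f.2} := fun {f} hf hWf =>
    Finset.eq_of_subset_of_card_le hWf (Finset.card_le_two.trans hcard)
  have noflat : ∀ {f : Fin c × Fin c} {R : Finset (Fin c × Fin c)}, f ∈ flatRegions K →
      R ∈ regions K → W ⊆ cell e (Sum.inr f) → W ⊆ cell e (Sum.inl R) → False := by
    intro f R hf hR h1 h2
    have := flat hf h1
    have k1 : e f.1 ∈ cell e (Sum.inl R) := h2 (by rw [this]; simp)
    have k2 : e f.2 ∈ cell e (Sum.inl R) := h2 (by rw [this]; simp)
    simp only [cell, Finset.mem_filter, Finset.mem_univ, true_and, pos_apply he] at k1 k2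
    exact flatRegion_not_inCell hf hR k1 k2
  cases i with
  | inr f =>
    have hf := Finset.inr_mem_disjSum.1 hi
    cases j with
    | inl R => exact (noflat hf (Finset.inl_mem_disjSum.1 hj) hW hW').elim
    | inr f' =>
      have hf' := Finset.inr_mem_disjSum.1 hj
      have h := (flat hf hW).symm.trans (flat hf' hW')
      have l1 := (mem_flatRegions.1 hf).1
      have l2 := (mem_flatRegions.1 hf').1
      have m1 : e f.1 ∈ ({e f'.1, e f'.2} : Finset (Fin n)) := h ▸ by simp
      have m2 : e f.2 ∈ ({e f'.1, e f'.2} : Finset (Fin n)) := h ▸ by simp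
      simp only [Finset.mem_insert, Finset.mem_singleton, EmbeddingLike.apply_eq_iff_eq] at m1 m2
      congr 1
      refine Prod.ext ?_ ?_ <;> simp only [Fin.ext_iff, Fin.lt_def] at * <;> omega
  | inl R =>
    have hR := Finset.inl_mem_disjSum.1 hi
    cases j with
    | inr f => exact (noflat (Finset.inr_mem_disjSum.1 hj) hR hW' hW).elim
    | inl R' =>
      have hR' := Finset.inl_mem_disjSum.1 hj
      by_contra hij
      have hne : R ≠ R' := fun h => hij (h ▸ rfl)
      obtain ⟨p, hp, q, hq, hpq⟩ := Finset.one_lt_card.1 hcard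
      refine hne (region_eq_of_inCell hK hR hR'
        (pos_ne_of_cells hc he hR hR' hne (hW hp) (hW' hq) hpq) ?_ ?_ ?_ ?_)
      · simpa [cell] using hW hp
      · simpa [cell] using hW hq
      · simpa [cell] using hW' hp
      · simpa [cell] using hW' hq

/-! ### Cells of partitions -/

theorem gapCell_subset_compl {e : Fin c ↪o Fin n} (he : Rooted e) (R : Finset (Fin c × Fin c)) :
    gapCell e R ⊆ (Finset.univ.map e.toEmbedding)ᶜ := by
  intro p hp
  simp only [gapCell, Finset.mem_filter, Finset.mem_univ, true_and] at hp
  obtain ⟨a, -, ha⟩ := hp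
  rw [Finset.mem_compl, Finset.mem_map]
  rintro ⟨v, -, rfl⟩
  rw [RelEmbedding.coe_toEmbedding, pos_apply he] at ha
  omega

theorem exists_odd_of_mem_compl {e : Fin c ↪o Fin n} (hc : 0 < c) (he : Rooted e) {p : Fin n}
    (hp : p ∈ (Finset.univ.map e.toEmbedding)ᶜ) : ∃ a : Fin c, pos e p = 2 * (a : ℕ) + 1 := by
  rcases exists_pos_eq hc he p with ⟨v, rfl⟩ | h
  · simp at hp
  · exact h

/-- A block avoiding the core points consists of points inside arcs, and uncrossed arcs belong to
the same region. Neither peaks nor flat regions play a role for partitions. -/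
theorem exists_subset_gapCell {K : Configuration c} (hc : 0 < c) {e : Fin c ↪o Fin n}
    (he : Rooted e) {W : Finset (Fin n)} (hne : W.Nonempty)
    (hWc : W ⊆ (Finset.univ.map e.toEmbedding)ᶜ)
    (hW : ∀ U ∈ K, ¬ Cross W (U.map e.toEmbedding)) : ∃ R ∈ regions K, W ⊆ gapCell e R := by
  obtain ⟨p, hp⟩ := hne
  obtain ⟨a, ha⟩ := exists_odd_of_mem_compl hc he (hWc hp)
  refine ⟨regionOf K (a, a), mem_regions.2 ⟨_, isFree_self K a, rfl⟩, fun q hq => ?_⟩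
  obtain ⟨b, hb⟩ := exists_odd_of_mem_compl hc he (hWc hq)
  simp only [gapCell, Finset.mem_filter, Finset.mem_univ, true_and]
  refine ⟨b, mem_boundaryArcs.2 (mem_regionOf.2 ⟨isFree_self K b, fun U hU => ?_⟩), hb⟩
  rw [sideArc_self, sideArc_self, ← ha, ← hb]
  by_contra h
  exact hW U hU ((cross_map_iff he).2 ⟨p, hp, q, hq, h⟩)

theorem gapCell_disjoint {K : Configuration c} (e : Fin c ↪o Fin n)
    {R R' : Finset (Fin c × Fin c)} (hR : R ∈ regions K) (hR' : R' ∈ regions K) (hne : R ≠ R') :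
    Disjoint (gapCell e R) (gapCell e R') := by
  rw [Finset.disjoint_left]
  intro p hp hp'
  simp only [gapCell, Finset.mem_filter, Finset.mem_univ, true_and] at hp hp'
  obtain ⟨a, ha, h⟩ := hp
  obtain ⟨b, hb, h'⟩ := hp'
  obtain rfl : a = b := Fin.ext (by omega)
  exact hne (region_eq_of_inCell_odd hR hR' (inCell_odd.2 (mem_boundaryArcs.1 ha))
    (inCell_odd.2 (mem_boundaryArcs.1 hb)))

theorem exists_mem_gapCell {K : Configuration c} (hc : 0 < c) {e : Fin c ↪o Fin n}
    (he : Rooted e) {p : Fin n} (hp : p ∈ (Finset.univ.map e.toEmbedding)ᶜ) :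
    ∃ R ∈ regions K, p ∈ gapCell e R := by
  obtain ⟨a, ha⟩ := exists_odd_of_mem_compl hc he hp
  refine ⟨regionOf K (a, a), mem_regions.2 ⟨_, isFree_self K a, rfl⟩, ?_⟩
  simp only [gapCell, Finset.mem_filter, Finset.mem_univ, true_and]
  exact ⟨a, mem_boundaryArcs.2 (mem_regionOf_self (isFree_self K a)), ha⟩

/-! ### Sizes of the cells -/

/-- The number of points on arc `a`. -/
def gap (e : Fin c ↪o Fin n) (a : Fin c) : ℕ :=
  (Finset.univ.filter fun p => pos e p = 2 * (a : ℕ) + 1).card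

theorem card_gapCell (e : Fin c ↪o Fin n) (R : Finset (Fin c × Fin c)) :
    (gapCell e R).card = ∑ a ∈ boundaryArcs R, gap e a := by
  classical
  have : gapCell e R = (boundaryArcs R).biUnion
      fun a => Finset.univ.filter fun p => pos e p = 2 * (a : ℕ) + 1 := by
    ext p
    simp [gapCell]
  rw [this, Finset.card_biUnion]
  · rfl
  · intro a _ b _ hab
    rw [Function.onFun, Finset.disjoint_left]
    intro p hp hp'
    simp only [Finset.mem_filter, Finset.mem_univ, true_and] at hp hp'
    exact hab (Fin.ext (by omega))

/-- Each point lies on a hyperchord with at least two vertices. -/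
def Full (K : Configuration c) : Prop := ∀ v : Fin c, ∃ U ∈ K, v ∈ U ∧ 2 ≤ U.card

theorem val_finRotate (a : Fin c) :
    (finRotate c a : ℕ) = a + 1 ∧ (a : ℕ) + 1 < c ∨
      (finRotate c a : ℕ) = 0 ∧ (a : ℕ) + 1 = c := by
  cases c with
  | zero => exact a.elim0
  | succ c =>
    rw [coe_finRotate]
    have := a.2
    split_ifs with h
    · right
      rw [h]
      simp
    · left
      have : (a : ℕ) ≠ c := fun h' => h (Fin.ext h')
      omega

/-- The point between two consecutive arcs lies on a hyperchord with another vertex, and this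
hyperchord separates them. -/
theorem finRotate_notMem_boundaryArcs {K : Configuration c} (hK : Full K)
    {R : Finset (Fin c × Fin c)} (hR : R ∈ regions K) {a : Fin c} (ha : a ∈ boundaryArcs R) :
    finRotate c a ∉ boundaryArcs R := by
  intro hb
  rw [mem_boundaryArcs] at ha hb
  obtain ⟨U, hU, hv, hcard⟩ := hK (finRotate c a)
  obtain ⟨u, hu, hne⟩ := Finset.exists_mem_ne hcard (finRotate c a)
  have h := (inCell_odd.2 ha).uncrossed hR (inCell_odd.2 hb) hU
  have h1 := h _ hv u hu
  have h2 := h u hu _ hv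
  have hne' : (u : ℕ) ≠ (finRotate c a : ℕ) := fun h => hne (Fin.ext h)
  have hlt := u.2
  rcases val_finRotate a with ⟨h3, h4⟩ | ⟨h3, h4⟩ <;> rw [h3] at h1 h2 hne' <;>
    unfold Btw Out at h1 h2 <;> omega

theorem finRotate_mem_region {K : Configuration c} {R : Finset (Fin c × Fin c)}
    (hR : R ∈ regions K) {a : Fin c} (ha : (a, a) ∈ R) : (finRotate c a, a) ∈ R := by
  have hu : ∀ U : Finset (Fin c), Uncrossed U (2 * (finRotate c a : ℕ)) (2 * a + 1) := by
    intro U u hu u' hu'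
    have := u.2
    have := u'.2
    rcases val_finRotate a with ⟨h3, h4⟩ | ⟨h3, h4⟩ <;> rw [h3] <;> unfold Btw Out <;> omega
  rw [← regionOf_eq_of_mem hR ha]
  refine mem_regionOf.2 ⟨isFree_iff.2 fun U _ _ => hu U, fun U hU => ?_⟩
  rw [sideArc_self]
  unfold sideArc
  split_ifs with h
  · exact uncrossed_self _ _
  · exact (hu U).symm.trans_notMem (uncrossed_succ _ _) h

-- Each boundary arc contributes its two ends. No end is shared, because consecutive arcs lie in
-- different regions; the other touched points are the peaks by definition.
open Classical in
theorem card_touched {K : Configuration c} (hK : Full K) {R : Finset (Fin c × Fin c)}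
    (hR : R ∈ regions K) : (Finset.univ.filter fun v => ∃ a, (v, a) ∈ R).card =
      2 * (boundaryArcs R).card + (peaks R).card := by
  have hsplit : (Finset.univ.filter fun v => ∃ a, (v, a) ∈ R) =
      (boundaryArcs R ∪ (boundaryArcs R).map (finRotate c).toEmbedding) ∪ peaks R := by
    ext v
    simp only [Finset.mem_filter, Finset.mem_univ, true_and, Finset.mem_union, Finset.mem_map,
      Equiv.coe_toEmbedding, peaks]
    constructor
    · intro h
      by_cases hv : ∀ a ∈ boundaryArcs R, v ≠ a ∧ v ≠ finRotate c a
      · exact Or.inr ⟨h, hv⟩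
      · left
        push Not at hv
        obtain ⟨a, ha, hv⟩ := hv
        by_cases hva : v = a
        · exact Or.inl (hva ▸ ha)
        · exact Or.inr ⟨a, ha, (hv hva).symm⟩
    · rintro ((h | ⟨a, ha, rfl⟩) | h)
      · exact ⟨v, mem_boundaryArcs.1 h⟩
      · exact ⟨a, finRotate_mem_region hR (mem_boundaryArcs.1 ha)⟩
      · exact h.1
  rw [hsplit, Finset.card_union_of_disjoint, Finset.card_union_of_disjoint, Finset.card_map]
  · ring
  · rw [Finset.disjoint_left]
    intro v hv hv'
    obtain ⟨a, ha, rfl⟩ := Finset.mem_map.1 hv'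
    exact finRotate_notMem_boundaryArcs hK hR ha hv
  · rw [Finset.disjoint_right]
    intro v hv hv'
    simp only [peaks, Finset.mem_filter, Finset.mem_univ, true_and] at hv
    rcases Finset.mem_union.1 hv' with h | h
    · exact (hv.2 v h).1 rfl
    · obtain ⟨a, ha, rfl⟩ := Finset.mem_map.1 h
      exact (hv.2 a ha).2 rfl

theorem card_cell_inl {K : Configuration c} (hK : Full K) (hc : 0 < c) {e : Fin c ↪o Fin n}
    (he : Rooted e) {R : Finset (Fin c × Fin c)} (hR : R ∈ regions K) :
    (cell e (Sum.inl R)).card =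
      2 * (boundaryArcs R).card + (peaks R).card + ∑ a ∈ boundaryArcs R, gap e a := by
  classical
  have hsplit : cell e (Sum.inl R) =
      (Finset.univ.filter fun v => ∃ a, (v, a) ∈ R).map e.toEmbedding ∪ gapCell e R := by
    ext p
    simp only [cell, gapCell, Finset.mem_filter, Finset.mem_univ, true_and, Finset.mem_union,
      Finset.mem_map, RelEmbedding.coe_toEmbedding]
    rcases exists_pos_eq hc he p with ⟨v, rfl⟩ | ⟨b, hb⟩
    · rw [pos_apply he, inCell_even]
      constructor
      · exact fun h => Or.inl ⟨v, h, rfl⟩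
      · rintro (⟨w, hw, h⟩ | ⟨a, -, h⟩)
        · rwa [← e.injective h]
        · omega
    · rw [hb, inCell_odd]
      constructor
      · exact fun h => Or.inr ⟨b, mem_boundaryArcs.2 h, rfl⟩
      · rintro (⟨w, hw, rfl⟩ | ⟨a, ha, h⟩)
        · rw [pos_apply he] at hb
          omega
        · obtain rfl : b = a := Fin.ext (by omega)
          exact mem_boundaryArcs.1 ha
  rw [hsplit, Finset.card_union_of_disjoint, Finset.card_map, card_touched hK hR, card_gapCell]
  rw [Finset.disjoint_right]
  intro p hp hp'
  have := gapCell_subset_compl he R hp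
  rw [Finset.mem_compl] at this
  exact this (Finset.map_subset_map.2 (Finset.subset_univ _) hp')

theorem card_cell_inr {K : Configuration c} (e : Fin c ↪o Fin n) {f : Fin c × Fin c}
    (hf : f ∈ flatRegions K) : (cell e (Sum.inr f)).card = 2 :=
  Finset.card_pair fun h => (mem_flatRegions.1 hf).1.ne (e.injective h)

end CellSets

end ChordConfig

namespace ChordConfig

/-! ### Product formula for the completions of a core -/

section NoncrossingSums

variable {n c : ℕ} {R : Type*} [CommRing R]

theorem sum_powerset_union {α : Type*} [DecidableEq α] (w : R) {A B : Finset α}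
    (hAB : Disjoint A B) {P P₁ P₂ : Finset α → Prop} [DecidablePred P] [DecidablePred P₁]
    [DecidablePred P₂]
    (h : ∀ D₁ ⊆ A, ∀ D₂ ⊆ B, P (D₁ ∪ D₂) ↔ P₁ D₁ ∧ P₂ D₂) :
    ∑ D ∈ (A ∪ B).powerset with P D, w ^ D.card =
      (∑ D ∈ A.powerset with P₁ D, w ^ D.card) * ∑ D ∈ B.powerset with P₂ D, w ^ D.card := by
  rw [Finset.sum_mul_sum, ← Finset.sum_product']
  refine Finset.sum_nbij' (fun D => (D ∩ A, D ∩ B)) (fun D => D.1 ∪ D.2) ?_ ?_ ?_ ?_ ?_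
  · intro D hD
    simp only [Finset.mem_filter, Finset.mem_powerset, Finset.mem_product] at hD ⊢
    have hu : D ∩ A ∪ D ∩ B = D := by
      rw [← Finset.inter_union_distrib_left, Finset.inter_eq_left.2 hD.1]
    have := (h (D ∩ A) Finset.inter_subset_right (D ∩ B) Finset.inter_subset_right).1
      (hu.symm ▸ hD.2)
    exact ⟨⟨Finset.inter_subset_right, this.1⟩, Finset.inter_subset_right, this.2⟩
  · rintro ⟨D₁, D₂⟩ hD
    simp only [Finset.mem_filter, Finset.mem_powerset, Finset.mem_product] at hD ⊢
    exact ⟨Finset.union_subset_union hD.1.1 hD.2.1, (h _ hD.1.1 _ hD.2.1).2 ⟨hD.1.2, hD.2.2⟩⟩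
  · intro D hD
    simp only [Finset.mem_filter, Finset.mem_powerset] at hD
    simp only
    rw [← Finset.inter_union_distrib_left, Finset.inter_eq_left.2 hD.1]
  · rintro ⟨D₁, D₂⟩ hD
    simp only [Finset.mem_filter, Finset.mem_powerset, Finset.mem_product] at hD
    have h1 : D₁ ∩ B = ∅ := Finset.disjoint_iff_inter_eq_empty.1
      (Finset.disjoint_of_subset_left hD.1.1 hAB)
    have h2 : D₂ ∩ A = ∅ := Finset.disjoint_iff_inter_eq_empty.1
      (Finset.disjoint_of_subset_left hD.2.1 hAB.symm)
    simp only [Finset.union_inter_distrib_right, h1, h2, Finset.inter_eq_left.2 hD.1.1,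
      Finset.inter_eq_left.2 hD.2.1, Finset.union_empty, Finset.empty_union]
  · intro D hD
    simp only [Finset.mem_filter, Finset.mem_powerset] at hD
    rw [← pow_add, ← Finset.card_union_of_disjoint, ← Finset.inter_union_distrib_left,
      Finset.inter_eq_left.2 hD.1]
    exact Finset.disjoint_of_subset_left Finset.inter_subset_right
      (Finset.disjoint_of_subset_right Finset.inter_subset_right hAB)

open Classical in
/-- The hyperchords with vertices in `A` and size in `S`. -/
noncomputable def hyperSets (S : Set ℕ) (A : Finset (Fin n)) : Finset (Finset (Fin n)) :=
  A.powerset.filter fun W => W.card ∈ S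

theorem mem_hyperSets {S : Set ℕ} {A W : Finset (Fin n)} :
    W ∈ hyperSets S A ↔ W ⊆ A ∧ W.card ∈ S := by
  simp [hyperSets]

open Classical in
/-- The sum of `w ^ |D|` over the noncrossing fillings of `A`. -/
noncomputable def ncSumOn (part : Prop) (S : Set ℕ) (w : R) (A : Finset (Fin n)) : R :=
  ∑ D ∈ (hyperSets S A).powerset with NonCrossing D ∧ IsFilling part S A D, w ^ D.card

/-- The sum of `w ^ |D|` over the noncrossing fillings of `N` points. -/
noncomputable def ncSum (part : Prop) (S : Set ℕ) (w : R) (N : ℕ) : R :=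
  ncSumOn part S w (Finset.univ : Finset (Fin N))

theorem nonCrossing_mapConfig (e : Fin c ↪o Fin n) {D : Configuration c} :
    NonCrossing (mapConfig e.toEmbedding D) ↔ NonCrossing D := by
  constructor
  · intro h U hU V hV hne hc
    exact h _ (map_mem_mapConfig.2 hU) _ (map_mem_mapConfig.2 hV)
      (fun h => hne (Finset.map_injective _ h)) ((cross_map_orderEmbedding e).2 hc)
  · intro h W hW W' hW' hne hc
    obtain ⟨U, hU, rfl⟩ := mem_mapConfig.1 hW
    obtain ⟨V, hV, rfl⟩ := mem_mapConfig.1 hW'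
    exact h U hU V hV (fun h => hne (h ▸ rfl)) ((cross_map_orderEmbedding e).1 hc)

theorem isFilling_mapConfig {part : Prop} {S : Set ℕ} (f : Fin c ↪ Fin n)
    {D : Configuration c} {A : Finset (Fin c)} :
    IsFilling part S (A.map f) (mapConfig f D) ↔ IsFilling part S A D := by
  constructor
  · rintro ⟨h1, h2, h3, h4⟩
    refine ⟨fun W hW => ?_, fun hp W hW => ?_, fun hp W hW W' hW' hne => ?_, fun hp v hv => ?_⟩
    · simpa using h1 _ (map_mem_mapConfig.2 hW)
    · simpa using h2 hp _ (map_mem_mapConfig.2 hW)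
    · simpa using h3 hp _ (map_mem_mapConfig.2 hW) _ (map_mem_mapConfig.2 hW')
        (fun h => hne (Finset.map_injective _ h))
    · obtain ⟨W, hW, hv⟩ := h4 hp (f v) (Finset.mem_map_of_mem f hv)
      obtain ⟨U, hU, rfl⟩ := mem_mapConfig.1 hW
      exact ⟨U, hU, by simpa using hv⟩
  · rintro ⟨h1, h2, h3, h4⟩
    refine ⟨fun W hW => ?_, fun hp W hW => ?_, fun hp W hW W' hW' hne => ?_, fun hp v hv => ?_⟩
    · obtain ⟨U, hU, rfl⟩ := mem_mapConfig.1 hW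
      simpa using h1 _ hU
    · obtain ⟨U, hU, rfl⟩ := mem_mapConfig.1 hW
      simpa using h2 hp _ hU
    · obtain ⟨U, hU, rfl⟩ := mem_mapConfig.1 hW
      obtain ⟨U', hU', rfl⟩ := mem_mapConfig.1 hW'
      simpa using h3 hp U hU U' hU' (fun h => hne (h ▸ rfl))
    · obtain ⟨v, hvA, rfl⟩ := Finset.mem_map.1 hv
      obtain ⟨W, hW, hvW⟩ := h4 hp v hvA
      exact ⟨_, map_mem_mapConfig.2 hW, Finset.mem_map_of_mem f hvW⟩

theorem mapConfig_subset_hyperSets {S : Set ℕ} (f : Fin c ↪ Fin n) {D : Configuration c}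
    {A : Finset (Fin c)} : mapConfig f D ⊆ hyperSets S (A.map f) ↔ D ⊆ hyperSets S A := by
  constructor
  · intro h W hW
    have := mem_hyperSets.1 (h (map_mem_mapConfig.2 hW))
    simpa [mem_hyperSets] using this
  · intro h W hW
    obtain ⟨U, hU, rfl⟩ := mem_mapConfig.1 hW
    have := mem_hyperSets.1 (h hU)
    simpa [mem_hyperSets] using this

theorem ncSumOn_map (part : Prop) (S : Set ℕ) (w : R) (e : Fin c ↪o Fin n)
    (A : Finset (Fin c)) : ncSumOn part S w (A.map e.toEmbedding) = ncSumOn part S w A := by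
  classical
  symm
  refine Finset.sum_bij (fun D _ => mapConfig e.toEmbedding D) ?_ ?_ ?_ ?_
  · intro D hD
    simpa only [Finset.mem_filter, Finset.mem_powerset, mapConfig_subset_hyperSets,
      nonCrossing_mapConfig, isFilling_mapConfig] using hD
  · exact fun D _ D' _ h => mapConfig_injective _ h
  · intro D hD
    obtain ⟨D', rfl⟩ := exists_mapConfig_eq (C := D) e fun U hU =>
      (mem_hyperSets.1 (Finset.mem_powerset.1 (Finset.mem_filter.1 hD).1 hU)).1.trans
        (Finset.map_subset_map.2 (Finset.subset_univ _))
    refine ⟨D', ?_, rfl⟩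
    simpa only [Finset.mem_filter, Finset.mem_powerset, mapConfig_subset_hyperSets,
      nonCrossing_mapConfig, isFilling_mapConfig] using hD
  · intro D _
    rw [card_mapConfig]

/-- Noncrossing fillings depend only on the order of the points, so `A` can be relabelled
increasingly. -/
theorem ncSumOn_eq (part : Prop) (S : Set ℕ) (w : R) (A : Finset (Fin n)) :
    ncSumOn part S w A = ncSum part S w A.card := by
  have : A = Finset.univ.map (A.orderEmbOfFin rfl).toEmbedding := by
    apply Finset.coe_injective
    simp
  conv_lhs => rw [this]
  exact ncSumOn_map _ _ _ _ _

theorem nonCrossing_union {A B D₁ D₂ : Configuration n}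
    (h : ∀ W ∈ A, ∀ W' ∈ B, ¬ Cross W W') (h₁ : D₁ ⊆ A) (h₂ : D₂ ⊆ B) :
    NonCrossing (D₁ ∪ D₂) ↔ NonCrossing D₁ ∧ NonCrossing D₂ := by
  constructor
  · intro hn
    exact ⟨fun U hU V hV => hn U (Finset.mem_union_left _ hU) V (Finset.mem_union_left _ hV),
      fun U hU V hV => hn U (Finset.mem_union_right _ hU) V (Finset.mem_union_right _ hV)⟩
  · rintro ⟨k1, k2⟩ U hU V hV hne
    rcases Finset.mem_union.1 hU with hU | hU <;> rcases Finset.mem_union.1 hV with hV | hV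
    · exact k1 U hU V hV hne
    · exact h U (h₁ hU) V (h₂ hV)
    · exact fun hc => h V (h₁ hV) U (h₂ hU) (cross_comm.1 hc)
    · exact k2 U hU V hV hne

theorem isFilling_union {part : Prop} {S : Set ℕ} {A B : Finset (Fin n)} {D₁ D₂ : Configuration n}
    (hAB : part → Disjoint A B) (h₁ : ∀ W ∈ D₁, W ⊆ A) (h₂ : ∀ W ∈ D₂, W ⊆ B) :
    IsFilling part S (A ∪ B) (D₁ ∪ D₂) ↔ IsFilling part S A D₁ ∧ IsFilling part S B D₂ := by
  constructor
  · rintro ⟨k1, k2, k3, k4⟩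
    refine ⟨⟨fun W hW => k1 W (Finset.mem_union_left _ hW), fun _ => h₁,
      fun hp W hW W' hW' => k3 hp W (Finset.mem_union_left _ hW) W' (Finset.mem_union_left _ hW'),
      fun hp v hv => ?_⟩, ⟨fun W hW => k1 W (Finset.mem_union_right _ hW), fun _ => h₂,
      fun hp W hW W' hW' => k3 hp W (Finset.mem_union_right _ hW) W'
        (Finset.mem_union_right _ hW'), fun hp v hv => ?_⟩⟩
    · obtain ⟨W, hW, hvW⟩ := k4 hp v (Finset.mem_union_left _ hv)
      rcases Finset.mem_union.1 hW with hW | hW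
      · exact ⟨W, hW, hvW⟩
      · exact absurd (h₂ W hW hvW) (Finset.disjoint_left.1 (hAB hp) hv)
    · obtain ⟨W, hW, hvW⟩ := k4 hp v (Finset.mem_union_right _ hv)
      rcases Finset.mem_union.1 hW with hW | hW
      · exact absurd (h₁ W hW hvW) (Finset.disjoint_right.1 (hAB hp) hv)
      · exact ⟨W, hW, hvW⟩
  · rintro ⟨⟨k1, k2, k3, k4⟩, ⟨l1, l2, l3, l4⟩⟩
    have hdis : part → ∀ W ∈ D₁, ∀ W' ∈ D₂, Disjoint W W' := fun hp W hW W' hW' =>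
      Finset.disjoint_of_subset_left (h₁ W hW) (Finset.disjoint_of_subset_right (h₂ W' hW') (hAB hp))
    refine ⟨fun W hW => ?_, fun hp W hW => ?_, fun hp W hW W' hW' hne => ?_, fun hp v hv => ?_⟩
    · rcases Finset.mem_union.1 hW with hW | hW
      exacts [k1 W hW, l1 W hW]
    · rcases Finset.mem_union.1 hW with hW | hW
      exacts [(h₁ W hW).trans Finset.subset_union_left, (h₂ W hW).trans Finset.subset_union_right]
    · rcases Finset.mem_union.1 hW with hW | hW <;> rcases Finset.mem_union.1 hW' with hW' | hW'
      exacts [k3 hp W hW W' hW' hne, hdis hp W hW W' hW', (hdis hp W' hW' W hW).symm,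
        l3 hp W hW W' hW' hne]
    · rcases Finset.mem_union.1 hv with hv | hv
      · obtain ⟨W, hW, hvW⟩ := k4 hp v hv
        exact ⟨W, Finset.mem_union_left _ hW, hvW⟩
      · obtain ⟨W, hW, hvW⟩ := l4 hp v hv
        exact ⟨W, Finset.mem_union_right _ hW, hvW⟩

theorem isFilling_empty (part : Prop) (S : Set ℕ) :
    IsFilling part S (∅ : Finset (Fin n)) ∅ :=
  ⟨by simp, by simp, by simp, by simp⟩

-- Fillings of the different cells are independent: no hyperchord is allowed in two cells,
-- hyperchords of two cells never cross, and for partitions the cells have no common points.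
open Classical in
theorem sum_biUnion_eq_prod {ι : Type*} (part : Prop) (S : Set ℕ) (w : R) (T : Finset ι)
    (A : ι → Finset (Fin n))
    (hdis : ∀ i ∈ T, ∀ j ∈ T, i ≠ j → Disjoint (hyperSets S (A i)) (hyperSets S (A j)))
    (hcross : ∀ i ∈ T, ∀ j ∈ T, i ≠ j → ∀ W ⊆ A i, ∀ W' ⊆ A j, ¬ Cross W W')
    (hpart : part → ∀ i ∈ T, ∀ j ∈ T, i ≠ j → Disjoint (A i) (A j)) :
    ∑ D ∈ (T.biUnion fun i => hyperSets S (A i)).powerset with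
      NonCrossing D ∧ IsFilling part S (T.biUnion A) D, w ^ D.card =
    ∏ i ∈ T, ncSum part S w (A i).card := by
  induction T using Finset.induction_on with
  | empty =>
    have hA : (∅ : Finset ι).biUnion A = ∅ := Finset.biUnion_empty
    have hH : ((∅ : Finset ι).biUnion fun i => hyperSets S (A i)) = ∅ := Finset.biUnion_empty
    rw [hH, hA, Finset.sum_filter, Finset.powerset_empty, Finset.sum_singleton,
      if_pos ⟨by simp [NonCrossing], isFilling_empty _ _⟩]
    simp
  | insert i T hi ih =>
    have hne : ∀ j ∈ T, i ≠ j := fun j hj h => hi (h ▸ hj)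
    rw [Finset.prod_insert hi, ← ih
      (fun j hj k hk => hdis j (Finset.mem_insert_of_mem hj) k (Finset.mem_insert_of_mem hk))
      (fun j hj k hk => hcross j (Finset.mem_insert_of_mem hj) k (Finset.mem_insert_of_mem hk))
      (fun hp j hj k hk => hpart hp j (Finset.mem_insert_of_mem hj) k (Finset.mem_insert_of_mem hk)),
      ← ncSumOn_eq]
    have hA : (insert i T).biUnion A = A i ∪ T.biUnion A := Finset.biUnion_insert
    have hH : ((insert i T).biUnion fun i => hyperSets S (A i)) =
      hyperSets S (A i) ∪ T.biUnion fun i => hyperSets S (A i) := Finset.biUnion_insert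
    rw [hH, hA, ncSumOn]
    refine sum_powerset_union w ?_ ?_
    · rw [Finset.disjoint_biUnion_right]
      exact fun j hj => hdis i (Finset.mem_insert_self _ _) j (Finset.mem_insert_of_mem hj)
        (hne j hj)
    · intro D₁ hD₁ D₂ hD₂
      rw [nonCrossing_union (A := hyperSets S (A i))
        (B := T.biUnion fun i => hyperSets S (A i)) ?_ hD₁ hD₂, isFilling_union ?_ ?_ ?_]
      · tauto
      · intro hp
        rw [Finset.disjoint_biUnion_right]
        exact fun j hj => hpart hp i (Finset.mem_insert_self _ _) j (Finset.mem_insert_of_mem hj)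
          (hne j hj)
      · exact fun W hW => (mem_hyperSets.1 (hD₁ hW)).1
      · intro W hW
        obtain ⟨j, hj, hWj⟩ := Finset.mem_biUnion.1 (hD₂ hW)
        exact (mem_hyperSets.1 hWj).1.trans (Finset.subset_biUnion_of_mem A hj)
      · intro W hW W' hW'
        obtain ⟨j, hj, hWj⟩ := Finset.mem_biUnion.1 hW'
        exact hcross i (Finset.mem_insert_self _ _) j (Finset.mem_insert_of_mem hj) (hne j hj) W
          (mem_hyperSets.1 hW).1 W' (mem_hyperSets.1 hWj).1

/-- The completions of a set of blocks to a partition. -/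
theorem fillingSum_partition {S : Set ℕ} (hS : 0 ∉ S) (w : R) {K : Configuration c} (hc : 0 < c)
    {e : Fin c ↪o Fin n} (he : Rooted e) :
    fillingSum True S w K e = ∏ Q ∈ regions K, ncSum True S w (∑ a ∈ boundaryArcs Q, gap e a) := by
  classical
  have hcover : (regions K).biUnion (gapCell e) = (Finset.univ.map e.toEmbedding)ᶜ := by
    apply Finset.Subset.antisymm
    · rw [Finset.biUnion_subset]
      exact fun Q _ => gapCell_subset_compl he Q
    · intro p hp
      rw [Finset.mem_biUnion]
      exact exists_mem_gapCell hc he hp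
  -- The empty hyperchord would belong to every cell and destroy the independence.
  have hnonempty : ∀ W : Finset (Fin n), W.card ∈ S → W.Nonempty := by
    intro W hW
    rw [← Finset.card_pos]
    exact Nat.pos_of_ne_zero fun h => hS (h ▸ hW)
  simp only [← card_gapCell]
  rw [← sum_biUnion_eq_prod True S w (regions K) (gapCell e), hcover, fillingSum]
  · refine Finset.sum_congr ?_ fun _ _ => rfl
    ext D
    simp only [Finset.mem_filter, Finset.mem_univ, true_and, Finset.mem_powerset]
    constructor
    · rintro ⟨h1, h2⟩
      refine ⟨fun W hW => ?_, h1.nonCrossing, h2⟩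
      obtain ⟨Q, hQ, h⟩ := exists_subset_gapCell hc he (hnonempty W (h2.card_mem W hW))
        (h2.subset trivial W hW) (h1.not_cross W hW)
      exact Finset.mem_biUnion.2 ⟨Q, hQ, mem_hyperSets.2 ⟨h, h2.card_mem W hW⟩⟩
    · rintro ⟨h1, h2, h3⟩
      refine ⟨⟨h2, fun W hW U hU => ?_, fun W hW hmem => ?_⟩, h3⟩
      · obtain ⟨Q, hQ, h⟩ := Finset.mem_biUnion.1 (h1 hW)
        exact not_cross_of_subset_cell he (Finset.inl_mem_disjSum.2 hQ)
          ((mem_hyperSets.1 h).1.trans (gapCell_subset_cell e Q)) hU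
      · obtain ⟨U, hU, rfl⟩ := mem_mapConfig.1 hmem
        obtain ⟨v, hv⟩ := hnonempty _ (h3.card_mem _ hW)
        have := h3.subset trivial _ hW hv
        rw [Finset.mem_compl] at this
        exact this (Finset.map_subset_map.2 (Finset.subset_univ _) hv)
  · intro Q hQ Q' hQ' hne
    rw [Finset.disjoint_left]
    intro W hW hW'
    rw [mem_hyperSets] at hW hW'
    obtain ⟨v, hv⟩ := hnonempty W hW.2
    exact Finset.disjoint_left.1 (gapCell_disjoint e hQ hQ' hne) (hW.1 hv) (hW'.1 hv)
  · intro Q hQ Q' hQ' hne W hW W' hW'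
    exact not_cross_of_cells hc he (Finset.inl_mem_disjSum.2 hQ) (Finset.inl_mem_disjSum.2 hQ')
      (fun h => hne (Sum.inl_injective h)) (hW.trans (gapCell_subset_cell e Q))
      (hW'.trans (gapCell_subset_cell e Q'))
  · exact fun _ Q hQ Q' hQ' hne => gapCell_disjoint e hQ hQ' hne

/-! ### Diagrams -/

open Classical in
/-- `1 + w` if hyperchords of size `1` are allowed by `S`, and `1` otherwise. -/
noncomputable def pointFactor (S : Set ℕ) (w : R) : R := if 1 ∈ S then 1 + w else 1

/-- The sizes in `S` that are at least `2`. -/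
def bigSizes (S : Set ℕ) : Set ℕ := {s ∈ S | 2 ≤ s}

open Classical in
/-- The hyperchords with one vertex that are allowed by `S`. -/
noncomputable def singletonSets (S : Set ℕ) (n : ℕ) : Finset (Finset (Fin n)) :=
  if 1 ∈ S then Finset.univ.map ⟨fun v => {v}, Finset.singleton_injective⟩ else ∅

theorem mem_singletonSets {S : Set ℕ} {W : Finset (Fin n)} :
    W ∈ singletonSets S n ↔ 1 ∈ S ∧ W.card = 1 := by
  unfold singletonSets
  split_ifs with h
  · simp [h, Finset.card_eq_one, eq_comm]
  · simp [h]

theorem sum_singletonSets (S : Set ℕ) (w : R) (n : ℕ) :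
    ∑ D ∈ (singletonSets S n).powerset, w ^ D.card = pointFactor S w ^ n := by
  have := Finset.sum_pow_mul_eq_add_pow w 1 (singletonSets S n)
  simp only [one_pow, mul_one] at this
  rw [this]
  unfold singletonSets pointFactor
  split_ifs with h
  · simp [add_comm]
  · simp

theorem isFilling_false {S : Set ℕ} {A : Finset (Fin n)} {D : Configuration n} :
    IsFilling False S A D ↔ ∀ W ∈ D, W.card ∈ S :=
  ⟨fun h => h.card_mem, fun h => ⟨h, fun h => h.elim, fun h => h.elim, fun h => h.elim⟩⟩

-- A hyperchord with one vertex crosses nothing, so it can be added freely at each of the `n`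
-- points.
open Classical in
theorem sum_singletonSets_union (S : Set ℕ) (w : R) (B : Configuration n)
    (hB : ∀ W ∈ B, 2 ≤ W.card) :
    ∑ D ∈ (singletonSets S n ∪ B).powerset with NonCrossing D, w ^ D.card =
      pointFactor S w ^ n * ∑ D ∈ B.powerset with NonCrossing D, w ^ D.card := by
  have key := sum_powerset_union w (A := singletonSets S n) (B := B) (P := NonCrossing)
    (P₁ := fun _ => True) (P₂ := NonCrossing) ?_ ?_
  · rw [← sum_singletonSets]
    refine key.trans ?_
    simp
  · rw [Finset.disjoint_left]
    intro W hW hW'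
    have h1 := (mem_singletonSets.1 hW).2
    have h2 := hB W hW'
    omega
  · intro D₁ hD₁ D₂ hD₂
    rw [nonCrossing_union ?_ hD₁ hD₂, and_congr_left_iff]
    · refine fun _ => iff_true_intro fun U hU V hV hne hc => ?_
      have h1 := (mem_singletonSets.1 (hD₁ hU)).2
      have h2 := hc.two_le_card
      omega
    · intro W hW W' hW' hc
      have h1 := (mem_singletonSets.1 hW).2
      have h2 := hc.two_le_card
      omega

open Classical in
theorem ncSumOn_false_eq (S : Set ℕ) (w : R) (A : Finset (Fin n)) :
    ncSumOn False S w A = ∑ D ∈ (hyperSets S A).powerset with NonCrossing D, w ^ D.card := by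
  refine Finset.sum_congr (Finset.filter_congr fun D hD => ?_) fun _ _ => rfl
  rw [and_iff_left_iff_imp, isFilling_false]
  exact fun _ W hW => (mem_hyperSets.1 (Finset.mem_powerset.1 hD hW)).2

theorem mem_or_mem_bigSizes {S : Set ℕ} (hS : 0 ∉ S) {s : ℕ} :
    s ∈ S ↔ (1 ∈ S ∧ s = 1) ∨ s ∈ bigSizes S := by
  constructor
  · intro h
    have h0 : s ≠ 0 := fun h0 => hS (h0 ▸ h)
    rcases eq_or_ne s 1 with rfl | h1
    · exact Or.inl ⟨h, rfl⟩
    · exact Or.inr ⟨h, by omega⟩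
  · rintro (⟨h, rfl⟩ | h)
    exacts [h, h.1]

theorem ncSum_eq_pointFactor_mul {S : Set ℕ} (hS : 0 ∉ S) (w : R) (N : ℕ) :
    ncSum False S w N = pointFactor S w ^ N * ncSum False (bigSizes S) w N := by
  classical
  rw [ncSum, ncSum, ncSumOn_false_eq, ncSumOn_false_eq, ← sum_singletonSets_union]
  · refine Finset.sum_congr ?_ fun _ _ => rfl
    congr 2
    ext W
    rw [Finset.mem_union, mem_singletonSets, mem_hyperSets, mem_hyperSets,
      mem_or_mem_bigSizes hS]
    simp
  · exact fun W hW => (mem_hyperSets.1 hW).2.2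

/-- The completions of a set of hyperchords to a diagram. -/
theorem fillingSum_diagram {S : Set ℕ} (hS : 0 ∉ S) (w : R) {K : Configuration c} (hK : Spread K)
    (hc : 0 < c) {e : Fin c ↪o Fin n} (he : Rooted e) :
    fillingSum False S w K e = pointFactor S w ^ n *
      ∏ i ∈ allRegions K, ncSum False (bigSizes S) w (cell e i).card := by
  classical
  have h2 : ∀ W ∈ (allRegions K).biUnion fun i => hyperSets (bigSizes S) (cell e i),
      2 ≤ W.card := by
    intro W hW
    obtain ⟨i, hi, h⟩ := Finset.mem_biUnion.1 hW
    exact (mem_hyperSets.1 h).2.2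
  rw [← sum_biUnion_eq_prod False (bigSizes S) w (allRegions K) (cell e)]
  · have : ∀ D ∈ ((allRegions K).biUnion fun i => hyperSets (bigSizes S) (cell e i)).powerset,
        (NonCrossing D ∧ IsFilling False (bigSizes S) ((allRegions K).biUnion (cell e)) D ↔
          NonCrossing D) := by
      intro D hD
      rw [and_iff_left_iff_imp, isFilling_false]
      intro _ W hW
      obtain ⟨i, hi, h⟩ := Finset.mem_biUnion.1 (Finset.mem_powerset.1 hD hW)
      exact (mem_hyperSets.1 h).2
    rw [Finset.filter_congr this, ← sum_singletonSets_union S w _ h2, fillingSum]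
    refine Finset.sum_congr ?_ fun _ _ => rfl
    ext D
    simp only [Finset.mem_filter, Finset.mem_univ, true_and, Finset.mem_powerset, isFilling_false]
    constructor
    · rintro ⟨h1, h2⟩
      refine ⟨fun W hW => ?_, h1.nonCrossing⟩
      rw [Finset.mem_union, mem_singletonSets]
      refine ((mem_or_mem_bigSizes hS).1 (h2 W hW)).imp_right fun hb => ?_
      obtain ⟨i, hi, h⟩ := exists_subset_cell hc he hb.2 (h1.not_cross W hW) (h1.notMem W hW)
      exact Finset.mem_biUnion.2 ⟨i, hi, mem_hyperSets.2 ⟨h, hb⟩⟩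
    · rintro ⟨h1, h2⟩
      refine ⟨⟨h2, fun W hW U hU hcr => ?_, fun W hW hmem => ?_⟩, fun W hW => ?_⟩
      · rcases Finset.mem_union.1 (h1 hW) with h | h
        · have := (mem_singletonSets.1 h).2
          have := hcr.two_le_card
          omega
        · obtain ⟨i, hi, h⟩ := Finset.mem_biUnion.1 h
          exact not_cross_of_subset_cell he hi (mem_hyperSets.1 h).1 hU hcr
      · rcases Finset.mem_union.1 (h1 hW) with h | h
        · have h1 := (mem_singletonSets.1 h).2
          obtain ⟨U, hU, rfl⟩ := mem_mapConfig.1 hmem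
          rw [Finset.card_map] at h1
          rcases hK U hU with h3 | ⟨V, hV, hcr⟩
          · omega
          · have := hcr.two_le_card
            omega
        · obtain ⟨i, hi, h⟩ := Finset.mem_biUnion.1 h
          exact notMem_of_subset_cell hK he hi (mem_hyperSets.1 h).1 hmem
      · rcases Finset.mem_union.1 (h1 hW) with h | h
        · exact (mem_or_mem_bigSizes hS).2 (Or.inl (mem_singletonSets.1 h))
        · obtain ⟨i, hi, h⟩ := Finset.mem_biUnion.1 h
          exact (mem_hyperSets.1 h).2.1
  -- Size at least two is what makes the cell unique; a single core point may lie in several cells,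
  -- so singletons are counted globally by the power of `pointFactor`.
  · intro i hi j hj hij
    rw [Finset.disjoint_left]
    intro W hW hW'
    rw [mem_hyperSets] at hW hW'
    exact hij (cell_eq_of_subset hK hc he hi hj hW.2.2 hW.1 hW'.1)
  · exact fun i hi j hj hij W hW W' hW' => not_cross_of_cells hc he hi hj hij hW hW'
  · exact fun h => h.elim

end NoncrossingSums

end ChordConfig

namespace ChordConfig

/-! ### Summation over the rooted embeddings of a core -/

section Gaps

variable {n c : ℕ}

/-- The arc on which the point `p` lies, or that starts at `p`. -/
def arcOf {e : Fin c ↪o Fin n} (hc : 0 < c) (he : Rooted e) (p : Fin n) : Fin c :=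
  ⟨pos e p / 2, by have := pos_lt hc he p; omega⟩

theorem card_arcOf_eq {e : Fin c ↪o Fin n} (hc : 0 < c) (he : Rooted e) (b : Fin c) :
    (Finset.univ.filter fun p => arcOf hc he p = b).card = gap e b + 1 := by
  have : (Finset.univ.filter fun p => arcOf hc he p = b) =
      insert (e b) (Finset.univ.filter fun p => pos e p = 2 * (b : ℕ) + 1) := by
    ext p
    simp only [arcOf, Finset.mem_filter, Finset.mem_univ, true_and, Finset.mem_insert,
      Fin.ext_iff (b := b)]
    rw [← pos_eq_two_mul he]
    omega
  rw [this, Finset.card_insert_of_notMem]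
  · rfl
  · simp [pos_apply he]

/-- The points before `e a` are grouped by arcs, each arc being counted together with the core point
at which it starts. -/
theorem val_apply_eq_sum {e : Fin c ↪o Fin n} (hc : 0 < c) (he : Rooted e) (a : Fin c) :
    (e a : ℕ) = ∑ b ∈ Finset.Iio a, (gap e b + 1) := by
  rw [← Fin.card_Iio, Finset.card_eq_sum_card_fiberwise (f := arcOf hc he) (t := Finset.Iio a)]
  · refine Finset.sum_congr rfl fun b hb => ?_
    rw [← card_arcOf_eq hc he]
    congr 1
    ext p
    simp only [Finset.mem_filter, Finset.mem_Iio, Finset.mem_univ, true_and, and_iff_right_iff_imp]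
    rintro rfl
    rw [Finset.mem_Iio, Fin.lt_def] at hb
    rw [← pos_lt_two_mul he]
    simp only [arcOf] at hb
    omega
  · intro p hp
    simp only [Finset.coe_Iio, Set.mem_Iio] at hp ⊢
    rw [← pos_lt_two_mul he] at hp
    rw [Fin.lt_def]
    simp only [arcOf]
    omega

theorem sum_gap_add_one {e : Fin c ↪o Fin n} (hc : 0 < c) (he : Rooted e) :
    ∑ b, (gap e b + 1) = n := by
  have := Finset.card_eq_sum_card_fiberwise (f := arcOf hc he) (s := Finset.univ)
    (t := Finset.univ) (by simp)
  simp only [card_arcOf_eq, Finset.card_univ, Fintype.card_fin] at this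
  exact this.symm

theorem sum_gap {e : Fin c ↪o Fin n} (hc : 0 < c) (he : Rooted e) :
    ∑ b, gap e b = n - c := by
  have := sum_gap_add_one hc he
  rw [Finset.sum_add_distrib] at this
  simp at this
  omega

theorem eq_of_sum_Iio_eq {g h : Fin c → ℕ}
    (hlt : ∀ a, ∑ b ∈ Finset.Iio a, g b = ∑ b ∈ Finset.Iio a, h b) (hsum : ∑ b, g b = ∑ b, h b) :
    g = h := by
  funext a
  have key : ∑ b ∈ Finset.Iic a, g b = ∑ b ∈ Finset.Iic a, h b := by
    by_cases ha : (a : ℕ) + 1 < c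
    · have : Finset.Iic a = Finset.Iio (⟨a + 1, ha⟩ : Fin c) := by
        ext b
        simp only [Finset.mem_Iic, Finset.mem_Iio, Fin.le_def, Fin.lt_def]
        omega
      rw [this]
      exact hlt _
    · have : Finset.Iic a = Finset.univ := by
        ext b
        simp only [Finset.mem_Iic, Fin.le_def, Finset.mem_univ, iff_true]
        omega
      rw [this]
      exact hsum
  rw [← Finset.Iio_insert, Finset.sum_insert (by simp), Finset.sum_insert (by simp), hlt a] at key
  omega

-- A rooted embedding is determined by its gaps, and any gaps with sum `n - c` occur: the partial
-- sums of `g + 1` give the images.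
open Classical in
theorem sum_rooted_eq_sum_piAntidiag {R : Type*} [CommRing R] (hc : 0 < c) (hcn : c ≤ n)
    (F : (Fin c → ℕ) → R) :
    ∑ e : Fin c ↪o Fin n with Rooted e, F (gap e) =
      ∑ g ∈ Finset.piAntidiag (Finset.univ : Finset (Fin c)) (n - c), F g := by
  refine Finset.sum_bij (fun e _ => gap e) ?_ ?_ ?_ ?_
  · intro e he
    simp only [Finset.mem_filter, Finset.mem_univ, true_and] at he
    simp [sum_gap hc he]
  · intro e he e' he' h
    simp only [Finset.mem_filter, Finset.mem_univ, true_and] at he he'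
    ext a
    rw [val_apply_eq_sum hc he, val_apply_eq_sum hc he', h]
  · intro g hg
    simp only [Finset.mem_piAntidiag, Finset.mem_univ, implies_true, and_true] at hg
    have htot : ∑ b, (g b + 1) = n := by
      rw [Finset.sum_add_distrib, hg]
      simp
      omega
    have hlt : ∀ a, ∑ b ∈ Finset.Iio a, (g b + 1) < n := by
      intro a
      have : ∑ b ∈ Finset.Iic a, (g b + 1) ≤ ∑ b, (g b + 1) :=
        Finset.sum_le_sum_of_subset (Finset.subset_univ _)
      rw [← Finset.Iio_insert, Finset.sum_insert (by simp)] at this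
      omega
    have hmono : StrictMono fun a : Fin c => (⟨∑ b ∈ Finset.Iio a, (g b + 1), hlt a⟩ : Fin n) := by
      intro a b hab
      rw [Fin.lt_def]
      have : ∑ x ∈ Finset.Iic a, (g x + 1) ≤ ∑ x ∈ Finset.Iio b, (g x + 1) := by
        refine Finset.sum_le_sum_of_subset fun x hx => ?_
        rw [Finset.mem_Iic] at hx
        rw [Finset.mem_Iio]
        exact hx.trans_lt hab
      rw [← Finset.Iio_insert, Finset.sum_insert (by simp)] at this
      simp only
      omega
    have he : Rooted (OrderEmbedding.ofStrictMono _ hmono) := by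
      intro a ha
      have : Finset.Iio a = ∅ := by
        ext b
        simp only [Finset.mem_Iio, Fin.lt_def, Finset.notMem_empty, iff_false]
        omega
      simp [OrderEmbedding.ofStrictMono, this]
    refine ⟨_, Finset.mem_filter.2 ⟨Finset.mem_univ _, he⟩, ?_⟩
    have key : (fun b => gap (OrderEmbedding.ofStrictMono _ hmono) b + 1) = fun b => g b + 1 := by
      refine eq_of_sum_Iio_eq (fun a => ?_) ?_
      · rw [← val_apply_eq_sum hc he]
        rfl
      · rw [sum_gap_add_one hc he, htot]
    funext b
    exact Nat.succ_injective (congrFun key b)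
  · exact fun _ _ => rfl

/-- A vector supported on the union splits into its two restrictions. The first enters only through
its sum, so its possible values are merely counted. -/
theorem sum_piAntidiag_union {α R : Type*} [DecidableEq α] [CommRing R] {s t : Finset α}
    (hst : Disjoint s t) (N : ℕ) (f : ℕ → R) (φ : (α → ℕ) → R)
    (hφ : ∀ g h : α → ℕ, (∀ a ∈ t, g a = h a) → φ g = φ h) :
    ∑ g ∈ Finset.piAntidiag (s ∪ t) N, f (∑ a ∈ s, g a) * φ g =
      ∑ x ∈ Finset.HasAntidiagonal.antidiagonal N,
        ((Finset.piAntidiag s x.1).card * f x.1) *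
        ∑ h ∈ Finset.piAntidiag t x.2, φ h := by
  have : ∀ x ∈ Finset.HasAntidiagonal.antidiagonal N,
        ((Finset.piAntidiag s x.1).card * f x.1) *
        ∑ h ∈ Finset.piAntidiag t x.2, φ h =
      ∑ y ∈ Finset.piAntidiag s x.1 ×ˢ Finset.piAntidiag t x.2, f x.1 * φ y.2 := by
    intro x _
    rw [Finset.sum_product]
    simp only [Finset.sum_const, ← Finset.mul_sum, nsmul_eq_mul]
    ring
  rw [Finset.sum_congr rfl this, Finset.sum_sigma']
  have hs0 : ∀ {g : α → ℕ}, (∀ a, g a ≠ 0 → a ∈ s) → ∀ a ∈ t, g a = 0 := fun hg a ha => by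
    by_contra h
    exact Finset.disjoint_left.1 hst (hg a h) ha
  have ht0 : ∀ {g : α → ℕ}, (∀ a, g a ≠ 0 → a ∈ t) → ∀ a ∈ s, g a = 0 := fun hg a ha => by
    by_contra h
    exact Finset.disjoint_left.1 hst ha (hg a h)
  refine Finset.sum_bij' (fun g _ => ⟨(∑ a ∈ s, g a, ∑ a ∈ t, g a),
    (fun a => if a ∈ s then g a else 0, fun a => if a ∈ t then g a else 0)⟩)
    (fun y _ => y.2.1 + y.2.2) ?_ ?_ ?_ ?_ ?_
  · intro g hg
    rw [Finset.mem_piAntidiag, Finset.sum_union hst] at hg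
    simp only [Finset.mem_sigma, Finset.HasAntidiagonal.mem_antidiagonal, Finset.mem_product,
      Finset.mem_piAntidiag]
    refine ⟨hg.1, ⟨Finset.sum_congr rfl fun a ha => by simp [ha], fun a ha => ?_⟩,
      Finset.sum_congr rfl fun a ha => by simp [ha], fun a ha => ?_⟩ <;>
    · by_contra h
      simp [h] at ha
  · rintro ⟨⟨p, q⟩, g, h⟩ hy
    simp only [Finset.mem_sigma, Finset.HasAntidiagonal.mem_antidiagonal, Finset.mem_product,
      Finset.mem_piAntidiag] at hy
    obtain ⟨hpq, ⟨h1, h2⟩, h3, h4⟩ := hy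
    rw [Finset.mem_piAntidiag, Finset.sum_union hst]
    simp only [Pi.add_apply, Finset.sum_add_distrib]
    rw [Finset.sum_eq_zero (hs0 h2), Finset.sum_eq_zero (ht0 h4), h1, h3]
    refine ⟨by omega, fun a ha => ?_⟩
    rw [Finset.mem_union]
    by_cases hga : g a = 0
    · exact Or.inr (h4 a (by omega))
    · exact Or.inl (h2 a hga)
  · intro g hg
    rw [Finset.mem_piAntidiag] at hg
    funext a
    simp only [Pi.add_apply]
    have h1 := hg.2 a
    rw [Finset.mem_union] at h1
    by_cases hs : a ∈ s
    · simp [hs, Finset.disjoint_left.1 hst hs]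
    · by_cases ht : a ∈ t
      · simp [hs, ht]
      · simp only [hs, ht, if_false]
        by_contra h
        have := h1 (by omega)
        tauto
  · rintro ⟨⟨p, q⟩, g, h⟩ hy
    simp only [Finset.mem_sigma, Finset.HasAntidiagonal.mem_antidiagonal, Finset.mem_product,
      Finset.mem_piAntidiag] at hy
    obtain ⟨hpq, ⟨h1, h2⟩, h3, h4⟩ := hy
    have e1 : ∑ a ∈ s, (g + h) a = p := by
      simp only [Pi.add_apply, Finset.sum_add_distrib, Finset.sum_eq_zero (ht0 h4), h1, add_zero]
    have e2 : ∑ a ∈ t, (g + h) a = q := by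
      simp only [Pi.add_apply, Finset.sum_add_distrib, Finset.sum_eq_zero (hs0 h2), h3, zero_add]
    have e3 : (fun a => if a ∈ s then (g + h) a else 0) = g := by
      funext a
      by_cases ha : a ∈ s
      · simp [ha, ht0 h4 a ha]
      · simp only [ha, if_false]
        by_contra hcon
        exact ha (h2 a (Ne.symm hcon))
    have e4 : (fun a => if a ∈ t then (g + h) a else 0) = h := by
      funext a
      by_cases ha : a ∈ t
      · simp [ha, hs0 h2 a ha]
      · simp only [ha, if_false]
        by_contra hcon
        exact ha (h4 a (Ne.symm hcon))
    simp only [e1, e2, e3, e4]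
  · intro g hg
    simp only
    rw [hφ g (fun a => if a ∈ t then g a else 0) fun a ha => by simp [ha]]

/-- Splitting off one set of arcs at a time is a convolution, that is, a multiplication of power
series. -/
theorem sum_piAntidiag_biUnion {α ι R : Type*} [DecidableEq α] [DecidableEq ι] [CommRing R]
    (T : Finset ι) (A : ι → Finset α) (hA : ∀ i ∈ T, ∀ j ∈ T, i ≠ j → Disjoint (A i) (A j)) (N : ℕ)
    (f : ι → ℕ → R) :
    ∑ g ∈ Finset.piAntidiag (T.biUnion A) N, ∏ i ∈ T, f i (∑ a ∈ A i, g a) =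
      coeff N (∏ i ∈ T, PowerSeries.mk fun m => ((Finset.piAntidiag (A i) m).card : R) * f i m) := by
  induction T using Finset.induction_on generalizing N with
  | empty =>
    rw [Finset.biUnion_empty, Finset.piAntidiag_empty, Finset.prod_empty, coeff_one]
    split_ifs <;> simp
  | insert i T hi ih =>
    have hne : ∀ j ∈ T, i ≠ j := fun j hj h => hi (h ▸ hj)
    rw [Finset.biUnion_insert, Finset.prod_insert hi, coeff_mul]
    simp only [Finset.prod_insert hi, coeff_mk]
    rw [sum_piAntidiag_union]
    · refine Finset.sum_congr rfl fun x _ => ?_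
      rw [ih fun j hj k hk => hA j (Finset.mem_insert_of_mem hj) k (Finset.mem_insert_of_mem hk)]
    · rw [Finset.disjoint_biUnion_right]
      exact fun j hj => hA i (Finset.mem_insert_self _ _) j (Finset.mem_insert_of_mem hj) (hne j hj)
    · intro g h hgh
      refine Finset.prod_congr rfl fun j hj => ?_
      congr 1
      exact Finset.sum_congr rfl fun a ha => hgh a (Finset.mem_biUnion.2 ⟨j, hj, ha⟩)

/-- Apply the convolution formula to the decomposition into singletons, each of which contributes
the geometric series. -/
theorem card_piAntidiag_eq {α R : Type*} [DecidableEq α] [CommRing R] (s : Finset α) (m : ℕ) :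
    ((Finset.piAntidiag s m).card : R) = coeff m ((PowerSeries.mk 1 : R⟦X⟧) ^ s.card) := by
  have := sum_piAntidiag_biUnion (R := R) s (fun a => {a})
    (fun a _ b _ hab => by simpa using hab) m (fun _ _ => 1)
  rw [Finset.biUnion_singleton_eq_self] at this
  simp only [Finset.prod_const_one, Finset.sum_const, nsmul_eq_mul, mul_one] at this
  rw [this, ← Finset.prod_const]
  congr 1
  refine Finset.prod_congr rfl fun a _ => ?_
  ext k
  rw [coeff_mk, coeff_mk]
  have : Finset.piAntidiag {a} k = {Function.update (0 : α → ℕ) a k} := by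
    ext g
    rw [Finset.mem_piAntidiag, Finset.sum_singleton, Finset.mem_singleton]
    constructor
    · rintro ⟨h1, h2⟩
      funext b
      by_cases hb : b = a
      · subst hb; simpa using h1
      · rw [Function.update_of_ne hb]
        by_contra h
        exact hb (Finset.mem_singleton.1 (h2 b h))
    · rintro rfl
      refine ⟨by simp, fun b hb => ?_⟩
      by_contra h
      rw [Finset.mem_singleton] at h
      simp [Function.update_of_ne h] at hb
  simp [this]

/-- The series attached to a region with boundary arcs `A`. -/
noncomputable def gapSeries {α R : Type*} [DecidableEq α] [CommRing R] (A : Finset α)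
    (f : ℕ → R) : R⟦X⟧ :=
  X ^ A.card * PowerSeries.mk fun m => ((Finset.piAntidiag A m).card : R) * f m

-- The factor `X ^ A.card` in `gapSeries` counts the core points at which the arcs of `A` start.
-- Since the sets of arcs partition all `c` arcs, together these account for the whole core and
-- leave `n - c` points to distribute.
open Classical in
theorem sum_rooted_prod_eq {ι R : Type*} [CommRing R] (hc : 0 < c) (n : ℕ)
    (T : Finset ι) (A : ι → Finset (Fin c))
    (hA : ∀ i ∈ T, ∀ j ∈ T, i ≠ j → Disjoint (A i) (A j)) (hcov : T.biUnion A = Finset.univ)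
    (f : ι → ℕ → R) :
    ∑ e : Fin c ↪o Fin n with Rooted e, ∏ i ∈ T, f i (∑ a ∈ A i, gap e a) =
      coeff n (∏ i ∈ T, gapSeries (A i) (f i)) := by
  have hcard : ∑ i ∈ T, (A i).card = c := by
    rw [← Finset.card_biUnion fun i hi j hj hij => hA i hi j hj hij, hcov, Finset.card_fin]
  simp only [gapSeries]
  rw [Finset.prod_mul_distrib, Finset.prod_pow_eq_pow_sum, hcard, coeff_X_pow_mul']
  split_ifs with hcn
  · rw [← sum_piAntidiag_biUnion T A hA, hcov, ← sum_rooted_eq_sum_piAntidiag hc hcn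
      (F := fun g => ∏ i ∈ T, f i (∑ a ∈ A i, g a))]
  · refine Finset.sum_eq_zero fun e _ => absurd ?_ hcn
    simpa using Fintype.card_le_of_embedding e.toEmbedding

end Gaps

end ChordConfig

namespace ChordConfig

/-! ### Bounding the size of a core by its number of crossings -/

section Finiteness

variable {n : ℕ}

/-- The four ends of a crossing. -/
def crossingEnds (t : (Fin n × Fin n) × (Fin n × Fin n)) : Finset (Fin n) :=
  {t.1.1, t.1.2, t.2.1, t.2.2}

theorem card_crossingEnds_le (t : (Fin n × Fin n) × (Fin n × Fin n)) :
    (crossingEnds t).card ≤ 4 := Finset.card_le_four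

theorem mem_orientedCrossings {U V : Finset (Fin n)} {a b p q : Fin n} :
    ((a, b), (p, q)) ∈ orientedCrossings U V ↔
      ((a ∈ U ∧ b ∈ U) ∧ p ∈ V ∧ q ∈ V) ∧ a < p ∧ p < b ∧ b < q := by
  simp [orientedCrossings]

theorem mem_crossingEnds_of_lt {U V : Finset (Fin n)} {u u' p q : Fin n} (hu : u ∈ U)
    (hu' : u' ∈ U) (hp : p ∈ V) (hq : q ∈ V) (h₁ : p < u) (h₂ : u < q) (h₃ : u' < p ∨ q < u') :
    u ∈ (orientedCrossings U V ∪ orientedCrossings V U).biUnion crossingEnds ∧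
      u' ∈ (orientedCrossings U V ∪ orientedCrossings V U).biUnion crossingEnds := by
  simp only [Finset.mem_biUnion, Finset.mem_union]
  rcases h₃ with h₃ | h₃
  · have := mem_orientedCrossings.2 ⟨⟨⟨hu', hu⟩, hp, hq⟩, h₃, h₁, h₂⟩
    exact ⟨⟨_, Or.inl this, by simp [crossingEnds]⟩, ⟨_, Or.inl this, by simp [crossingEnds]⟩⟩
  · have := mem_orientedCrossings.2 ⟨⟨⟨hp, hq⟩, hu, hu'⟩, h₁, h₂, h₃⟩
    exact ⟨⟨_, Or.inr this, by simp [crossingEnds]⟩, ⟨_, Or.inr this, by simp [crossingEnds]⟩⟩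

/-- A crossing chord `pq` of `V` has vertices of `U` on both sides. Every vertex of `U` other than
`p` and `q` forms with one of them a chord crossing `pq`, and a crossing has only four ends. -/
theorem card_le_of_cross {U V : Finset (Fin n)} (h : Cross U V) :
    U.card ≤ 2 + 4 * ((orientedCrossings U V).card + (orientedCrossings V U).card) := by
  obtain ⟨p, hp, q, hq, a, ha, b, hb, ⟨h1, h2⟩, h3⟩ := cross_iff.1 (cross_comm.1 h)
  have hsub : U ⊆ {p, q} ∪
      (orientedCrossings U V ∪ orientedCrossings V U).biUnion crossingEnds := by
    intro u hu
    rw [Finset.mem_union, Finset.mem_insert, Finset.mem_singleton]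
    by_cases hup : u = p
    · exact Or.inl (Or.inl hup)
    by_cases huq : u = q
    · exact Or.inl (Or.inr huq)
    right
    rcases lt_or_gt_of_ne hup with h4 | h4
    · exact (mem_crossingEnds_of_lt ha hu hp hq h1 h2 (Or.inl h4)).2
    · rcases lt_or_gt_of_ne huq with h5 | h5
      · exact (mem_crossingEnds_of_lt hu hb hp hq h4 h5 h3).1
      · exact (mem_crossingEnds_of_lt ha hu hp hq h1 h2 (Or.inr h5)).2
  calc U.card ≤ _ := Finset.card_le_card hsub
    _ ≤ ({p, q} : Finset (Fin n)).card +
        ((orientedCrossings U V ∪ orientedCrossings V U).biUnion crossingEnds).card :=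
      Finset.card_union_le _ _
    _ ≤ 2 + (orientedCrossings U V ∪ orientedCrossings V U).card * 4 := by
      gcongr
      · exact Finset.card_le_two
      · exact Finset.card_biUnion_le_card_mul _ _ _ fun t _ => card_crossingEnds_le t
    _ ≤ 2 + 4 * ((orientedCrossings U V).card + (orientedCrossings V U).card) := by
      have := Finset.card_union_le (orientedCrossings U V) (orientedCrossings V U)
      omega

/-- With k crossings there are at most 2k hyperchords, since each is crossed and each crossing
involves two. Their sizes sum to at most 2 · 2k + 4 · 2k, and they cover all points. -/
theorem IsCore.points_le {K : Configuration n} (hK : IsCore K) : n ≤ 12 * crossingNumber K := by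
  have hpair : ∀ U ∈ K, 1 ≤ (∑ V ∈ K.erase U,
      ((orientedCrossings U V).card + (orientedCrossings V U).card)) ∧
      U.card ≤ 2 + 4 * ∑ V ∈ K.erase U,
        ((orientedCrossings U V).card + (orientedCrossings V U).card) := by
    intro U hU
    obtain ⟨V, hV, hne, hc⟩ := hK.1 U hU
    have hle := Finset.single_le_sum (f := fun V => (orientedCrossings U V).card +
      (orientedCrossings V U).card) (fun _ _ => Nat.zero_le _) (Finset.mem_erase.2 ⟨hne, hV⟩)
    have h1 := card_le_of_cross hc
    have h2 : 1 ≤ (orientedCrossings U V).card + (orientedCrossings V U).card := by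
      simp only [Cross, ← Finset.card_pos] at hc
      omega
    omega
  have htot := two_mul_crossingNumber K
  have hn : n ≤ ∑ U ∈ K, U.card := by
    have := Finset.card_biUnion_le (s := K) (t := id)
    have h2 := support_eq_univ hK
    rw [support] at h2
    rw [h2, Finset.card_fin] at this
    exact this
  have hK1 : K.card ≤ 2 * crossingNumber K := by
    rw [htot, Finset.card_eq_sum_ones]
    exact Finset.sum_le_sum fun U hU => (hpair U hU).1
  have h2 : ∑ U ∈ K, U.card ≤ 2 * K.card + 4 * (2 * crossingNumber K) := by
    rw [htot, Finset.card_eq_sum_ones, Finset.mul_sum, Finset.mul_sum, ← Finset.sum_add_distrib]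
    exact Finset.sum_le_sum fun U hU => by simpa using (hpair U hU).2
  omega

theorem pos_of_crossingNumber {K : Configuration n} (h : 1 ≤ crossingNumber K) : 0 < n := by
  rcases Nat.eq_zero_or_pos n with rfl | hn
  · exfalso
    have : crossingNumber K = 0 := crossingNumber_eq_zero_iff.2 fun U _ V _ _ hc => by
      obtain ⟨a, -⟩ := cross_iff.1 hc
      exact a.elim0
    omega
  · exact hn

end Finiteness

/-! ### From rooted cores to generating functions -/

section Formula

variable {R : Type*} [CommRing R]

open Classical in
/-- The generating function of the fillings with `k` crossings; a hyperchord has weight `w`. -/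
noncomputable def genSeries (part : Prop) (S : Set ℕ) (w : R) (k : ℕ) : R⟦X⟧ :=
  PowerSeries.mk fun n => ∑ C : Configuration n with
    IsFilling part S Finset.univ C ∧ crossingNumber C = k, w ^ C.card

/-- The cores with `k` crossings. -/
def coreSet (part : Prop) (S : Set ℕ) (k : ℕ) : Set (Σ n : ℕ, Configuration n) :=
  {K | IsFilling part S Finset.univ K.2 ∧ IsCore K.2 ∧ crossingNumber K.2 = k}

open Classical in
theorem coreSet_eq_sigma (part : Prop) (S : Set ℕ) (k M : ℕ) (hM : 12 * k < M) :
    coreSet part S k = ((Finset.range M).sigma fun c => Finset.univ.filter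
      fun K : Configuration c => IsFilling part S Finset.univ K ∧ IsCore K ∧
        crossingNumber K = k : Finset (Σ n : ℕ, Configuration n)) := by
  ext ⟨c, K⟩
  simp only [coreSet, Set.mem_ofPred_eq, Finset.coe_sigma, Finset.coe_range, Set.mem_sigma_iff,
    Set.mem_Iio, Finset.coe_filter, Finset.mem_univ, true_and]
  constructor
  · rintro ⟨h1, h2, h3⟩
    refine ⟨?_, h1, h2, h3⟩
    have := h2.points_le
    omega
  · exact fun h => h.2

theorem coreSet_finite (part : Prop) (S : Set ℕ) (k : ℕ) : (coreSet part S k).Finite := by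
  rw [coreSet_eq_sigma part S k (12 * k + 1) (by omega)]
  exact Finset.finite_toSet _

theorem coeff_zero_genSeries_zero (part : Prop) (S : Set ℕ) (w : R) (N : ℕ) :
    coeff N (genSeries part S w 0) = ncSum part S w N := by
  classical
  rw [genSeries, coeff_mk, ncSum, ncSumOn]
  refine Finset.sum_congr ?_ fun _ _ => rfl
  ext D
  simp only [Finset.mem_filter, Finset.mem_univ, true_and, Finset.mem_powerset,
    crossingNumber_eq_zero_iff]
  constructor
  · exact fun h => ⟨fun W hW => mem_hyperSets.2 ⟨Finset.subset_univ _, h.1.card_mem W hW⟩,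
      h.2, h.1⟩
  · exact fun h => ⟨h.2.2, h.2.1⟩

theorem coeff_xDiff (f : R⟦X⟧) (n : ℕ) : coeff n (xDiff f) = n * coeff n f := by
  cases n with
  | zero => simp [xDiff]
  | succ n =>
    rw [xDiff, coeff_succ_X_mul, coeff_derivative]
    push_cast
    ring

-- Compare coefficients and group configurations by the number c of core points: double counting
-- gives n/c times the rooted count, where n comes from `xDiff` and 1/c is the weight of the core.
open Classical in
theorem genSeries_eq [Algebra ℚ R] (part : Prop) (S : Set ℕ) (w : R) {k : ℕ} (hk : 1 ≤ k)
    (B : (Σ n : ℕ, Configuration n) → R⟦X⟧)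
    (hB : ∀ K ∈ coreSet part S k, ∀ n, ∑ e : Fin K.1 ↪o Fin n with Rooted e,
      fillingSum part S w K.2 e = coeff n (B K)) :
    genSeries part S w k = xDiff (∑ K ∈ (coreSet_finite part S k).toFinset,
      algebraMap ℚ R⟦X⟧ (K.1 : ℚ)⁻¹ * PowerSeries.C w ^ K.2.card * B K) := by
  ext n
  -- One bound serves both sides: a core has at most 12k points, and the core of a configuration on
  -- `n` points has at most `n`.
  set M := 12 * k + n + 1 with hM
  have hset : (coreSet_finite part S k).toFinset = (Finset.range M).sigma fun c =>
      Finset.univ.filter fun K : Configuration c => IsFilling part S Finset.univ K ∧ IsCore K ∧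
        crossingNumber K = k := by
    apply Finset.coe_injective
    rw [Set.Finite.coe_toFinset, coreSet_eq_sigma part S k M (by omega)]
  rw [coeff_xDiff, hset, Finset.sum_sigma, map_sum, Finset.mul_sum, genSeries, coeff_mk,
    ← Finset.sum_fiberwise_of_maps_to (t := Finset.range M)
      (g := fun C : Configuration n => (support (coreOf C)).card)]
  · refine Finset.sum_congr rfl fun c hc => ?_
    simp only [Finset.filter_filter]
    -- Without core points there are no crossings, so both sums are empty because `1 ≤ k`.
    rcases Nat.eq_zero_or_pos c with rfl | hcpos
    · rw [Finset.sum_eq_zero, Finset.sum_eq_zero, map_zero, mul_zero]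
      · intro K hK
        simp only [Finset.mem_filter, Finset.mem_univ, true_and] at hK
        exact absurd (pos_of_crossingNumber (hK.2.2 ▸ hk)) (lt_irrefl _)
      · intro C hC
        simp only [Finset.mem_filter, Finset.mem_univ, true_and] at hC
        exfalso
        have h0 := Finset.card_eq_zero.1 hC.2
        have : crossingNumber C = 0 := crossingNumber_eq_zero_iff.2 fun U hU V hV hne hcr => by
          obtain ⟨v, hv⟩ := Finset.card_pos.1 (by have := hcr.two_le_card; omega : 0 < U.card)
          have := mem_support.2 ⟨U, (mem_coreOf_of_cross hU hV hne hcr).1, hv⟩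
          rw [h0] at this
          simp at this
        omega
    · obtain ⟨c, rfl⟩ : ∃ c', c = c' + 1 := ⟨c - 1, by omega⟩
      have h1 := card_mul_sum_eq part S w k n (c + 1)
      rw [sum_rooted_eq] at h1
      have hinv : algebraMap ℚ R ((c + 1 : ℕ) : ℚ)⁻¹ * ((c + 1 : ℕ) : R) = 1 := by
        rw [← map_natCast (algebraMap ℚ R), ← map_mul, inv_mul_cancel₀, map_one]
        exact_mod_cast Nat.succ_ne_zero c
      have h2 := congrArg (fun z => algebraMap ℚ R ((c + 1 : ℕ) : ℚ)⁻¹ * z) h1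
      simp only [← mul_assoc] at h2
      rw [hinv, one_mul] at h2
      rw [h2, map_sum, mul_comm (algebraMap ℚ R _) (n : R), mul_assoc, Finset.mul_sum]
      congr 1
      refine Finset.sum_congr rfl fun K hK => ?_
      simp only [Finset.mem_filter, Finset.mem_univ, true_and] at hK
      rw [hB ⟨c + 1, K⟩ hK n, PowerSeries.algebraMap_apply, ← map_pow, mul_assoc, coeff_C_mul,
        coeff_C_mul]
  · intro C _
    rw [Finset.mem_range]
    have : (support (coreOf C)).card ≤ n := (Finset.card_le_univ _).trans (by simp)
    omega

/-! ### The series of the regions -/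

theorem inv_factorial_smul_iterate_derivative [Algebra ℚ R] (d : ℕ) (f : R⟦X⟧) :
    ((d.factorial : ℚ)⁻¹) • (derivative R)^[d] f =
      PowerSeries.mk fun m => ((d + m).choose d : R) * coeff (m + d) f := by
  ext m
  rw [coeff_mk, map_rat_smul (coeff m : R⟦X⟧ →ₗ[R] R), coeff_iterate_derivative,
    Nat.ascFactorial_eq_factorial_mul_choose, Nat.add_comm d m]
  push_cast
  rw [mul_assoc, ← smul_mul_assoc]
  have : ((d.factorial : ℚ)⁻¹) • (d.factorial : R) = 1 := by
    rw [Algebra.smul_def, ← map_natCast (algebraMap ℚ R), ← map_mul, inv_mul_cancel₀, map_one]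
    exact_mod_cast Nat.factorial_ne_zero d
  rw [this, one_mul]

theorem gapSeries_of_card {α : Type*} [DecidableEq α] {A : Finset α} {d : ℕ} (hA : A.card = d + 1)
    (f : ℕ → R) : gapSeries A f =
      X ^ (d + 1) * PowerSeries.mk fun m => ((d + m).choose d : R) * f m := by
  rw [gapSeries, hA]
  congr 1
  ext m
  rw [coeff_mk, coeff_mk, card_piAntidiag_eq, hA, mk_one_pow_eq_mk_choose_add, coeff_mk]

theorem gapSeries_empty {α : Type*} [DecidableEq α] (f : ℕ → R) :
    gapSeries (∅ : Finset α) f = PowerSeries.C (f 0) := by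
  ext m
  rw [gapSeries, Finset.card_empty, pow_zero, one_mul, coeff_mk, Finset.piAntidiag_empty, coeff_C]
  split_ifs with h
  · simp [h]
  · simp

/-- Distributing m points over i arcs can be done in as many ways as the binomial coefficient
produced by i - 1 derivatives. The inner factor `X ^ (i - 1)` compensates the shift of the
coefficients. -/
theorem regionSeries_eq [Algebra ℚ R] {α : Type*} [DecidableEq α] {A : Finset α}
    (hA : 1 ≤ A.card) (f : R⟦X⟧) :
    regionSeries f A.card = gapSeries A fun m => coeff m f := by
  obtain ⟨d, hd⟩ : ∃ d, A.card = d + 1 := ⟨A.card - 1, by omega⟩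
  rw [gapSeries_of_card hd, regionSeries, hd, Nat.add_sub_cancel, ← mul_smul_comm,
    inv_factorial_smul_iterate_derivative]
  simp only [coeff_X_pow_mul]

/-- With i arcs, the tail quotient shifts coefficients by i + j + 1 and the derivatives by i - 1,
which makes up the 2i + j core points that the region touches. -/
theorem regionSeriesPeaks_eq [Algebra ℚ R] {α : Type*} [DecidableEq α] (A : Finset α) (j : ℕ)
    (f : R⟦X⟧) :
    regionSeriesPeaks f A.card j = gapSeries A fun m => coeff (2 * A.card + j + m) f := by
  rcases Nat.eq_zero_or_pos A.card with h | h
  · rw [Finset.card_eq_zero] at h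
    subst h
    rw [gapSeries_empty]
    simp [regionSeriesPeaks]
  · obtain ⟨d, hd⟩ : ∃ d, A.card = d + 1 := ⟨A.card - 1, by omega⟩
    rw [gapSeries_of_card hd, regionSeriesPeaks, if_neg (by omega), hd, Nat.add_sub_cancel,
      ← mul_smul_comm, inv_factorial_smul_iterate_derivative]
    congr 1
    ext m
    simp only [coeff_mk, tailQuotient]
    congr 3
    ring

theorem C_mul_gapSeries {α : Type*} [DecidableEq α] (A : Finset α) (r : R) (f : ℕ → R) :
    PowerSeries.C r * gapSeries A f = gapSeries A fun m => r * f m := by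
  rw [gapSeries, gapSeries, mul_left_comm]
  congr 1
  ext m
  rw [coeff_C_mul, coeff_mk, coeff_mk]
  ring

end Formula

end ChordConfig

namespace ChordConfig

/-! ### The composition formulas for partitions and for diagrams -/

section FamilyFormula

variable {R : Type*} [CommRing R] {c : ℕ}

theorem boundaryArcs_disjoint {K : Configuration c} {Q Q' : Finset (Fin c × Fin c)}
    (hQ : Q ∈ regions K) (hQ' : Q' ∈ regions K) (hne : Q ≠ Q') :
    Disjoint (boundaryArcs Q) (boundaryArcs Q') := by
  rw [Finset.disjoint_left]
  intro a ha ha'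
  exact hne (region_eq_of_inCell_odd hQ hQ' (inCell_odd.2 (mem_boundaryArcs.1 ha))
    (inCell_odd.2 (mem_boundaryArcs.1 ha')))

theorem biUnion_boundaryArcs (K : Configuration c) :
    (regions K).biUnion boundaryArcs = Finset.univ := by
  ext a
  simp only [Finset.mem_biUnion, Finset.mem_univ, iff_true]
  exact ⟨regionOf K (a, a), mem_regions.2 ⟨_, isFree_self K a, rfl⟩,
    mem_boundaryArcs.2 (mem_regionOf_self (isFree_self K a))⟩

theorem ncSum_partition_zero {S : Set ℕ} (hS : 0 ∉ S) (w : R) : ncSum True S w 0 = 1 := by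
  classical
  have : hyperSets S (Finset.univ : Finset (Fin 0)) = ∅ := by
    ext W
    rw [mem_hyperSets]
    simp [Finset.eq_empty_of_isEmpty W, hS]
  rw [ncSum, ncSumOn, this, Finset.sum_filter, Finset.powerset_empty, Finset.sum_singleton,
    if_pos]
  · simp
  · exact ⟨by simp [NonCrossing], isFilling_empty _ _⟩

open Classical in
theorem sum_fillingSum_partition {S : Set ℕ} (hS : 0 ∉ S) (w : R) (hc : 0 < c)
    (K : Configuration c) (n : ℕ) :
    ∑ e : Fin c ↪o Fin n with Rooted e, fillingSum True S w K e =
      coeff n (∏ Q ∈ regions K, gapSeries (boundaryArcs Q) (ncSum True S w)) := by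
  rw [← sum_rooted_prod_eq hc n (regions K) boundaryArcs
    (fun Q hQ Q' hQ' hne => boundaryArcs_disjoint hQ hQ' hne) (biUnion_boundaryArcs K)]
  refine Finset.sum_congr rfl fun e he => ?_
  simp only [Finset.mem_filter, Finset.mem_univ, true_and] at he
  exact fillingSum_partition hS w hc he

theorem prod_regions_partition [Algebra ℚ R] {S : Set ℕ} (hS : 0 ∉ S) (w : R)
    (K : Configuration c) :
    ∏ Q ∈ regions K, gapSeries (boundaryArcs Q) (ncSum True S w) =
      ∏ i ∈ Finset.Icc 1 c, regionSeries (genSeries True S w 0) i ^ numRegions K i := by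
  have hmaps : ∀ Q ∈ (regions K).filter (fun Q => 1 ≤ (boundaryArcs Q).card),
      (boundaryArcs Q).card ∈ Finset.Icc 1 c := by
    intro Q hQ
    rw [Finset.mem_Icc]
    exact ⟨(Finset.mem_filter.1 hQ).2, (Finset.card_le_univ _).trans (by simp)⟩
  rw [← Finset.prod_filter_of_ne (p := fun Q => 1 ≤ (boundaryArcs Q).card),
    ← Finset.prod_fiberwise_of_maps_to hmaps]
  · refine Finset.prod_congr rfl fun i hi => ?_
    rw [Finset.mem_Icc] at hi
    rw [numRegions, ← Finset.prod_const]
    refine Finset.prod_congr ?_ fun Q hQ => ?_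
    · ext Q
      simp only [Finset.mem_filter]
      constructor
      · exact fun h => ⟨h.1.1, h.2⟩
      · exact fun h => ⟨⟨h.1, by omega⟩, h.2⟩
    · obtain ⟨h1, rfl⟩ := Finset.mem_filter.1 hQ
      rw [regionSeries_eq hi.1]
      simp only [coeff_zero_genSeries_zero]
  -- Regions without boundary arcs contain no available points and contribute the factor 1, which is
  -- why they carry no variable.
  · intro Q hQ h
    by_contra h0
    apply h
    have : boundaryArcs Q = ∅ := Finset.card_eq_zero.1 (by omega)
    rw [this, gapSeries_empty, ncSum_partition_zero hS, map_one]

theorem IsCore.spread {K : Configuration c} (hK : IsCore K) : Spread K := fun U hU => by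
  obtain ⟨V, hV, -, hc⟩ := hK.1 U hU
  exact Or.inr ⟨V, hV, hc⟩

theorem IsCore.full {K : Configuration c} (hK : IsCore K) : Full K := fun v => by
  obtain ⟨U, hU, hv⟩ := hK.2 v
  obtain ⟨V, hV, -, hc⟩ := hK.1 U hU
  exact ⟨U, hU, hv, hc.two_le_card⟩

/-- The boundary arcs of a region or of a flat region. -/
def arcsOf : Finset (Fin c × Fin c) ⊕ Fin c × Fin c → Finset (Fin c)
  | Sum.inl Q => boundaryArcs Q
  | Sum.inr _ => ∅

/-- The number of peaks of a region or of a flat region. -/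
def peakCount : Finset (Fin c × Fin c) ⊕ Fin c × Fin c → ℕ
  | Sum.inl Q => (peaks Q).card
  | Sum.inr _ => 2

theorem card_cell {K : Configuration c} (hK : Full K) (hc : 0 < c) {n : ℕ} {e : Fin c ↪o Fin n}
    (he : Rooted e) {i : Finset (Fin c × Fin c) ⊕ Fin c × Fin c} (hi : i ∈ allRegions K) :
    (cell e i).card = 2 * (arcsOf i).card + peakCount i + ∑ a ∈ arcsOf i, gap e a := by
  cases i with
  | inl Q => exact card_cell_inl hK hc he (Finset.inl_mem_disjSum.1 hi)
  | inr f => simpa [arcsOf, peakCount] using card_cell_inr e (Finset.inr_mem_disjSum.1 hi)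

theorem arcsOf_disjoint {K : Configuration c} {i j : Finset (Fin c × Fin c) ⊕ Fin c × Fin c}
    (hi : i ∈ allRegions K) (hj : j ∈ allRegions K) (hij : i ≠ j) :
    Disjoint (arcsOf i) (arcsOf j) := by
  cases i with
  | inr f => simp [arcsOf]
  | inl Q =>
    cases j with
    | inr f => simp [arcsOf]
    | inl Q' =>
      exact boundaryArcs_disjoint (Finset.inl_mem_disjSum.1 hi) (Finset.inl_mem_disjSum.1 hj)
        (fun h => hij (h ▸ rfl))

theorem biUnion_arcsOf (K : Configuration c) :
    (allRegions K).biUnion arcsOf = Finset.univ := by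
  ext a
  simp only [Finset.mem_biUnion, Finset.mem_univ, iff_true]
  have ha : a ∈ (regions K).biUnion boundaryArcs := biUnion_boundaryArcs K ▸ Finset.mem_univ a
  obtain ⟨Q, hQ, haQ⟩ := Finset.mem_biUnion.1 ha
  exact ⟨Sum.inl Q, Finset.inl_mem_disjSum.2 hQ, haQ⟩

-- Each point belongs to exactly one arc closed at its start, so the exponent `n` of `pointFactor`
-- splits over the regions into number of arcs plus number of inserted points. Flat regions receive
-- none.
open Classical in
theorem sum_fillingSum_diagram {S : Set ℕ} (hS : 0 ∉ S) (w : R) (hc : 0 < c)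
    {K : Configuration c} (hK : Spread K) (hK' : Full K) (n : ℕ) :
    ∑ e : Fin c ↪o Fin n with Rooted e, fillingSum False S w K e =
      coeff n (∏ i ∈ allRegions K, gapSeries (arcsOf i) fun m =>
        pointFactor S w ^ ((arcsOf i).card + m) *
          ncSum False (bigSizes S) w (2 * (arcsOf i).card + peakCount i + m)) := by
  rw [← sum_rooted_prod_eq hc n (allRegions K) arcsOf
    (fun i hi j hj hne => arcsOf_disjoint hi hj hne) (biUnion_arcsOf K)]
  refine Finset.sum_congr rfl fun e he => ?_
  simp only [Finset.mem_filter, Finset.mem_univ, true_and] at he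
  rw [fillingSum_diagram hS w hK hc he, Finset.prod_mul_distrib, Finset.prod_pow_eq_pow_sum]
  congr 1
  · congr 1
    have : ∀ i, (arcsOf i).card + ∑ a ∈ arcsOf i, gap e a =
        ∑ a ∈ arcsOf i, (gap e a + 1) := fun i => by
      rw [Finset.sum_add_distrib, Finset.sum_const, smul_eq_mul, mul_one, add_comm]
    simp only [this]
    rw [← Finset.sum_biUnion fun i hi j hj hne => arcsOf_disjoint hi hj hne, biUnion_arcsOf,
      sum_gap_add_one hc he]
  · exact Finset.prod_congr rfl fun i hi => by rw [card_cell hK' hc he hi]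

/-- Group the regions by their numbers of arcs and peaks. The bound `2 ≤ c` makes the exponents
range over (0, 2), where the flat regions are counted. -/
theorem prod_allRegions {M : Type*} [CommMonoid M] {K : Configuration c} (hc : 2 ≤ c)
    (h : ℕ × ℕ → M) :
    ∏ i ∈ allRegions K, h ((arcsOf i).card, peakCount i) =
      ∏ i ∈ Finset.range (c + 1), ∏ j ∈ Finset.range (c + 1), h (i, j) ^ numRegionsPeaks K i j := by
  have hcard : ∀ A : Finset (Fin c), A.card ∈ Finset.range (c + 1) := fun A => by
    rw [Finset.mem_range]
    have := (Finset.card_le_univ A)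
    simp at this
    omega
  have h1 : ∏ Q ∈ regions K, h ((boundaryArcs Q).card, (peaks Q).card) =
      ∏ x ∈ Finset.range (c + 1) ×ˢ Finset.range (c + 1), h x ^ ((regions K).filter
        fun Q => (boundaryArcs Q).card = x.1 ∧ (peaks Q).card = x.2).card := by
    rw [← Finset.prod_fiberwise_of_maps_to (t := Finset.range (c + 1) ×ˢ Finset.range (c + 1))
      (g := fun Q => ((boundaryArcs Q).card, (peaks Q).card))]
    · refine Finset.prod_congr rfl fun x _ => ?_
      rw [← Finset.prod_const]
      refine Finset.prod_congr (Finset.filter_congr fun Q _ => by rw [Prod.ext_iff])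
        fun Q hQ => ?_
      obtain ⟨h1, h2⟩ := (Finset.mem_filter.1 hQ).2
      rw [h1, h2]
    · exact fun Q _ => Finset.mem_product.2 ⟨hcard (boundaryArcs Q), hcard (peaks Q)⟩
  have h2 : ∏ f ∈ flatRegions K, h (0, 2) =
      ∏ x ∈ Finset.range (c + 1) ×ˢ Finset.range (c + 1),
        h x ^ (if x.1 = 0 ∧ x.2 = 2 then (flatRegions K).card else 0) := by
    rw [Finset.prod_const, Finset.prod_eq_single (0, 2)]
    · simp
    · intro x _ hx
      rw [if_neg fun h => hx (Prod.ext h.1 h.2), pow_zero]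
    · intro hx
      exfalso
      apply hx
      rw [Finset.mem_product, Finset.mem_range, Finset.mem_range]
      constructor <;> simp only <;> omega
  rw [allRegions, Finset.prod_disjSum]
  simp only [arcsOf, peakCount, Finset.card_empty]
  rw [h1, h2, ← Finset.prod_mul_distrib, ← Finset.prod_product']
  refine Finset.prod_congr rfl fun x _ => ?_
  rw [← pow_add]
  rfl

/-- The full noncrossing count on 2i + j + m points contains that power of `pointFactor`, but the
region is entitled only to the power i + m. The excess i + j is cancelled by `r`. -/
theorem gapSeries_diagram [Algebra ℚ R] {S : Set ℕ} (hS : 0 ∉ S) (w : R) {r : R}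
    (hr : r * pointFactor S w = 1) (A : Finset (Fin c)) (j : ℕ) :
    (gapSeries A fun m => pointFactor S w ^ (A.card + m) *
      ncSum False (bigSizes S) w (2 * A.card + j + m)) =
    PowerSeries.C (r ^ (A.card + j)) *
      regionSeriesPeaks (genSeries False S w 0) A.card j := by
  rw [regionSeriesPeaks_eq, C_mul_gapSeries]
  congr 1
  funext m
  rw [coeff_zero_genSeries_zero, ncSum_eq_pointFactor_mul hS, ← mul_assoc]
  congr 1
  rw [show 2 * A.card + j + m = (A.card + j) + (A.card + m) by ring,
    pow_add (pointFactor S w) (A.card + j), ← mul_assoc, ← mul_pow, hr, one_pow, one_mul]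

/-! ### The families -/

theorem mem_partitions {n : ℕ} {H : Configuration n} :
    H ∈ partitions n ↔ (∀ U ∈ H, U.Nonempty) ∧ (∀ W ∈ H, ∀ W' ∈ H, W' ≠ W → Disjoint W W') ∧
      ∀ v, ∃ W ∈ H, v ∈ W := by
  constructor
  · rintro ⟨P, rfl⟩
    refine ⟨fun U hU => P.nonempty_of_mem_parts hU,
      fun W hW W' hW' hne => P.disjoint hW hW' hne.symm, fun v => ?_⟩
    exact P.exists_mem (Finset.mem_univ v)
  · rintro ⟨h1, h2, h3⟩
    refine ⟨⟨H, ?_, ?_, ?_⟩, rfl⟩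
    · rw [Finset.supIndep_iff_pairwiseDisjoint]
      exact fun W hW W' hW' hne => h2 W hW W' hW' hne.symm
    · ext v
      simpa [Finset.mem_sup] using h3 v
    · intro h
      simpa using h1 _ h

theorem mem_partitionsSizes {S : Set ℕ} (hS : 0 ∉ S) {n : ℕ} {H : Configuration n} :
    H ∈ partitionsSizes S n ↔ IsFilling True S Finset.univ H := by
  constructor
  · rintro ⟨h1, h2⟩
    rw [mem_partitions] at h1
    exact ⟨h2, fun _ _ _ => Finset.subset_univ _, fun _ => h1.2.1, fun _ v _ => h1.2.2 v⟩
  · intro h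
    refine ⟨mem_partitions.2 ⟨fun U hU => ?_, h.disjoint trivial,
      fun v => h.cover trivial v (Finset.mem_univ v)⟩, h.card_mem⟩
    rw [← Finset.card_pos]
    exact Nat.pos_of_ne_zero fun h0 => hS (h0 ▸ h.card_mem U hU)

theorem mem_hyperchordDiagramsSizes {S : Set ℕ} (hS : 0 ∉ S) {n : ℕ} {H : Configuration n} :
    H ∈ hyperchordDiagramsSizes S n ↔ IsFilling False S Finset.univ H := by
  rw [isFilling_false]
  constructor
  · exact fun h => h.2
  · refine fun h => ⟨fun U hU => ?_, h⟩
    rw [← Finset.card_pos]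
    exact Nat.pos_of_ne_zero fun h0 => hS (h0 ▸ h U hU)

theorem genFun_eq {F : Family} {part : Prop} {S : Set ℕ}
    (hF : ∀ n (H : Configuration n), H ∈ F n ↔ IsFilling part S Finset.univ H) (k : ℕ) :
    genFun F k = genSeries part S (X : ℚ⟦X⟧) k := by
  classical
  ext n m
  rw [genFun, genSeries, coeff_mk, coeff_mk, coeff_mk, map_sum]
  simp only [coeff_X_pow]
  rw [Finset.sum_boole, Finset.filter_filter, ← Set.ncard_coe_finset]
  congr 2
  ext H
  simp only [hF, Set.mem_ofPred_eq, Finset.coe_filter, Finset.mem_univ, true_and]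
  tauto

theorem genFunX_eq {F : Family} {part : Prop} {S : Set ℕ}
    (hF : ∀ n (H : Configuration n), H ∈ F n ↔ IsFilling part S Finset.univ H) (k : ℕ) :
    genFunX F k = genSeries part S (1 : ℚ) k := by
  classical
  ext n
  rw [genFunX, genSeries, coeff_mk, coeff_mk]
  simp only [one_pow, Finset.sum_const, nsmul_eq_mul, mul_one]
  rw [← Set.ncard_coe_finset]
  congr 2
  ext H
  simp [hF]

theorem cores_eq {F : Family} {part : Prop} {S : Set ℕ}
    (hF : ∀ n (H : Configuration n), H ∈ F n ↔ IsFilling part S Finset.univ H) (k : ℕ) :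
    cores F k = coreSet part S k := by
  ext K
  simp only [cores, coreSet, Set.mem_ofPred_eq, hF]

theorem coreSet_pos {part : Prop} {S : Set ℕ} {k : ℕ} (hk : 1 ≤ k) {K : Σ n : ℕ, Configuration n}
    (hK : K ∈ coreSet part S k) : 0 < K.1 :=
  pos_of_crossingNumber (K := K.2) (hK.2.2 ▸ hk)

theorem coreSet_two_le {part : Prop} {S : Set ℕ} {k : ℕ} (hk : 1 ≤ k)
    {K : Σ n : ℕ, Configuration n} (hK : K ∈ coreSet part S k) : 2 ≤ K.1 := by
  obtain ⟨U, -, -, hU⟩ := hK.2.1.full ⟨0, coreSet_pos hk hK⟩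
  have := Finset.card_le_univ U
  simp at this
  omega

/-- The formula for partitions. -/
theorem genSeries_partition [Algebra ℚ R] {S : Set ℕ} (hS : 0 ∉ S) (w : R) {k : ℕ} (hk : 1 ≤ k) :
    genSeries True S w k = xDiff (∑ K ∈ (coreSet_finite True S k).toFinset,
      algebraMap ℚ R⟦X⟧ (K.1 : ℚ)⁻¹ * PowerSeries.C w ^ K.2.card *
        ∏ i ∈ Finset.Icc 1 K.1, regionSeries (genSeries True S w 0) i ^ numRegions K.2 i) := by
  rw [genSeries_eq True S w hk fun K =>
    ∏ i ∈ Finset.Icc 1 K.1, regionSeries (genSeries True S w 0) i ^ numRegions K.2 i]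
  intro K hK n
  rw [sum_fillingSum_partition hS w (coreSet_pos hk hK), prod_regions_partition hS]

/-- The formula for diagrams. -/
theorem genSeries_diagram [Algebra ℚ R] {S : Set ℕ} (hS : 0 ∉ S) (w : R) {r : R}
    (hr : r * pointFactor S w = 1) {k : ℕ} (hk : 1 ≤ k) :
    genSeries False S w k = xDiff (∑ K ∈ (coreSet_finite False S k).toFinset,
      algebraMap ℚ R⟦X⟧ (K.1 : ℚ)⁻¹ * PowerSeries.C w ^ K.2.card *
        ∏ i ∈ Finset.range (K.1 + 1), ∏ j ∈ Finset.range (K.1 + 1),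
          (PowerSeries.C (r ^ (i + j)) * regionSeriesPeaks (genSeries False S w 0) i j) ^
            numRegionsPeaks K.2 i j) := by
  rw [genSeries_eq False S w hk fun K =>
    ∏ i ∈ Finset.range (K.1 + 1), ∏ j ∈ Finset.range (K.1 + 1),
      (PowerSeries.C (r ^ (i + j)) * regionSeriesPeaks (genSeries False S w 0) i j) ^
        numRegionsPeaks K.2 i j]
  intro K hK n
  rw [sum_fillingSum_diagram hS w (coreSet_pos hk hK) hK.2.1.spread hK.2.1.full]
  rw [← prod_allRegions (K := K.2) (coreSet_two_le hk hK) fun x =>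
    PowerSeries.C (r ^ (x.1 + x.2)) * regionSeriesPeaks (genSeries False S w 0) x.1 x.2]
  simp only [gapSeries_diagram hS w hr]

/-- The formula for a family of partitions, in two variables. -/
theorem genFun_partition_formula {F : Family} {S : Set ℕ} (hS : 0 ∉ S)
    (hF : ∀ n (H : Configuration n), H ∈ F n ↔ IsFilling True S Finset.univ H) {k : ℕ}
    (hk : 1 ≤ k) : (cores F k).Finite ∧ genFun F k =
      xDiff (substXY (corePolynomial F k) (regionSeries (genFun F 0))) := by
  have hfin : (cores F k).Finite := cores_eq hF k ▸ coreSet_finite True S k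
  refine ⟨hfin, ?_⟩
  rw [genFun_eq hF, genFun_eq hF, genSeries_partition hS _ hk, substXY, corePolynomial,
    finsum_mem_eq_finite_toFinset_sum _ hfin, map_sum]
  congr 1
  refine Finset.sum_congr (by simp only [cores_eq hF k]) fun K _ => ?_
  simp only [map_mul, map_pow, map_prod, MvPolynomial.aeval_X, MvPolynomial.aeval_C,
    Option.elim_none, Option.elim_some]
  rfl

/-- The formula for a family of partitions, in one variable. -/
theorem genFunX_partition_formula {F : Family} {S : Set ℕ} (hS : 0 ∉ S)
    (hF : ∀ n (H : Configuration n), H ∈ F n ↔ IsFilling True S Finset.univ H) {k : ℕ}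
    (hk : 1 ≤ k) : (cores F k).Finite ∧ genFunX F k =
      xDiff (MvPolynomial.aeval (regionSeries (genFunX F 0)) (corePolynomialX F k)) := by
  have hfin : (cores F k).Finite := cores_eq hF k ▸ coreSet_finite True S k
  refine ⟨hfin, ?_⟩
  rw [genFunX_eq hF, genFunX_eq hF, genSeries_partition hS _ hk, corePolynomialX,
    finsum_mem_eq_finite_toFinset_sum _ hfin, map_sum]
  congr 1
  refine Finset.sum_congr (by simp only [cores_eq hF k]) fun K _ => ?_
  simp only [map_mul, map_pow, map_prod, MvPolynomial.aeval_X, MvPolynomial.aeval_C, map_one,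
    one_pow, mul_one]

theorem inv_singletonFactor_mul (S : Set ℕ) :
    (singletonFactor S)⁻¹ * pointFactor S (X : ℚ⟦X⟧) = 1 := by
  have : pointFactor S (X : ℚ⟦X⟧) = singletonFactor S := rfl
  rw [this]
  refine PowerSeries.inv_mul_cancel _ ?_
  unfold singletonFactor
  split_ifs <;> simp

/-- The formula for a family of diagrams. -/
theorem genFun_diagram_formula {F : Family} {S : Set ℕ} (hS : 0 ∉ S)
    (hF : ∀ n (H : Configuration n), H ∈ F n ↔ IsFilling False S Finset.univ H) {k : ℕ}
    (hk : 1 ≤ k) : (cores F k).Finite ∧ genFun F k =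
      xDiff (substXY (corePolynomialPeaks F k)
        fun ij => regionSeriesHyper S (genFun F 0) ij.1 ij.2) := by
  have hfin : (cores F k).Finite := cores_eq hF k ▸ coreSet_finite False S k
  refine ⟨hfin, ?_⟩
  rw [genFun_eq hF, genFun_eq hF, genSeries_diagram hS _ (inv_singletonFactor_mul S) hk, substXY,
    corePolynomialPeaks, finsum_mem_eq_finite_toFinset_sum _ hfin, map_sum]
  congr 1
  refine Finset.sum_congr (by simp only [cores_eq hF k]) fun K _ => ?_
  simp only [map_mul, map_pow, map_prod, MvPolynomial.aeval_X, MvPolynomial.aeval_C,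
    Option.elim_none, Option.elim_some, regionSeriesHyper, yVar]

end FamilyFormula

end ChordConfig

namespace ChordConfig

/-! ### A distinguished hyperchord, treated like a core with one block -/

section Distinguished

variable {n c : ℕ} {R : Type*} [CommRing R]

theorem ncSum_eq_sum_univ (part : Prop) (S : Set ℕ) (w : R) (N : ℕ) [DecidablePred
    fun D : Configuration N => NonCrossing D ∧ IsFilling part S Finset.univ D] :
    ncSum part S w N = ∑ D : Configuration N with
      NonCrossing D ∧ IsFilling part S Finset.univ D, w ^ D.card := by
  classical
  rw [ncSum, ncSumOn]
  refine Finset.sum_congr ?_ fun _ _ => rfl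
  ext D
  simp only [Finset.mem_filter, Finset.mem_univ, true_and, Finset.mem_powerset]
  exact ⟨fun h => h.2, fun h =>
    ⟨fun W hW => mem_hyperSets.2 ⟨Finset.subset_univ _, h.2.card_mem W hW⟩, h⟩⟩

/-- The configuration whose only hyperchord is the set of all points. -/
def fullBlock (c : ℕ) : Configuration c := {Finset.univ}

theorem mem_fullBlock {U : Finset (Fin c)} : U ∈ fullBlock c ↔ U = Finset.univ :=
  Finset.mem_singleton

theorem mapConfig_fullBlock (e : Fin c ↪ Fin n) :
    mapConfig e (fullBlock c) = {Finset.univ.map e} := by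
  ext W
  simp [mem_mapConfig, mem_fullBlock, eq_comm]

theorem isFilling_fullBlock {part : Prop} {S : Set ℕ} :
    IsFilling part S Finset.univ (fullBlock c) ↔ c ∈ S := by
  constructor
  · intro h
    simpa using h.card_mem Finset.univ (mem_fullBlock.2 rfl)
  · intro h
    refine ⟨fun W hW => ?_, fun _ _ _ => Finset.subset_univ _, fun _ W hW W' hW' hne => ?_,
      fun _ v _ => ⟨_, mem_fullBlock.2 rfl, Finset.mem_univ v⟩⟩
    · rw [mem_fullBlock.1 hW]
      simpa using h
    · exact absurd ((mem_fullBlock.1 hW').trans (mem_fullBlock.1 hW).symm) hne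

open Classical in
/-- The configurations that contain a given hyperchord. -/
theorem sum_mem_eq_fillingSum {part : Prop} {S : Set ℕ} (w : R) (e : Fin c ↪o Fin n) :
    ∑ D : Configuration n with (NonCrossing D ∧ IsFilling part S Finset.univ D) ∧
        Finset.univ.map e.toEmbedding ∈ D, w ^ D.card =
      if c ∈ S then w * fillingSum part S w (fullBlock c) e else 0 := by
  have hfull : ∀ v : Fin c, ∃ U ∈ fullBlock c, v ∈ U :=
    fun v => ⟨_, mem_fullBlock.2 rfl, Finset.mem_univ v⟩
  set U := Finset.univ.map e.toEmbedding with hU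
  have hUcard : U.card = c := by simp [hU]
  split_ifs with hc
  · rw [fillingSum, Finset.mul_sum]
    -- Adding `U` preserves the noncrossing property exactly when `D` is compatible with the
    -- one-block configuration, so the product formulas for completions become available.
    have key : ∀ D : Configuration n, U ∉ D →
        ((NonCrossing (insert U D) ∧ IsFilling part S Finset.univ (insert U D)) ↔
          Compatible (fullBlock c) e D ∧ IsFilling part S Uᶜ D) := by
      intro D hD
      have hD' : ∀ W ∈ D, W ∉ mapConfig e.toEmbedding (fullBlock c) := by
        intro W hW h
        rw [mapConfig_fullBlock, Finset.mem_singleton] at h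
        exact hD (by rw [hU, ← h]; exact hW)
      have h1 := isFilling_union_iff (part := part) (S := S) hfull hD'
      rw [mapConfig_fullBlock, isFilling_fullBlock, ← hU, ← Finset.insert_eq] at h1
      rw [h1]
      constructor
      · rintro ⟨hnc, -, h⟩
        refine ⟨⟨fun W hW V hV => hnc W (Finset.mem_insert_of_mem hW) V
          (Finset.mem_insert_of_mem hV), fun W hW V hV => ?_, hD'⟩, h⟩
        rw [mem_fullBlock.1 hV]
        exact hnc W (Finset.mem_insert_of_mem hW) U (Finset.mem_insert_self _ _)
          fun h => hD (h ▸ hW)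
      · rintro ⟨⟨h1, h2, -⟩, h⟩
        refine ⟨?_, hc, h⟩
        intro W hW V hV hne
        rw [Finset.mem_insert] at hW hV
        rcases hW with rfl | hW <;> rcases hV with rfl | hV
        · exact absurd rfl hne
        · exact fun h => h2 V hV _ (mem_fullBlock.2 rfl) (cross_comm.1 h)
        · exact fun h => h2 W hW _ (mem_fullBlock.2 rfl) h
        · exact h1 W hW V hV hne
    refine Finset.sum_bij' (fun D _ => D.erase U) (fun D _ => insert U D) ?_ ?_ ?_ ?_ ?_
    · intro D hD
      simp only [Finset.mem_filter, Finset.mem_univ, true_and] at hD ⊢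
      refine (key _ (Finset.notMem_erase U D)).1 ?_
      rw [Finset.insert_erase hD.2]
      exact hD.1
    · intro D hD
      simp only [Finset.mem_filter, Finset.mem_univ, true_and] at hD ⊢
      refine ⟨(key D fun h => ?_).2 hD, Finset.mem_insert_self _ _⟩
      exact hD.1.notMem U h (by rw [mapConfig_fullBlock, hU]; exact Finset.mem_singleton_self _)
    · intro D hD
      simp only [Finset.mem_filter, Finset.mem_univ, true_and] at hD
      exact Finset.insert_erase hD.2
    · intro D hD
      simp only [Finset.mem_filter, Finset.mem_univ, true_and] at hD
      refine Finset.erase_insert fun h => ?_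
      exact hD.1.notMem U h (by rw [mapConfig_fullBlock, hU]; exact Finset.mem_singleton_self _)
    · intro D hD
      simp only [Finset.mem_filter, Finset.mem_univ, true_and] at hD
      rw [← pow_succ', Finset.card_erase_add_one hD.2]
  · refine Finset.sum_eq_zero fun D hD => ?_
    simp only [Finset.mem_filter, Finset.mem_univ, true_and] at hD
    exact absurd (hUcard ▸ hD.1.2.card_mem U hD.2) hc

open Classical in
/-- The configurations with a unique hyperchord of a certain kind. -/
theorem sum_exists_unique_eq {part : Prop} {S : Set ℕ} (w : R) (P : Finset (Fin n) → Prop)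
    (hP : ∀ D : Configuration n, NonCrossing D → IsFilling part S Finset.univ D →
      ∀ U ∈ D, ∀ V ∈ D, P U → P V → U = V) :
    ∑ D : Configuration n with (NonCrossing D ∧ IsFilling part S Finset.univ D) ∧
        ∃ U ∈ D, P U, w ^ D.card =
      ∑ s ∈ Finset.range (n + 1) with s ∈ S, w *
        ∑ e : Fin s ↪o Fin n with P (Finset.univ.map e.toEmbedding),
          fillingSum part S w (fullBlock s) e := by
  have h1 : ∑ D : Configuration n with (NonCrossing D ∧ IsFilling part S Finset.univ D) ∧
        ∃ U ∈ D, P U, w ^ D.card = ∑ U : Finset (Fin n) with P U,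
      ∑ D : Configuration n with (NonCrossing D ∧ IsFilling part S Finset.univ D) ∧
        U ∈ D, w ^ D.card := by
    rw [← Finset.sum_biUnion]
    · refine Finset.sum_congr ?_ fun _ _ => rfl
      ext D
      simp only [Finset.mem_filter, Finset.mem_univ, true_and, Finset.mem_biUnion]
      constructor
      · rintro ⟨h, U, hU, hPU⟩
        exact ⟨U, hPU, h, hU⟩
      · rintro ⟨U, hPU, h, hU⟩
        exact ⟨h, U, hU, hPU⟩
    · intro U hU V hV hne
      simp only [Finset.coe_filter, Finset.mem_univ, true_and, Set.mem_ofPred_eq] at hU hV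
      simp only [Function.onFun]
      rw [Finset.disjoint_left]
      intro D hD hD'
      simp only [Finset.mem_filter, Finset.mem_univ, true_and] at hD hD'
      exact hne (hP D hD.1.1 hD.1.2 U hD.2 V hD'.2 hU hV)
  have hmaps : ∀ U ∈ (Finset.univ : Finset (Finset (Fin n))).filter P,
      U.card ∈ Finset.range (n + 1) := fun U _ => by
    have := Finset.card_le_univ U
    simp at this
    rw [Finset.mem_range]
    omega
  rw [h1, ← Finset.sum_fiberwise_of_maps_to hmaps, Finset.sum_filter]
  refine Finset.sum_congr rfl fun s _ => ?_
  have h2 : ∑ U ∈ ((Finset.univ : Finset (Finset (Fin n))).filter P) with U.card = s,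
      ∑ D : Configuration n with (NonCrossing D ∧ IsFilling part S Finset.univ D) ∧
        U ∈ D, w ^ D.card = ∑ e : Fin s ↪o Fin n with P (Finset.univ.map e.toEmbedding),
      ∑ D : Configuration n with (NonCrossing D ∧ IsFilling part S Finset.univ D) ∧
        Finset.univ.map e.toEmbedding ∈ D, w ^ D.card := by
    symm
    refine Finset.sum_bij (fun e _ => Finset.univ.map e.toEmbedding) ?_ ?_ ?_ ?_
    · intro e he
      simp only [Finset.mem_filter, Finset.mem_univ, true_and] at he ⊢
      exact ⟨he, by simp⟩
    · exact fun e _ e' _ h => orderEmbedding_eq_of_map_univ_eq h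
    · intro U hU
      simp only [Finset.mem_filter, Finset.mem_univ, true_and] at hU
      have hUe : Finset.univ.map (U.orderEmbOfFin hU.2).toEmbedding = U := by
        apply Finset.coe_injective
        simp
      refine ⟨U.orderEmbOfFin hU.2, ?_, hUe⟩
      simp only [Finset.mem_filter, Finset.mem_univ, true_and]
      rw [hUe]
      exact hU.1
    · exact fun _ _ => rfl
  rw [h2]
  simp only [sum_mem_eq_fillingSum]
  split_ifs
  · rw [Finset.mul_sum]
  · simp

end Distinguished

/-! ### Functional equation for noncrossing partitions -/

section PartitionEquation

variable {c : ℕ} {R : Type*} [CommRing R]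

theorem eq_of_uncrossed_fullBlock {a b : Fin c}
    (h : Uncrossed (Finset.univ : Finset (Fin c)) (2 * a + 1) (2 * b + 1)) : a = b := by
  by_contra hne
  have hne : (a : ℕ) ≠ b := fun h => hne (Fin.ext h)
  rcases Nat.lt_or_gt_of_ne hne with hlt | hlt
  · exact h b (Finset.mem_univ _) a (Finset.mem_univ _) (Or.inl ⟨by omega, by omega⟩)
      (Or.inl ⟨by omega, by omega⟩)
  · exact h a (Finset.mem_univ _) b (Finset.mem_univ _) (Or.inr ⟨by omega, by omega⟩)
      (Or.inl ⟨by omega, by omega⟩)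

theorem card_boundaryArcs_fullBlock_le {Q : Finset (Fin c × Fin c)}
    (hQ : Q ∈ regions (fullBlock c)) : (boundaryArcs Q).card ≤ 1 := by
  rw [Finset.card_le_one]
  intro a ha b hb
  refine eq_of_uncrossed_fullBlock (InCell.uncrossed hQ (inCell_odd.2 (mem_boundaryArcs.1 ha))
    (inCell_odd.2 (mem_boundaryArcs.1 hb)) (mem_fullBlock.2 rfl))

theorem sum_card_boundaryArcs (K : Configuration c) :
    ∑ Q ∈ regions K, (boundaryArcs Q).card = c := by
  rw [← Finset.card_biUnion fun Q hQ Q' hQ' hne => boundaryArcs_disjoint hQ hQ' hne,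
    biUnion_boundaryArcs, Finset.card_univ, Fintype.card_fin]

theorem gapSeries_of_card_one {α : Type*} [DecidableEq α] {A : Finset α} (hA : A.card = 1)
    (f : ℕ → R) : gapSeries A f = X * PowerSeries.mk f := by
  rw [gapSeries_of_card (d := 0) hA]
  simp

/-- Outside a block each arc between consecutive vertices is a region of its own, carrying an
independent noncrossing partition. -/
theorem prod_regions_fullBlock {S : Set ℕ} (hS : 0 ∉ S) (w : R) :
    ∏ Q ∈ regions (fullBlock c), gapSeries (boundaryArcs Q) (ncSum True S w) =
      (X * genSeries True S w 0) ^ c := by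
  conv_rhs => rw [← sum_card_boundaryArcs (fullBlock c), ← Finset.prod_pow_eq_pow_sum]
  refine Finset.prod_congr rfl fun Q hQ => ?_
  have h := card_boundaryArcs_fullBlock_le hQ
  rcases Nat.le_one_iff_eq_zero_or_eq_one.1 h with h | h
  · rw [h, pow_zero, Finset.card_eq_zero.1 h, gapSeries_empty, ncSum_partition_zero hS, map_one]
  · rw [h, pow_one, gapSeries_of_card_one h]
    congr 1
    ext N
    rw [coeff_mk, coeff_zero_genSeries_zero]

-- Decompose according to the block of the first point: it is unique by disjointness, exists by
-- covering, and is placed by a rooted embedding.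
open Classical in
theorem ncSum_partition_succ {S : Set ℕ} (hS : 0 ∉ S) (w : R) (n : ℕ) :
    ncSum True S w (n + 1) = ∑ s ∈ Finset.range (n + 2) with s ∈ S,
      w * coeff (n + 1) ((X * genSeries True S w 0) ^ s) := by
  have h := sum_exists_unique_eq (part := True) (S := S) w
    (fun U : Finset (Fin (n + 1)) => (0 : Fin (n + 1)) ∈ U)
    (fun D _ hD U hU V hV h h' => by
      by_contra hne
      exact Finset.disjoint_left.1 (hD.disjoint trivial V hV U hU hne) h' h)
  rw [ncSum_eq_sum_univ]
  refine (Finset.sum_congr ?_ fun _ _ => rfl).trans (h.trans ?_)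
  · ext D
    simp only [Finset.mem_filter, Finset.mem_univ, true_and]
    refine (and_iff_left_of_imp fun hD => ?_).symm
    exact hD.2.cover trivial 0 (Finset.mem_univ _)
  · refine Finset.sum_congr rfl fun s hs => ?_
    have hs0 : 0 < s := Nat.pos_of_ne_zero fun h0 => hS (h0 ▸ (Finset.mem_filter.1 hs).2)
    rw [← prod_regions_fullBlock hS, ← sum_fillingSum_partition hS w hs0]
    congr 1
    refine Finset.sum_congr ?_ fun _ _ => rfl
    ext e
    simp only [Finset.mem_filter, Finset.mem_univ, true_and, Finset.mem_map]
    constructor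
    · rintro ⟨a, ha⟩ b hb
      have : e b ≤ e a := e.monotone (Fin.le_def.2 (by omega))
      have h0 : e a = 0 := ha
      rw [h0, Fin.le_def] at this
      simpa using this
    · exact fun he => ⟨⟨0, hs0⟩, Fin.ext (he _ rfl)⟩

end PartitionEquation

open Classical in
/-- The generating function of a set of integers. -/
noncomputable def indicatorSeries (S : Set ℕ) : ℚ⟦X⟧ :=
  PowerSeries.mk fun s => if s ∈ S then 1 else 0

/-- Since `B` has no constant term, powers of `B` beyond `n` do not reach degree `n`. -/
theorem coeff_subst_eq_sum {R : Type*} [CommRing R] [Algebra ℚ R] {B : R⟦X⟧}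
    (hB : constantCoeff B = 0) (f : ℚ⟦X⟧) {n N : ℕ} (hN : n < N) :
    coeff n (f.subst B) = ∑ s ∈ Finset.range N, coeff s f • coeff n (B ^ s) := by
  rw [coeff_subst' (HasSubst.of_constantCoeff_zero' hB),
    finsum_eq_sum_of_support_subset]
  intro s hs
  rw [Finset.coe_range, Set.mem_Iio]
  by_contra h
  apply hs
  have : X ^ s ∣ B ^ s := pow_dvd_pow_of_dvd (X_dvd_iff.2 hB) s
  simp only [X_pow_dvd_iff.1 this n (by omega), smul_zero]

theorem genSeries_partition_zero_eq {R : Type*} [CommRing R] [Algebra ℚ R] {S : Set ℕ}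
    (hS : 0 ∉ S) (w : R) :
    genSeries True S w 0 =
      1 + PowerSeries.C w * (indicatorSeries S).subst (X * genSeries True S w 0) := by
  classical
  have hB : constantCoeff (X * genSeries True S w 0) = 0 := by simp
  ext n
  rw [map_add, coeff_C_mul, coeff_subst_eq_sum hB _ (Nat.lt_succ_self n),
    coeff_zero_genSeries_zero]
  cases n with
  | zero =>
    rw [ncSum_partition_zero hS]
    simp [indicatorSeries, hS]
  | succ n =>
    rw [ncSum_partition_succ hS, Finset.sum_filter, Finset.mul_sum, coeff_one,
      if_neg (Nat.succ_ne_zero n), zero_add]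
    refine Finset.sum_congr rfl fun s _ => ?_
    rw [indicatorSeries, coeff_mk]
    split_ifs <;> simp

end ChordConfig

namespace ChordConfig

/-! ### Noncrossing diagrams with a hyperchord through the first and last points -/

section DiagramEquation

variable {n c : ℕ} {R : Type*} [CommRing R]

theorem exists_eq_of_mem_regions_fullBlock {Q : Finset (Fin c × Fin c)}
    (hQ : Q ∈ regions (fullBlock c)) : ∃ a, regionOf (fullBlock c) (a, a) = Q := by
  obtain ⟨⟨v, a⟩, -, rfl⟩ := mem_regions.1 hQ
  refine ⟨a, regionOf_eq fun U hU => ?_⟩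
  rw [sideArc_self, mem_fullBlock.1 hU]
  simpa [sideArc] using uncrossed_self _ _

/-- Any other vertex is cut off from arc `a` by the edge of the block that joins the two ends of
this arc. -/
theorem mem_regionOf_fullBlock {a v b : Fin c}
    (h : (v, b) ∈ regionOf (fullBlock c) (a, a)) : b = a ∧ (v = a ∨ v = finRotate c a) := by
  obtain ⟨hf, hs⟩ := mem_regionOf.1 h
  have hba : a = b := by
    have := hs Finset.univ (mem_fullBlock.2 rfl)
    rw [sideArc_self] at this
    exact eq_of_uncrossed_fullBlock (by simpa [sideArc] using this)
  subst hba
  refine ⟨rfl, ?_⟩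
  have hu : Uncrossed Finset.univ (2 * (v : ℕ)) (2 * (a : ℕ) + 1) :=
    isFree_iff.1 hf Finset.univ (mem_fullBlock.2 rfl) (Finset.mem_univ _)
  by_contra! hne
  obtain ⟨h1, h2⟩ := hne
  have h1 : (v : ℕ) ≠ a := fun h => h1 (Fin.ext h)
  have h2 : (v : ℕ) ≠ finRotate c a := fun h => h2 (Fin.ext h)
  have hv := v.2
  rcases Nat.lt_or_gt_of_ne h1 with hlt | hlt
  · have hb : Btw (2 * (v : ℕ)) (2 * (a : ℕ) + 1) (2 * a) := Or.inl ⟨by omega, by omega⟩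
    rcases val_finRotate a with ⟨h3, h4⟩ | ⟨h3, h4⟩
    · exact hu a (Finset.mem_univ _) ⟨a + 1, h4⟩ (Finset.mem_univ _) hb
        (Or.inr ⟨by simp only; omega, by simp only; omega⟩)
    · exact hu a (Finset.mem_univ _) ⟨0, by omega⟩ (Finset.mem_univ _) hb
        (Or.inl ⟨by simp only; omega, by simp only; omega⟩)
  · rcases val_finRotate a with ⟨h3, h4⟩ | ⟨h3, h4⟩
    · exact hu ⟨a + 1, h4⟩ (Finset.mem_univ _) a (Finset.mem_univ _)
        (Or.inr ⟨by simp only; omega, by simp only; omega⟩) (Or.inl ⟨by omega, by omega⟩)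
    · omega

theorem boundaryArcs_regionOf_fullBlock (a : Fin c) :
    boundaryArcs (regionOf (fullBlock c) (a, a)) = {a} := by
  ext b
  rw [mem_boundaryArcs, Finset.mem_singleton]
  constructor
  · exact fun h => (mem_regionOf_fullBlock h).1
  · rintro rfl
    exact mem_regionOf_self (isFree_self _ _)

theorem peaks_regionOf_fullBlock (a : Fin c) :
    peaks (regionOf (fullBlock c) (a, a)) = ∅ := by
  rw [Finset.eq_empty_iff_forall_notMem]
  intro v hv
  simp only [peaks, Finset.mem_filter, Finset.mem_univ, true_and] at hv
  obtain ⟨⟨b, hb⟩, h⟩ := hv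
  have := h a (by rw [boundaryArcs_regionOf_fullBlock]; exact Finset.mem_singleton_self a)
  rcases (mem_regionOf_fullBlock hb).2 with h' | h'
  · exact this.1 h'
  · exact this.2 h'

theorem flatRegions_fullBlock : flatRegions (fullBlock c) = ∅ := by
  rw [Finset.eq_empty_iff_forall_notMem]
  intro f hf
  obtain ⟨-, h1, ⟨U, hU, -, -, a, ha, h2, h3⟩, V, hV, -, -, b, hb, h4⟩ := mem_flatRegions.1 hf
  rw [mem_fullBlock.1 hU] at ha
  rw [mem_fullBlock.1 hV] at hb
  rw [Fin.lt_def] at h2 h3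
  refine h1 _ (mem_fullBlock.2 rfl) a ha b hb (Or.inl ⟨by omega, by omega⟩) ?_
  rcases h4 with h4 | h4
  · rw [Fin.lt_def] at h4
    exact Or.inl ⟨by omega, by omega⟩
  · rw [Fin.lt_def] at h4
    exact Or.inr ⟨by omega, by omega⟩

theorem full_fullBlock (hc : 2 ≤ c) : Full (fullBlock c) :=
  fun v => ⟨_, mem_fullBlock.2 rfl, Finset.mem_univ v, by simpa using hc⟩

/-- A block of size two fails: its two sides share both ends, so the product formula would count the
chord itself on each side. Chords are therefore treated apart, by toggling. -/
theorem spread_fullBlock (hc : 3 ≤ c) : Spread (fullBlock c) := fun U hU => by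
  rw [mem_fullBlock.1 hU]
  exact Or.inl (by simpa using hc)

theorem prod_allRegions_fullBlock (hc : 2 ≤ c) {e : Fin c ↪o Fin n} (he : Rooted e)
    (f : ℕ → R) : ∏ i ∈ allRegions (fullBlock c), f (cell e i).card =
      ∏ a : Fin c, f (gap e a + 2) := by
  classical
  rw [allRegions, flatRegions_fullBlock, Finset.prod_disjSum, Finset.prod_empty, mul_one]
  have himage : regions (fullBlock c) =
      Finset.univ.image fun a => regionOf (fullBlock c) (a, a) := by
    ext Q
    simp only [Finset.mem_image, Finset.mem_univ, true_and]
    constructor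
    · exact exists_eq_of_mem_regions_fullBlock
    · rintro ⟨a, rfl⟩
      exact mem_regions.2 ⟨_, isFree_self _ a, rfl⟩
  rw [himage, Finset.prod_image]
  · refine Finset.prod_congr rfl fun a _ => ?_
    rw [card_cell_inl (full_fullBlock hc) (by omega) he
      (mem_regions.2 ⟨_, isFree_self _ a, rfl⟩), boundaryArcs_regionOf_fullBlock,
      peaks_regionOf_fullBlock, Finset.sum_singleton, Finset.card_singleton, Finset.card_empty]
    congr 1
    omega
  · intro a _ b _ h
    have h := congrArg boundaryArcs h
    simp only [boundaryArcs_regionOf_fullBlock] at h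
    exact Finset.singleton_injective h

theorem bigSizes_eq_self {S : Set ℕ} (hS : ∀ s ∈ S, 2 ≤ s) : bigSizes S = S := by
  ext s
  exact ⟨fun h => h.1, fun h => ⟨h, hS s h⟩⟩

theorem pointFactor_of_two_le {S : Set ℕ} (hS : ∀ s ∈ S, 2 ≤ s) (w : R) :
    pointFactor S w = 1 :=
  if_neg fun h => absurd (hS 1 h) (by norm_num)

theorem zero_notMem_of_two_le {S : Set ℕ} (hS : ∀ s ∈ S, 2 ≤ s) : 0 ∉ S :=
  fun h => absurd (hS 0 h) (by norm_num)

/-- All the points after the last image point lie on the last arc. -/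
theorem mem_map_last_iff {e : Fin (c + 1) ↪o Fin (n + 1)} (he : Rooted e) :
    Fin.last n ∈ Finset.univ.map e.toEmbedding ↔ gap e (Fin.last c) = 0 := by
  have h1 := val_apply_eq_sum (Nat.succ_pos c) he (Fin.last c)
  have h2 := sum_gap_add_one (Nat.succ_pos c) he
  have h3 : (Finset.univ : Finset (Fin (c + 1))) =
      insert (Fin.last c) (Finset.Iio (Fin.last c)) := by
    ext a
    rw [Finset.mem_insert, Finset.mem_Iio, ← le_iff_eq_or_lt]
    simp [Fin.le_last]
  rw [h3, Finset.sum_insert (by simp), ← h1] at h2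
  have h4 : Fin.last n ∈ Finset.univ.map e.toEmbedding ↔ (e (Fin.last c) : ℕ) = n := by
    rw [Finset.mem_map]
    constructor
    · rintro ⟨a, -, ha⟩
      have h5 : e a ≤ e (Fin.last c) := e.monotone (Fin.le_last a)
      have h6 : e a = Fin.last n := ha
      rw [h6, Fin.le_def, Fin.val_last] at h5
      have := (e (Fin.last c)).2
      omega
    · exact fun h => ⟨Fin.last c, Finset.mem_univ _, Fin.ext h⟩
  rw [h4]
  omega

/-- The generating function of the noncrossing diagrams on at least two points, where one of the
points is not marked. -/
noncomputable def polygonSeries (S : Set ℕ) (w : R) : R⟦X⟧ :=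
  X * PowerSeries.mk fun m => ncSum False S w (m + 2)

-- The closing arc holds no inserted point, so its cell is the pair of first and last points and
-- gives the constant `ncSum False S w 2`. Each of the other `c` arcs gives a `polygonSeries`.
open Classical in
theorem sum_fillingSum_fullBlock {S : Set ℕ} (hS : ∀ s ∈ S, 2 ≤ s) (w : R) (hc : 2 ≤ c) (n : ℕ) :
    ∑ e : Fin (c + 1) ↪o Fin (n + 1) with Rooted e ∧ gap e (Fin.last c) = 0,
      fillingSum False S w (fullBlock (c + 1)) e =
    ncSum False S w 2 * coeff n (polygonSeries S w ^ c) := by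
  -- The vanishing of the last gap is encoded in the weight of the last arc, which turns the
  -- restricted sum into a sum over all rooted embeddings.
  set f : Fin (c + 1) → ℕ → R := fun a m =>
    if a = Fin.last c then (if m = 0 then ncSum False S w 2 else 0) else ncSum False S w (m + 2)
    with hf
  have h := sum_rooted_prod_eq (Nat.succ_pos c) (n + 1) Finset.univ
    (fun a : Fin (c + 1) => {a}) (fun i _ j _ hij => by simpa using hij) (by ext; simp) f
  have h1 : ∀ a : Fin c, gapSeries ({a.castSucc} : Finset (Fin (c + 1))) (f a.castSucc) =
      polygonSeries S w := fun a => by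
    rw [gapSeries_of_card_one (Finset.card_singleton _), polygonSeries]
    congr 2
    funext m
    simp only [hf]
    rw [if_neg (Fin.castSucc_lt_last a).ne]
  have h2 : gapSeries ({Fin.last c} : Finset (Fin (c + 1))) (f (Fin.last c)) =
      X * PowerSeries.C (ncSum False S w 2) := by
    rw [gapSeries_of_card_one (Finset.card_singleton _)]
    congr 1
    ext m
    simp only [hf, if_true, coeff_mk, coeff_C]
  rw [Fin.prod_univ_castSucc, h2] at h
  simp only [h1, Finset.prod_const, Finset.card_univ, Fintype.card_fin, Finset.sum_singleton] at h
  rw [show polygonSeries S w ^ c * (X * PowerSeries.C (ncSum False S w 2)) =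
    X * (PowerSeries.C (ncSum False S w 2) * polygonSeries S w ^ c) by ring,
    coeff_succ_X_mul, coeff_C_mul] at h
  rw [← h, ← Finset.filter_filter, Finset.sum_filter]
  refine Finset.sum_congr rfl fun e he => ?_
  have he : Rooted e := (Finset.mem_filter.1 he).2
  rw [Fin.prod_univ_castSucc]
  simp only [hf, if_true]
  split_ifs with h0
  · rw [fillingSum_diagram (zero_notMem_of_two_le hS) w (spread_fullBlock (by omega))
      (Nat.succ_pos c) he, pointFactor_of_two_le hS, one_pow, one_mul, bigSizes_eq_self hS,
      prod_allRegions_fullBlock (by omega) he, Fin.prod_univ_castSucc, h0, zero_add]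
    congr 1
    refine Finset.prod_congr rfl fun a _ => ?_
    rw [if_neg (Fin.castSucc_lt_last a).ne]
  · rw [mul_zero]

/-- Two noncrossing hyperchords with at least three vertices that share the first and the last
point are equal. -/
theorem eq_of_not_cross_of_last {U V : Finset (Fin (n + 1))} (hU : 3 ≤ U.card) (hV : 3 ≤ V.card)
    (hU0 : 0 ∈ U) (hV0 : 0 ∈ V) (hUn : Fin.last n ∈ U) (hVn : Fin.last n ∈ V)
    (h : ¬ Cross U V) : U = V := by
  have key : ∀ {U V : Finset (Fin (n + 1))}, 3 ≤ U.card → 0 ∈ U → 0 ∈ V → Fin.last n ∈ U →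
      Fin.last n ∈ V → ¬ Cross U V → V ⊆ U := by
    intro U V hU hU0 hV0 hUn hVn h b hb
    by_contra hbU
    obtain ⟨a, ha, ha0, han⟩ : ∃ a ∈ U, a ≠ 0 ∧ a ≠ Fin.last n := by
      by_contra! hc
      have : U ⊆ {0, Fin.last n} := fun a ha => by
        rw [Finset.mem_insert, Finset.mem_singleton]
        by_cases h0 : a = 0
        · exact Or.inl h0
        · exact Or.inr (hc a ha h0)
      have := (Finset.card_le_card this).trans Finset.card_le_two
      omega
    have hb0 : b ≠ 0 := fun h => hbU (h ▸ hU0)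
    have hbn : b ≠ Fin.last n := fun h => hbU (h ▸ hUn)
    have hab : a ≠ b := fun h => hbU (h ▸ ha)
    have h1 : 0 < a := Fin.pos_iff_ne_zero.2 ha0
    have h2 : 0 < b := Fin.pos_iff_ne_zero.2 hb0
    have h3 : a < Fin.last n := lt_of_le_of_ne (Fin.le_last a) han
    have h4 : b < Fin.last n := lt_of_le_of_ne (Fin.le_last b) hbn
    apply h
    rw [cross_iff]
    rcases lt_or_gt_of_ne hab with hlt | hlt
    · exact ⟨a, ha, _, hUn, b, hb, 0, hV0, ⟨hlt, h4⟩, Or.inl h1⟩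
    · exact ⟨0, hU0, a, ha, b, hb, _, hVn, ⟨h2, hlt⟩, Or.inr h3⟩
  exact Finset.Subset.antisymm (key hV hV0 hU0 hVn hUn fun h' => h (cross_comm.1 h'))
    (key hU hU0 hV0 hUn hVn h)

open Classical in
/-- The noncrossing diagrams where a hyperchord with at least three vertices contains the first and
the last point. -/
theorem sum_big_eq {S : Set ℕ} (hS : ∀ s ∈ S, 2 ≤ s) (w : R) (n : ℕ) :
    ∑ D : Configuration (n + 1) with (NonCrossing D ∧ IsFilling False S Finset.univ D) ∧
        ∃ U ∈ D, 3 ≤ U.card ∧ 0 ∈ U ∧ Fin.last n ∈ U, w ^ D.card =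
      ∑ t ∈ Finset.range (n + 1) with t + 1 ∈ S ∧ 2 ≤ t,
        w * (ncSum False S w 2 * coeff n (polygonSeries S w ^ t)) := by
  have h := sum_exists_unique_eq (part := False) (S := S) w
    (fun U : Finset (Fin (n + 1)) => 3 ≤ U.card ∧ 0 ∈ U ∧ Fin.last n ∈ U) ?_
  · refine (Finset.sum_congr ?_ fun _ _ => rfl).trans (h.trans ?_)
    · ext D
      simp only [Finset.mem_filter, Finset.mem_univ, true_and]
    · rw [Finset.sum_filter, Finset.sum_range_succ', if_neg (zero_notMem_of_two_le hS), add_zero,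
        Finset.sum_filter]
      refine Finset.sum_congr rfl fun t _ => ?_
      by_cases ht : t + 1 ∈ S
      · by_cases h2 : 2 ≤ t
        · rw [if_pos ht, if_pos ⟨ht, h2⟩, ← sum_fillingSum_fullBlock hS w h2]
          congr 1
          refine Finset.sum_congr ?_ fun _ _ => rfl
          ext e
          simp only [Finset.mem_filter, Finset.mem_univ, true_and, Finset.card_map,
            Finset.card_univ, Fintype.card_fin]
          have h0 : 0 ∈ Finset.univ.map e.toEmbedding ↔ Rooted e := by
            rw [Finset.mem_map]
            constructor
            · rintro ⟨a, -, ha⟩ b hb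
              have : e b ≤ e a := e.monotone (Fin.le_def.2 (by omega))
              have h0 : e a = 0 := ha
              rw [h0, Fin.le_def] at this
              simpa using this
            · exact fun he => ⟨0, Finset.mem_univ _, Fin.ext (he _ rfl)⟩
          rw [h0]
          constructor
          · exact fun h => ⟨h.2.1, (mem_map_last_iff h.2.1).1 h.2.2⟩
          · exact fun h => ⟨by omega, h.1, (mem_map_last_iff h.1).2 h.2⟩
        · rw [if_pos ht, if_neg fun h => h2 h.2, Finset.sum_eq_zero, mul_zero]
          intro e he
          simp only [Finset.mem_filter, Finset.card_map, Finset.card_univ, Fintype.card_fin] at he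
          omega
      · rw [if_neg ht, if_neg fun h => ht h.1]
  · intro D hD _ U hU V hV h h'
    by_contra hne
    exact hne (eq_of_not_cross_of_last h.1 h'.1 h.2.1 h'.2.1 h.2.2 h'.2.2
      (hD U hU V hV (Ne.symm hne)))

/-- Erasing `u` matches the sets with and without it, at the cost of one factor `w`. -/
theorem sum_insert_toggle {α : Type*} [Fintype α] [DecidableEq α] (w : R) (u : α)
    (Q : Finset α → Prop) [DecidablePred Q] (hQ : ∀ D, u ∉ D → (Q (insert u D) ↔ Q D)) :
    ∑ D : Finset α with Q D ∧ u ∈ D, w ^ D.card =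
      w * ∑ D : Finset α with Q D ∧ u ∉ D, w ^ D.card := by
  rw [Finset.mul_sum]
  refine Finset.sum_bij' (fun D _ => D.erase u) (fun D _ => insert u D) ?_ ?_ ?_ ?_ ?_
  · intro D hD
    simp only [Finset.mem_filter, Finset.mem_univ, true_and] at hD ⊢
    refine ⟨(hQ _ (Finset.notMem_erase u D)).1 ?_, Finset.notMem_erase u D⟩
    rw [Finset.insert_erase hD.2]
    exact hD.1
  · intro D hD
    simp only [Finset.mem_filter, Finset.mem_univ, true_and] at hD ⊢
    exact ⟨(hQ _ hD.2).2 hD.1, Finset.mem_insert_self u D⟩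
  · intro D hD
    simp only [Finset.mem_filter, Finset.mem_univ, true_and] at hD
    exact Finset.insert_erase hD.2
  · intro D hD
    simp only [Finset.mem_filter, Finset.mem_univ, true_and] at hD
    exact Finset.erase_insert hD.2
  · intro D hD
    simp only [Finset.mem_filter, Finset.mem_univ, true_and] at hD
    rw [← pow_succ', Finset.card_erase_add_one hD.2]

open Classical in
/-- The sum of `w ^ |D|` over the noncrossing diagrams where a hyperchord contains the first and the
last of the `n + 1` points. -/
noncomputable def joinSum (S : Set ℕ) (w : R) (n : ℕ) : R :=
  ∑ D : Configuration (n + 1) with (NonCrossing D ∧ IsFilling False S Finset.univ D) ∧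
    ∃ U ∈ D, 0 ∈ U ∧ Fin.last n ∈ U, w ^ D.card

open Classical in
/-- The weight of a chord, if chords are allowed by `S`. -/
noncomputable def chordWeight (S : Set ℕ) (w : R) : R := if 2 ∈ S then w else 0

-- If allowed, the chord from the first to the last point crosses nothing and can be toggled. Let T
-- and B be the total and the large-hyperchord sums restricted to diagrams without this chord. Then
-- the join sum is wT + B, while the unrestricted sums are (1 + w)T and (1 + w)B. If chords are not
-- allowed, only large hyperchords join the two points.
open Classical in
theorem one_add_mul_joinSum {S : Set ℕ} (hS : ∀ s ∈ S, 2 ≤ s) (w : R) {n : ℕ} (hn : 1 ≤ n) :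
    (1 + chordWeight S w) * joinSum S w n = chordWeight S w * ncSum False S w (n + 1) +
      ∑ t ∈ Finset.range (n + 1) with t + 1 ∈ S ∧ 2 ≤ t,
        w * (ncSum False S w 2 * coeff n (polygonSeries S w ^ t)) := by
  rw [← sum_big_eq hS, ncSum_eq_sum_univ, joinSum]
  set u : Finset (Fin (n + 1)) := {0, Fin.last n} with hu
  have h0n : (0 : Fin (n + 1)) ≠ Fin.last n := fun h => by
    have := congrArg Fin.val h
    simp at this
    omega
  have hucard : u.card = 2 := Finset.card_pair h0n
  have hbig : ∀ U : Finset (Fin (n + 1)), U.card ∈ S → 0 ∈ U → Fin.last n ∈ U → U ≠ u →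
      3 ≤ U.card := by
    intro U hU h0 hn' hne
    have hsub : u ⊆ U := by
      intro x hx
      rw [hu, Finset.mem_insert, Finset.mem_singleton] at hx
      rcases hx with rfl | rfl <;> assumption
    have := Finset.card_lt_card (Finset.ssubset_iff_subset_ne.2 ⟨hsub, hne.symm⟩)
    omega
  by_cases h2 : 2 ∈ S
  · rw [chordWeight, if_pos h2]
    have hcross : ∀ W : Finset (Fin (n + 1)), ¬ Cross W u := by
      intro W hW
      rw [cross_comm, cross_iff] at hW
      obtain ⟨a, ha, b, hb, p, -, q, -, ⟨h1, h2⟩, h3⟩ := hW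
      rw [hu, Finset.mem_insert, Finset.mem_singleton] at ha hb
      have hq := Fin.le_last q
      have hp := Fin.le_last p
      rcases ha with rfl | rfl
      · rcases hb with rfl | rfl
        · exact absurd (h1.trans h2) (lt_irrefl _)
        · rcases h3 with h3 | h3
          · exact absurd h3 (Fin.not_lt_zero q)
          · exact absurd h3 (not_lt.2 hq)
      · exact absurd h1 (not_lt.2 hp)
    have hQ : ∀ D : Configuration (n + 1), u ∉ D →
        ((NonCrossing (insert u D) ∧ IsFilling False S Finset.univ (insert u D)) ↔
          NonCrossing D ∧ IsFilling False S Finset.univ D) := by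
      intro D _
      simp only [isFilling_false, Finset.forall_mem_insert, hucard, h2, true_and]
      refine and_congr_left fun _ => ⟨fun h W hW V hV => h W (Finset.mem_insert_of_mem hW) V
        (Finset.mem_insert_of_mem hV), fun h W hW V hV hne => ?_⟩
      rw [Finset.mem_insert] at hW hV
      rcases hW with rfl | hW
      · exact fun h => hcross V (cross_comm.1 h)
      · rcases hV with rfl | hV
        · exact hcross W
        · exact h W hW V hV hne
    have hQ' : ∀ D : Configuration (n + 1), u ∉ D →
        (((NonCrossing (insert u D) ∧ IsFilling False S Finset.univ (insert u D)) ∧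
            ∃ U ∈ insert u D, 3 ≤ U.card ∧ 0 ∈ U ∧ Fin.last n ∈ U) ↔
          (NonCrossing D ∧ IsFilling False S Finset.univ D) ∧
            ∃ U ∈ D, 3 ≤ U.card ∧ 0 ∈ U ∧ Fin.last n ∈ U) := by
      intro D hD
      rw [hQ D hD, Finset.exists_mem_insert]
      refine and_congr_right fun _ => ⟨fun h => h.resolve_left fun h => ?_, Or.inr⟩
      rw [hucard] at h
      omega
    have e1 := sum_insert_toggle w u
      (fun D => NonCrossing D ∧ IsFilling False S Finset.univ D) hQ
    have e2 := sum_insert_toggle w u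
      (fun D => (NonCrossing D ∧ IsFilling False S Finset.univ D) ∧
        ∃ U ∈ D, 3 ≤ U.card ∧ 0 ∈ U ∧ Fin.last n ∈ U) hQ'
    rw [← Finset.sum_filter_add_sum_filter_not (Finset.univ.filter fun D : Configuration (n + 1) =>
      NonCrossing D ∧ IsFilling False S Finset.univ D) (fun D => u ∈ D)]
    rw [← Finset.sum_filter_add_sum_filter_not (Finset.univ.filter fun D : Configuration (n + 1) =>
      (NonCrossing D ∧ IsFilling False S Finset.univ D) ∧
        ∃ U ∈ D, 3 ≤ U.card ∧ 0 ∈ U ∧ Fin.last n ∈ U) (fun D => u ∈ D)]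
    rw [← Finset.sum_filter_add_sum_filter_not (Finset.univ.filter fun D : Configuration (n + 1) =>
      (NonCrossing D ∧ IsFilling False S Finset.univ D) ∧
        ∃ U ∈ D, 0 ∈ U ∧ Fin.last n ∈ U) (fun D => u ∈ D)]
    simp only [Finset.filter_filter]
    have e3 : (Finset.univ.filter fun D : Configuration (n + 1) =>
        ((NonCrossing D ∧ IsFilling False S Finset.univ D) ∧
          ∃ U ∈ D, 0 ∈ U ∧ Fin.last n ∈ U) ∧ u ∈ D) =
        Finset.univ.filter fun D : Configuration (n + 1) =>
        (NonCrossing D ∧ IsFilling False S Finset.univ D) ∧ u ∈ D := by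
      ext D
      simp only [Finset.mem_filter, Finset.mem_univ, true_and]
      exact ⟨fun h => ⟨h.1.1, h.2⟩, fun h => ⟨⟨h.1, u, h.2, by simp [hu], by simp [hu]⟩, h.2⟩⟩
    have e4 : (Finset.univ.filter fun D : Configuration (n + 1) =>
        ((NonCrossing D ∧ IsFilling False S Finset.univ D) ∧
          ∃ U ∈ D, 0 ∈ U ∧ Fin.last n ∈ U) ∧ u ∉ D) =
        Finset.univ.filter fun D : Configuration (n + 1) =>
        ((NonCrossing D ∧ IsFilling False S Finset.univ D) ∧
          ∃ U ∈ D, 3 ≤ U.card ∧ 0 ∈ U ∧ Fin.last n ∈ U) ∧ u ∉ D := by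
      ext D
      simp only [Finset.mem_filter, Finset.mem_univ, true_and]
      constructor
      · rintro ⟨⟨h, U, hU, h0, hl⟩, hD⟩
        exact ⟨⟨h, U, hU, hbig U (h.2.card_mem U hU) h0 hl fun h => hD (h ▸ hU), h0, hl⟩, hD⟩
      · rintro ⟨⟨h, U, hU, -, h0, hl⟩, hD⟩
        exact ⟨⟨h, U, hU, h0, hl⟩, hD⟩
    rw [e3, e4, e1, e2]
    ring
  · rw [chordWeight, if_neg h2, add_zero, one_mul, zero_mul, zero_add]
    refine Finset.sum_congr ?_ fun _ _ => rfl
    ext D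
    simp only [Finset.mem_filter, Finset.mem_univ, true_and]
    constructor
    · rintro ⟨h, U, hU, h0, hl⟩
      refine ⟨h, U, hU, hbig U (h.2.card_mem U hU) h0 hl fun h' => h2 ?_, h0, hl⟩
      rw [← hucard, ← h']
      exact h.2.card_mem U hU
    · rintro ⟨h, U, hU, -, h0, hl⟩
      exact ⟨h, U, hU, h0, hl⟩

end DiagramEquation

end ChordConfig

namespace ChordConfig

/-! ### Functional equation for noncrossing diagrams -/

section DiagramRecurrence

variable {n c : ℕ} {R : Type*} [CommRing R]

open Classical in
theorem sum_join_Iic_eq (S : Set ℕ) (w : R) (v : Fin (n + 1)) :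
    ∑ D ∈ (hyperSets S (Finset.Iic v)).powerset with
      NonCrossing D ∧ ∃ U ∈ D, 0 ∈ U ∧ v ∈ U, w ^ D.card = joinSum S w v := by
  set e : Fin ((v : ℕ) + 1) ↪o Fin (n + 1) := Fin.castLEOrderEmb v.2
  have hmap : Finset.univ.map e.toEmbedding = Finset.Iic v := by
    ext x
    simp only [Finset.mem_map, Finset.mem_univ, true_and, Finset.mem_Iic, Fin.le_def]
    constructor
    · rintro ⟨a, rfl⟩
      exact Nat.lt_succ_iff.1 a.2
    · exact fun h => ⟨⟨x, Nat.lt_succ_iff.2 h⟩, rfl⟩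
  have hjoin : ∀ D : Configuration ((v : ℕ) + 1),
      (∃ U ∈ mapConfig e.toEmbedding D, 0 ∈ U ∧ v ∈ U) ↔
        ∃ U ∈ D, 0 ∈ U ∧ Fin.last (v : ℕ) ∈ U := by
    intro D
    have key : ∀ U : Finset (Fin ((v : ℕ) + 1)),
        (0 ∈ U.map e.toEmbedding ∧ v ∈ U.map e.toEmbedding) ↔ 0 ∈ U ∧ Fin.last (v : ℕ) ∈ U := by
      intro U
      refine and_congr ?_ ?_
      · exact Finset.mem_map' (a := 0) e.toEmbedding
      · exact Finset.mem_map' (a := Fin.last (v : ℕ)) e.toEmbedding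
    constructor
    · rintro ⟨W, hW, h⟩
      obtain ⟨U, hU, rfl⟩ := mem_mapConfig.1 hW
      exact ⟨U, hU, (key U).1 h⟩
    · rintro ⟨U, hU, h⟩
      exact ⟨_, map_mem_mapConfig.2 hU, (key U).2 h⟩
  rw [joinSum, ← hmap]
  symm
  refine Finset.sum_bij (fun D _ => mapConfig e.toEmbedding D) ?_ ?_ ?_ ?_
  · intro D hD
    simp only [Finset.mem_filter, Finset.mem_univ, true_and, Finset.mem_powerset,
      mapConfig_subset_hyperSets, nonCrossing_mapConfig, hjoin] at hD ⊢
    exact ⟨fun W hW => mem_hyperSets.2 ⟨Finset.subset_univ _, hD.1.2.card_mem W hW⟩, hD.1.1, hD.2⟩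
  · exact fun D _ D' _ h => mapConfig_injective _ h
  · intro D hD
    obtain ⟨D', rfl⟩ := exists_mapConfig_eq (C := D) e fun U hU =>
      (mem_hyperSets.1 (Finset.mem_powerset.1 (Finset.mem_filter.1 hD).1 hU)).1
    refine ⟨D', ?_, rfl⟩
    simp only [Finset.mem_filter, Finset.mem_univ, true_and, Finset.mem_powerset,
      mapConfig_subset_hyperSets, nonCrossing_mapConfig, hjoin] at hD ⊢
    exact ⟨⟨hD.2.1, isFilling_false.2 fun W hW => (mem_hyperSets.1 (hD.1 hW)).2⟩, hD.2.2⟩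
  · intro D _
    rw [card_mapConfig]

/-- The point `v` is the last one that is joined to the first point by a hyperchord. -/
def IsFarthest (D : Configuration (n + 1)) (v : Fin (n + 1)) : Prop :=
  (∃ U ∈ D, 0 ∈ U ∧ v ∈ U) ∧ ∀ U ∈ D, 0 ∈ U → U ⊆ Finset.Iic v

theorem IsFarthest.eq {D : Configuration (n + 1)} {v v' : Fin (n + 1)} (h : IsFarthest D v)
    (h' : IsFarthest D v') : v = v' := by
  obtain ⟨⟨U, hU, h0, hv⟩, h2⟩ := h
  obtain ⟨⟨U', hU', h0', hv'⟩, h2'⟩ := h'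
  exact le_antisymm (Finset.mem_Iic.1 (h2' U hU h0 hv)) (Finset.mem_Iic.1 (h2 U' hU' h0' hv'))

theorem exists_isFarthest {D : Configuration (n + 1)} (hD : ∀ U ∈ D, 2 ≤ U.card)
    (h : ∃ U ∈ D, 0 ∈ U) : ∃ v, v ≠ 0 ∧ IsFarthest D v := by
  classical
  set T := (D.filter fun U => 0 ∈ U).biUnion id with hT
  have hmem : ∀ {v}, v ∈ T ↔ ∃ U ∈ D, 0 ∈ U ∧ v ∈ U := by
    intro v
    simp only [hT, Finset.mem_biUnion, Finset.mem_filter, id]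
    exact ⟨fun ⟨U, hU, hv⟩ => ⟨U, hU.1, hU.2, hv⟩, fun ⟨U, hU, h0, hv⟩ => ⟨U, ⟨hU, h0⟩, hv⟩⟩
  obtain ⟨U, hU, h0⟩ := h
  have hne : T.Nonempty := ⟨0, hmem.2 ⟨U, hU, h0, h0⟩⟩
  have hle : ∀ V ∈ D, 0 ∈ V → V ⊆ Finset.Iic (T.max' hne) := fun V hV h0V x hx =>
    Finset.mem_Iic.2 (T.le_max' x (hmem.2 ⟨V, hV, h0V, hx⟩))
  refine ⟨T.max' hne, fun hm => ?_, hmem.1 (T.max'_mem hne), hle⟩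
  have h1 : U ⊆ {0} := fun x hx => by
    have := hle U hU h0 hx
    rw [hm, Finset.mem_Iic] at this
    exact Finset.mem_singleton.2 (Fin.le_zero_iff.1 this)
  have h2 := Finset.card_le_card h1
  have h3 := hD U hU
  rw [Finset.card_singleton] at h2
  omega

/-- A hyperchord with vertices on both sides of `v` avoids the first point, as `v` is farthest. It
would then cross the chord from the first point to `v`. -/
theorem subset_Iic_or_subset_Ici {D : Configuration (n + 1)} (hD : NonCrossing D)
    {v : Fin (n + 1)} (hv : IsFarthest D v) {W : Finset (Fin (n + 1))}
    (hW : W ∈ D) : W ⊆ Finset.Iic v ∨ W ⊆ Finset.Ici v := by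
  by_contra! h
  obtain ⟨⟨U, hU, h0, hvU⟩, hle⟩ := hv
  obtain ⟨y, hy, hyv⟩ := Finset.not_subset.1 h.1
  obtain ⟨x, hx, hxv⟩ := Finset.not_subset.1 h.2
  rw [Finset.mem_Iic, not_le] at hyv
  rw [Finset.mem_Ici, not_le] at hxv
  have h0W : 0 ∉ W := fun h0W => absurd (Finset.mem_Iic.1 (hle W hW h0W hy)) (not_le.2 hyv)
  have hx0 : 0 < x := Fin.pos_iff_ne_zero.2 fun h => h0W (h ▸ hx)
  refine hD U hU W hW (fun h => h0W (h ▸ h0)) (cross_iff.2 ?_)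
  exact ⟨0, h0, v, hvU, x, hx, y, hy, ⟨hx0, hxv⟩, Or.inr hyv⟩

theorem not_cross_of_Iic_Ici {v : Fin n} {W W' : Finset (Fin n)}
    (hW : W ⊆ Finset.Iic v) (hW' : W' ⊆ Finset.Ici v) : ¬ Cross W W' := by
  rw [cross_iff]
  rintro ⟨a, ha, b, hb, p, hp, q, hq, ⟨h1, h2⟩, -⟩
  exact absurd ((Finset.mem_Iic.1 (hW hb)).trans (Finset.mem_Ici.1 (hW' hp))) (not_le.2 h2)

open Classical in
-- The diagram splits at `v` into two independent parts that share only this point. As sizes are at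
-- least two, no hyperchord belongs to both.
theorem sum_isFarthest_eq {S : Set ℕ} (hS : ∀ s ∈ S, 2 ≤ s) (w : R) {v : Fin (n + 1)}
    (hv : v ≠ 0) :
    ∑ D ∈ (hyperSets S (Finset.univ : Finset (Fin (n + 1)))).powerset with
      NonCrossing D ∧ IsFarthest D v, w ^ D.card =
    joinSum S w v * ncSum False S w (n + 1 - v) := by
  have hdis : Disjoint (hyperSets S (Finset.Iic v)) (hyperSets S (Finset.Ici v)) := by
    rw [Finset.disjoint_left]
    intro W hW hW'
    rw [mem_hyperSets] at hW hW'
    have h1 : W ⊆ {v} := fun x hx => Finset.mem_singleton.2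
      (le_antisymm (Finset.mem_Iic.1 (hW.1 hx)) (Finset.mem_Ici.1 (hW'.1 hx)))
    have h2 := Finset.card_le_card h1
    have h3 := hS _ hW.2
    rw [Finset.card_singleton] at h2
    omega
  have h0 : ∀ W ⊆ Finset.Ici v, (0 : Fin (n + 1)) ∉ W := fun W hW h =>
    hv (Fin.le_zero_iff.1 (Finset.mem_Ici.1 (hW h)))
  have key : ∀ D₁ ⊆ hyperSets S (Finset.Iic v), ∀ D₂ ⊆ hyperSets S (Finset.Ici v),
      ((NonCrossing (D₁ ∪ D₂) ∧ ∃ U ∈ D₁ ∪ D₂, 0 ∈ U ∧ v ∈ U) ↔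
        (NonCrossing D₁ ∧ ∃ U ∈ D₁, 0 ∈ U ∧ v ∈ U) ∧ NonCrossing D₂) := by
    intro D₁ h₁ D₂ h₂
    rw [nonCrossing_union (fun W hW W' hW' => not_cross_of_Iic_Ici (mem_hyperSets.1 hW).1
      (mem_hyperSets.1 hW').1) h₁ h₂]
    constructor
    · rintro ⟨h, U, hU, hU0, hUv⟩
      refine ⟨⟨h.1, U, ?_, hU0, hUv⟩, h.2⟩
      rcases Finset.mem_union.1 hU with hU | hU
      · exact hU
      · exact absurd hU0 (h0 U (mem_hyperSets.1 (h₂ hU)).1)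
    · rintro ⟨⟨h, U, hU, hU0, hUv⟩, h'⟩
      exact ⟨⟨h, h'⟩, U, Finset.mem_union_left _ hU, hU0, hUv⟩
  have h := sum_powerset_union w hdis (P := fun D => NonCrossing D ∧ ∃ U ∈ D, 0 ∈ U ∧ v ∈ U)
    (P₁ := fun D => NonCrossing D ∧ ∃ U ∈ D, 0 ∈ U ∧ v ∈ U) (P₂ := NonCrossing) key
  rw [sum_join_Iic_eq, ← ncSumOn_false_eq, ncSumOn_eq, Fin.card_Ici] at h
  rw [← h]
  refine Finset.sum_congr ?_ fun _ _ => rfl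
  ext D
  simp only [Finset.mem_filter, Finset.mem_powerset]
  constructor
  · rintro ⟨hD, hnc, hf⟩
    refine ⟨fun W hW => ?_, hnc, hf.1⟩
    rw [Finset.mem_union, mem_hyperSets, mem_hyperSets]
    have hWS := (mem_hyperSets.1 (hD hW)).2
    rcases subset_Iic_or_subset_Ici hnc hf hW with h | h
    · exact Or.inl ⟨h, hWS⟩
    · exact Or.inr ⟨h, hWS⟩
  · rintro ⟨hD, hnc, hf⟩
    refine ⟨fun W hW => ?_, hnc, hf, fun W hW hW0 => ?_⟩
    · rcases Finset.mem_union.1 (hD hW) with h | h <;>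
        exact mem_hyperSets.2 ⟨Finset.subset_univ _, (mem_hyperSets.1 h).2⟩
    · rcases Finset.mem_union.1 (hD hW) with h | h
      · exact (mem_hyperSets.1 h).1
      · exact absurd hW0 (h0 W (mem_hyperSets.1 h).1)

/-- Either the first point is isolated and is removed, or the diagram splits at the farthest point
joined to it. -/
theorem ncSum_diagram_succ {S : Set ℕ} (hS : ∀ s ∈ S, 2 ≤ s) (w : R) (n : ℕ) :
    ncSum False S w (n + 1) = ncSum False S w n +
      ∑ v ∈ Finset.range n, joinSum S w (v + 1) * ncSum False S w (n - v) := by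
  classical
  have h1 : ncSum False S w n =
      ∑ D ∈ (hyperSets S (Finset.univ : Finset (Fin (n + 1)))).powerset with
        NonCrossing D ∧ ¬ ∃ U ∈ D, 0 ∈ U, w ^ D.card := by
    have hc : (Finset.univ.erase (0 : Fin (n + 1))).card = n := by simp
    conv_lhs => rw [← hc, ← ncSumOn_eq, ncSumOn_false_eq]
    refine Finset.sum_congr ?_ fun _ _ => rfl
    ext D
    simp only [Finset.mem_filter, Finset.mem_powerset]
    constructor
    · rintro ⟨hD, hnc⟩
      refine ⟨fun W hW => mem_hyperSets.2 ⟨Finset.subset_univ _, (mem_hyperSets.1 (hD hW)).2⟩,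
        hnc, ?_⟩
      rintro ⟨W, hW, h0⟩
      exact Finset.notMem_erase _ _ ((mem_hyperSets.1 (hD hW)).1 h0)
    · rintro ⟨hD, hnc, h⟩
      refine ⟨fun W hW => mem_hyperSets.2 ⟨fun x hx => ?_, (mem_hyperSets.1 (hD hW)).2⟩, hnc⟩
      exact Finset.mem_erase.2 ⟨fun h0 => h ⟨W, hW, h0 ▸ hx⟩, Finset.mem_univ _⟩
  have h2 : ∑ D ∈ (hyperSets S (Finset.univ : Finset (Fin (n + 1)))).powerset with
        NonCrossing D ∧ ∃ U ∈ D, 0 ∈ U, w ^ D.card =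
      ∑ v : Fin (n + 1) with v ≠ 0, joinSum S w v * ncSum False S w (n + 1 - v) := by
    rw [Finset.sum_congr rfl fun v hv =>
      (sum_isFarthest_eq hS w (Finset.mem_filter.1 hv).2).symm, ← Finset.sum_biUnion]
    · refine Finset.sum_congr ?_ fun _ _ => rfl
      ext D
      simp only [Finset.mem_filter, Finset.mem_powerset, Finset.mem_biUnion, Finset.mem_univ,
        true_and]
      constructor
      · rintro ⟨hD, hnc, h⟩
        obtain ⟨v, hv, hf⟩ :=
          exists_isFarthest (fun U hU => hS _ (mem_hyperSets.1 (hD hU)).2) h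
        exact ⟨v, hv, hD, hnc, hf⟩
      · rintro ⟨v, hv, hD, hnc, ⟨U, hU, h0, -⟩, -⟩
        exact ⟨hD, hnc, U, hU, h0⟩
    · intro v _ v' _ hne
      simp only [Function.onFun]
      rw [Finset.disjoint_left]
      intro D hD hD'
      simp only [Finset.mem_filter] at hD hD'
      exact hne (hD.2.2.eq hD'.2.2)
  have h3 : ∑ v : Fin (n + 1) with v ≠ 0, joinSum S w v * ncSum False S w (n + 1 - v) =
      ∑ v ∈ Finset.range n, joinSum S w (v + 1) * ncSum False S w (n - v) := by
    rw [Finset.sum_filter, Fin.sum_univ_succ, if_neg (fun h => h rfl), zero_add,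
      ← Fin.sum_univ_eq_sum_range fun v => joinSum S w (v + 1) * ncSum False S w (n - v)]
    refine Finset.sum_congr rfl fun v _ => ?_
    rw [if_pos (Fin.succ_ne_zero v), Fin.val_succ, Nat.add_sub_add_right]
  rw [← h3, ← h2, h1, ncSum, ncSumOn_false_eq]
  simp only [← Finset.filter_filter]
  rw [Finset.sum_filter_not_add_sum_filter]

theorem ncSum_diagram_zero {S : Set ℕ} (hS : ∀ s ∈ S, 2 ≤ s) (w : R) :
    ncSum False S w 0 = 1 := by
  classical
  have : hyperSets S (Finset.univ : Finset (Fin 0)) = ∅ := by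
    ext W
    rw [mem_hyperSets]
    simp [Finset.eq_empty_of_isEmpty W, zero_notMem_of_two_le hS]
  rw [ncSum, ncSumOn_false_eq, this, Finset.powerset_empty, Finset.sum_filter,
    Finset.sum_singleton, if_pos]
  · simp
  · simp [NonCrossing]

theorem ncSum_diagram_one {S : Set ℕ} (hS : ∀ s ∈ S, 2 ≤ s) (w : R) :
    ncSum False S w 1 = 1 := by
  rw [ncSum_diagram_succ hS, ncSum_diagram_zero hS, Finset.range_zero, Finset.sum_empty, add_zero]

theorem ncSum_diagram_two {S : Set ℕ} (hS : ∀ s ∈ S, 2 ≤ s) (w : R) :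
    ncSum False S w 2 = 1 + chordWeight S w := by
  classical
  have h1 := ncSum_diagram_succ hS w 1
  have h2 := one_add_mul_joinSum hS w (le_refl 1)
  rw [Finset.sum_eq_zero, add_zero] at h2
  · rw [Finset.sum_range_one, ncSum_diagram_one hS] at h1
    simp only [zero_add, mul_one] at h1
    linear_combination (1 + chordWeight S w) * h1 + h2
  · intro t ht
    simp only [Finset.mem_filter, Finset.mem_range] at ht
    omega

open Classical in
/-- The generating function `∑ t ^ (s - 1)`, over the sizes `s ≥ 3` in `S`. -/
noncomputable def shiftedSeries (S : Set ℕ) : ℚ⟦X⟧ :=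
  PowerSeries.mk fun t => if t + 1 ∈ S ∧ 2 ≤ t then 1 else 0

theorem constantCoeff_polygonSeries (S : Set ℕ) (w : R) :
    constantCoeff (polygonSeries S w) = 0 := by
  simp [polygonSeries]

theorem coeff_succ_polygonSeries (S : Set ℕ) (w : R) (m : ℕ) :
    coeff (m + 1) (polygonSeries S w) = ncSum False S w (m + 2) := by
  rw [polygonSeries, coeff_succ_X_mul, coeff_mk]

/-- The added 1 is the unique diagram on a single point. -/
theorem one_add_polygonSeries {S : Set ℕ} (hS : ∀ s ∈ S, 2 ≤ s) (w : R) :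
    1 + polygonSeries S w = PowerSeries.mk fun m => ncSum False S w (m + 1) := by
  ext m
  rw [coeff_mk, map_add, coeff_one]
  cases m with
  | zero => simp [constantCoeff_polygonSeries, ncSum_diagram_one hS]
  | succ m => rw [coeff_succ_polygonSeries, if_neg (Nat.succ_ne_zero m), zero_add]

/-- Eliminate the join series `J` between two relations: the splitting at the farthest point (`e1`)
and the description of joined diagrams by their outer hyperchord (`e2`). -/
theorem polygonSeries_eq [Algebra ℚ R] {S : Set ℕ} (hS : ∀ s ∈ S, 2 ≤ s) (w : R) :
    PowerSeries.C (1 + chordWeight S w) * polygonSeries S w = (1 + polygonSeries S w) *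
      (PowerSeries.C (1 + chordWeight S w) * (X + PowerSeries.C w *
        (shiftedSeries S).subst (polygonSeries S w)) +
        PowerSeries.C (chordWeight S w) * polygonSeries S w) := by
  classical
  set A := polygonSeries S w with hA
  have hA0 : constantCoeff A = 0 := constantCoeff_polygonSeries S w
  have hAcoeff : ∀ m, coeff (m + 1) A = ncSum False S w (m + 2) := coeff_succ_polygonSeries S w
  have h1A : 1 + A = PowerSeries.mk fun m => ncSum False S w (m + 1) := one_add_polygonSeries hS w
  set J : R⟦X⟧ := X * PowerSeries.mk fun m => joinSum S w (m + 1) with hJ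
  have e1 : A = (1 + A) * (X + J) := by
    have : A = (X * (1 + A)) + X * ((PowerSeries.mk fun m => joinSum S w (m + 1)) * (1 + A)) := by
      rw [h1A]
      ext m
      cases m with
      | zero => simp [hA0]
      | succ m =>
        rw [hAcoeff, map_add, coeff_succ_X_mul, coeff_succ_X_mul, coeff_mk, coeff_mul,
          Finset.Nat.sum_antidiagonal_eq_sum_range_succ_mk, ncSum_diagram_succ hS]
        congr 1
        refine Finset.sum_congr rfl fun v hv => ?_
        rw [coeff_mk, coeff_mk]
        rw [Finset.mem_range] at hv
        congr 2
        omega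
    rw [hJ]
    linear_combination this
  have e2 : PowerSeries.C (1 + chordWeight S w) * J = PowerSeries.C (chordWeight S w) * A +
      PowerSeries.C (w * (1 + chordWeight S w)) * (shiftedSeries S).subst A := by
    ext m
    rw [coeff_C_mul, map_add, coeff_C_mul, coeff_C_mul,
      coeff_subst_eq_sum hA0 _ (Nat.lt_succ_self m)]
    cases m with
    | zero => simp [hJ, hA0, shiftedSeries]
    | succ m =>
      rw [hAcoeff, hJ, coeff_succ_X_mul, coeff_mk, one_add_mul_joinSum hS w (Nat.succ_pos m),
        Finset.sum_filter, Finset.mul_sum]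
      congr 1
      refine Finset.sum_congr rfl fun t _ => ?_
      rw [shiftedSeries, coeff_mk, ncSum_diagram_two hS]
      split_ifs
      · rw [one_smul, mul_assoc]
      · simp
  rw [map_mul] at e2
  linear_combination PowerSeries.C (1 + chordWeight S w) * e1 + (1 + A) * e2

end DiagramRecurrence

end ChordConfig

namespace ChordConfig

/-! ### Closure properties of rational functions of given elements -/

section RationalFunctions

theorem polynomial_aeval_mem {A : Type*} [CommRing A] [Algebra ℚ A] {M : Subalgebra ℚ A}
    {f : A} (hf : f ∈ M) (P : Polynomial ℚ) :
    Polynomial.aeval f P ∈ M := by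
  rw [Polynomial.aeval_eq_sum_range]
  exact sum_mem fun i _ => Subalgebra.smul_mem _ (pow_mem hf i) _

variable {A ι : Type*} [CommRing A] [IsDomain A] [Algebra ℚ A]

/-- The rational functions of the elements `g i`. -/
def rationalFunctions (g : ι → A) : Subalgebra ℚ A where
  carrier := {f | IsRationalFunctionOf f g}
  algebraMap_mem' r := ⟨MvPolynomial.C r, 1, by simp, by simp⟩
  add_mem' := by
    rintro f f' ⟨p, q, h0, h⟩ ⟨p', q', h0', h'⟩
    refine ⟨q' * p + q * p', q * q', by simpa using ⟨h0, h0'⟩, ?_⟩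
    simp only [map_mul, map_add]
    linear_combination MvPolynomial.aeval g q' * h + MvPolynomial.aeval g q * h'
  mul_mem' := by
    rintro f f' ⟨p, q, h0, h⟩ ⟨p', q', h0', h'⟩
    refine ⟨p * p', q * q', by simpa using ⟨h0, h0'⟩, ?_⟩
    simp only [map_mul]
    rw [← h, ← h']
    ring

variable {g : ι → A}

theorem mem_rationalFunctions {f : A} :
    f ∈ rationalFunctions g ↔ IsRationalFunctionOf f g := Iff.rfl

theorem aeval_mem_rationalFunctions (g : ι → A) (p : MvPolynomial ι ℚ) :
    MvPolynomial.aeval g p ∈ rationalFunctions g :=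
  ⟨p, 1, by simp, by simp⟩

theorem apply_mem_rationalFunctions (g : ι → A) (i : ι) : g i ∈ rationalFunctions g := by
  simpa using aeval_mem_rationalFunctions g (MvPolynomial.X i)

/-- Closure under those divisions that are possible inside the domain; this is how every nontrivial
membership is obtained. -/
theorem mem_rationalFunctions_of_mul {a b f : A} (ha : a ∈ rationalFunctions g)
    (hb : b ∈ rationalFunctions g) (ha0 : a ≠ 0) (h : a * f = b) :
    f ∈ rationalFunctions g := by
  obtain ⟨p, q, h0, h1⟩ := ha
  obtain ⟨p', q', h0', h1'⟩ := hb
  refine ⟨q * p', q' * p, ?_, ?_⟩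
  · rw [map_mul, ← h1]
    exact mul_ne_zero h0' (mul_ne_zero h0 ha0)
  · rw [map_mul, map_mul, ← h1, ← h1', ← h]
    ring

/-- Polynomials in the generators follow from the product rule. For quotients, differentiate `q * f
= p` and solve for `D f`. -/
theorem derivation_mem_rationalFunctions (D : Derivation ℚ A A)
    (hD : ∀ i, D (g i) ∈ rationalFunctions g) {f : A} (hf : f ∈ rationalFunctions g) :
    D f ∈ rationalFunctions g := by
  have key : ∀ p : MvPolynomial ι ℚ, D (MvPolynomial.aeval g p) ∈ rationalFunctions g := by
    intro p
    induction p using MvPolynomial.induction_on with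
    | C r =>
      rw [MvPolynomial.aeval_C, D.map_algebraMap]
      exact zero_mem _
    | add p q hp hq =>
      rw [map_add, map_add]
      exact add_mem hp hq
    | mul_X p i hp =>
      rw [map_mul, MvPolynomial.aeval_X, D.leibniz, smul_eq_mul, smul_eq_mul]
      exact add_mem (mul_mem (aeval_mem_rationalFunctions g p) (hD i))
        (mul_mem (apply_mem_rationalFunctions g i) hp)
  obtain ⟨p, q, h0, h⟩ := id hf
  have h' := congrArg D h
  rw [D.leibniz, smul_eq_mul, smul_eq_mul] at h'
  refine mem_rationalFunctions_of_mul (aeval_mem_rationalFunctions g q)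
    (b := D (MvPolynomial.aeval g p) - f * D (MvPolynomial.aeval g q))
    (sub_mem (key p) (mul_mem hf (key q))) h0 ?_
  rw [← h']
  ring

end RationalFunctions

/-! ### Reduction of rationality to the noncrossing series -/

section ClosedUnderDerivative

variable {R ι : Type*} [CommRing R] [Algebra ℚ R] {g : ι → R⟦X⟧}

/-- The derivative of power series, as a derivation over the rational numbers. -/
noncomputable def ratDerivative (R : Type*) [CommRing R] [Algebra ℚ R] :
    Derivation ℚ R⟦X⟧ R⟦X⟧ := (derivative R).restrictScalars ℚ

theorem iterate_derivative_mem {M : Subalgebra ℚ R⟦X⟧} (hD : ∀ f ∈ M, derivative R f ∈ M)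
    (d : ℕ) {f : R⟦X⟧} (hf : f ∈ M) : (derivative R)^[d] f ∈ M := by
  induction d generalizing f with
  | zero => exact hf
  | succ d ih => exact ih (hD f hf)

theorem regionSeries_mem {M : Subalgebra ℚ R⟦X⟧} (hD : ∀ f ∈ M, derivative R f ∈ M)
    (hX : X ∈ M) {f : R⟦X⟧} (hf : f ∈ M) (i : ℕ) : regionSeries f i ∈ M :=
  Subalgebra.smul_mem _ (mul_mem (pow_mem hX i)
    (iterate_derivative_mem hD _ (mul_mem (pow_mem hX _) hf))) _

theorem genSeries_partition_mem {M : Subalgebra ℚ R⟦X⟧} (hD : ∀ f ∈ M, derivative R f ∈ M)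
    (hX : X ∈ M) {S : Set ℕ} (hS : 0 ∉ S) {w : R} (hw : PowerSeries.C w ∈ M)
    (h0 : genSeries True S w 0 ∈ M) (k : ℕ) : genSeries True S w k ∈ M := by
  rcases Nat.eq_zero_or_pos k with rfl | hk
  · exact h0
  · rw [genSeries_partition hS w hk, xDiff]
    refine mul_mem hX (hD _ (sum_mem fun K _ => mul_mem (mul_mem (algebraMap_mem M _)
      (pow_mem hw _)) (prod_mem fun i _ => pow_mem (regionSeries_mem hD hX h0 i) _)))

theorem C_ncSum_mem {M : Subalgebra ℚ R⟦X⟧} {w : R} (hw : PowerSeries.C w ∈ M) (part : Prop)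
    (S : Set ℕ) (N : ℕ) : PowerSeries.C (ncSum part S w N) ∈ M := by
  rw [ncSum, ncSumOn, map_sum]
  refine sum_mem fun D _ => ?_
  rw [map_pow]
  exact pow_mem hw _

theorem C_pointFactor_mem {M : Subalgebra ℚ R⟦X⟧} {w : R} (hw : PowerSeries.C w ∈ M)
    (S : Set ℕ) : PowerSeries.C (pointFactor S w) ∈ M := by
  unfold pointFactor
  split_ifs
  · rw [map_add, map_one]
    exact add_mem (one_mem M) hw
  · rw [map_one]
    exact one_mem M

theorem C_chordWeight_mem {M : Subalgebra ℚ R⟦X⟧} {w : R} (hw : PowerSeries.C w ∈ M)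
    (S : Set ℕ) : PowerSeries.C (chordWeight S w) ∈ M := by
  unfold chordWeight
  split_ifs
  · exact hw
  · rw [map_zero]
    exact zero_mem M

theorem trunc_mem {M : Subalgebra ℚ R⟦X⟧} (hX : X ∈ M) {f : R⟦X⟧}
    (hf : ∀ n, PowerSeries.C (coeff n f) ∈ M) (p : ℕ) :
    ((trunc p f : Polynomial R) : R⟦X⟧) ∈ M := by
  induction p with
  | zero =>
    rw [trunc_zero', Polynomial.coe_zero]
    exact zero_mem M
  | succ p ih =>
    rw [trunc_succ, ← Polynomial.C_mul_X_pow_eq_monomial, Polynomial.coe_add, Polynomial.coe_mul,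
      Polynomial.coe_C, Polynomial.coe_pow, Polynomial.coe_X]
    exact add_mem ih (mul_mem (hf p) (pow_mem hX p))

/-- The truncation is a polynomial in `X` whose coefficients are members by assumption, and the tail
quotient arises by dividing the difference by a power of `X`. -/
theorem regionSeriesPeaks_mem [IsDomain R]
    (hD : ∀ f ∈ rationalFunctions g, derivative R f ∈ rationalFunctions g)
    (hX : X ∈ rationalFunctions g) {f : R⟦X⟧} (hf : f ∈ rationalFunctions g)
    (hfc : ∀ n, PowerSeries.C (coeff n f) ∈ rationalFunctions g) (i j : ℕ) :
    regionSeriesPeaks f i j ∈ rationalFunctions g := by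
  unfold regionSeriesPeaks
  split_ifs
  · exact hfc j
  · refine Subalgebra.smul_mem _ (mul_mem (pow_mem hX i) (iterate_derivative_mem hD _ ?_)) _
    refine mem_rationalFunctions_of_mul (pow_mem hX (i + j + 1))
      (sub_mem hf (trunc_mem hX hfc _)) (pow_ne_zero _ X_ne_zero)
      (X_pow_mul_tailQuotient f (i + j))

theorem genSeries_diagram_mem [IsDomain R]
    (hD : ∀ f ∈ rationalFunctions g, derivative R f ∈ rationalFunctions g)
    (hX : X ∈ rationalFunctions g) {S : Set ℕ} (hS : 0 ∉ S) {w r : R}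
    (hr : r * pointFactor S w = 1) (hw : PowerSeries.C w ∈ rationalFunctions g)
    (h0 : genSeries False S w 0 ∈ rationalFunctions g) (k : ℕ) :
    genSeries False S w k ∈ rationalFunctions g := by
  have hrM : PowerSeries.C r ∈ rationalFunctions g := by
    have hr' : PowerSeries.C (pointFactor S w) * PowerSeries.C r = (1 : R⟦X⟧) := by
      rw [← map_mul, mul_comm, hr, map_one]
    exact mem_rationalFunctions_of_mul (C_pointFactor_mem hw S) (one_mem _)
      (left_ne_zero_of_mul_eq_one hr') hr'
  have hc : ∀ n, PowerSeries.C (coeff n (genSeries False S w 0)) ∈ rationalFunctions g := by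
    intro n
    rw [coeff_zero_genSeries_zero]
    exact C_ncSum_mem hw _ _ _
  rcases Nat.eq_zero_or_pos k with rfl | hk
  · exact h0
  · rw [genSeries_diagram hS w hr hk, xDiff]
    refine mul_mem hX (hD _ (sum_mem fun K _ => mul_mem (mul_mem (algebraMap_mem _ _)
      (pow_mem hw _)) (prod_mem fun i _ => prod_mem fun j _ => pow_mem ?_ _)))
    rw [map_pow]
    exact mul_mem (pow_mem hrM _) (regionSeriesPeaks_mem hD hX h0 hc i j)

theorem constantCoeff_aeval {f : R⟦X⟧} (hf : constantCoeff f = 0) (P : Polynomial ℚ) :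
    constantCoeff (Polynomial.aeval f P) = algebraMap ℚ R (P.coeff 0) := by
  have h := Polynomial.aeval_algHom_apply (constantCoeff (R := R)).toRatAlgHom f P
  rw [RingHom.toRatAlgHom_apply, RingHom.toRatAlgHom_apply, hf,
    ← Polynomial.coeff_zero_eq_aeval_zero'] at h
  exact h.symm

theorem subst_coe_eq {f : R⟦X⟧} (hf : constantCoeff f = 0) (P : Polynomial ℚ) :
    (P : ℚ⟦X⟧).subst f = Polynomial.aeval f P :=
  subst_coe (HasSubst.of_constantCoeff_zero' hf) P

theorem subst_mul_eq {f : R⟦X⟧} (hf : constantCoeff f = 0) {P Q : Polynomial ℚ} {φ : ℚ⟦X⟧}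
    (h : (Q : ℚ⟦X⟧) * φ = P) : Polynomial.aeval f Q * φ.subst f = Polynomial.aeval f P := by
  rw [← subst_coe_eq hf, ← subst_coe_eq hf, ← h]
  exact (subst_mul (HasSubst.of_constantCoeff_zero' hf) _ _).symm

end ClosedUnderDerivative

/-! ### Rational series attached to eventually periodic sets of sizes -/

section Periodic

/-- Membership in `S` is periodic from some point on. -/
def EventuallyPeriodic (S : Set ℕ) : Prop :=
  ∃ N p : ℕ, 1 ≤ p ∧ ∀ s, N ≤ s → (s + p ∈ S ↔ s ∈ S)

theorem eventuallyPeriodic_of_finite {S : Set ℕ} (hS : S.Finite) : EventuallyPeriodic S := by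
  obtain ⟨M, hM⟩ := hS.bddAbove
  refine ⟨M + 1, 1, le_refl 1, fun s hs => ?_⟩
  constructor
  · intro h
    have := hM h
    omega
  · intro h
    have := hM h
    omega

theorem eventuallyPeriodic_of_ultimatelyPeriodic {S : Set ℕ} (hS : UltimatelyPeriodic S) :
    EventuallyPeriodic S := by
  obtain ⟨A, B, p, -, -, hp, rfl⟩ := hS
  refine ⟨A.sup id + B.sup id + 1, p, hp, fun s hs => ?_⟩
  have hA : ∀ a ∈ A, a ≤ A.sup id := fun a ha => Finset.le_sup (f := id) ha
  have hB : ∀ b ∈ B, b ≤ B.sup id := fun b hb => Finset.le_sup (f := id) hb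
  simp only [Set.mem_union, Finset.mem_coe, Set.mem_iUnion, Set.mem_ofPred_eq, exists_prop]
  constructor
  · rintro (h | ⟨b, hb, u, hu⟩)
    · have := hA _ h
      omega
    · have := hB b hb
      cases u with
      | zero => omega
      | succ u =>
        rw [add_mul, one_mul] at hu
        exact Or.inr ⟨b, hb, u, by omega⟩
  · rintro (h | ⟨b, hb, u, hu⟩)
    · have := hA _ h
      omega
    · exact Or.inr ⟨b, hb, u + 1, by rw [add_mul, one_mul]; omega⟩

/-- Multiplication by `1 - X ^ p` annihilates all coefficients from degree `N + p` on. -/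
theorem exists_polynomial_of_periodic {f : ℚ⟦X⟧} {N p : ℕ} (hp : 1 ≤ p)
    (hf : ∀ s, N ≤ s → coeff (s + p) f = coeff s f) :
    ∃ P Q : Polynomial ℚ, Q.coeff 0 = 1 ∧ (Q : ℚ⟦X⟧) * f = P := by
  refine ⟨trunc (N + p) ((1 - X ^ p) * f), 1 - Polynomial.X ^ p, ?_, ?_⟩
  · rw [Polynomial.coeff_sub, Polynomial.coeff_one_zero, Polynomial.coeff_X_pow,
      if_neg (by omega), sub_zero]
  · rw [Polynomial.coe_sub, Polynomial.coe_one, Polynomial.coe_pow, Polynomial.coe_X]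
    ext n
    rw [Polynomial.coeff_coe, coeff_trunc]
    split_ifs with h
    · rfl
    · obtain ⟨s, rfl⟩ : ∃ s, n = s + p := ⟨n - p, by omega⟩
      rw [sub_mul, one_mul, map_sub, coeff_X_pow_mul, hf s (by omega), sub_self]

theorem EventuallyPeriodic.bigSizes {S : Set ℕ} (hS : EventuallyPeriodic S) :
    EventuallyPeriodic (bigSizes S) := by
  obtain ⟨N, p, hp, h⟩ := hS
  refine ⟨N + 2, p, hp, fun s hs => ?_⟩
  exact and_congr (h s (by omega)) ⟨fun _ => by omega, fun _ => by omega⟩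

theorem EventuallyPeriodic.indicatorSeries {S : Set ℕ} (hS : EventuallyPeriodic S) :
    ∃ P Q : Polynomial ℚ, Q.coeff 0 = 1 ∧ (Q : ℚ⟦X⟧) * indicatorSeries S = P := by
  obtain ⟨N, p, hp, h⟩ := hS
  refine exists_polynomial_of_periodic (N := N) hp fun s hs => ?_
  classical
  rw [ChordConfig.indicatorSeries, coeff_mk, coeff_mk]
  exact if_congr (h s hs) rfl rfl

theorem EventuallyPeriodic.shiftedSeries {S : Set ℕ} (hS : EventuallyPeriodic S) :
    ∃ P Q : Polynomial ℚ, Q.coeff 0 = 1 ∧ (Q : ℚ⟦X⟧) * shiftedSeries S = P := by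
  obtain ⟨N, p, hp, h⟩ := hS
  refine exists_polynomial_of_periodic (N := N + 2) hp fun s hs => ?_
  have h1 : s + p + 1 ∈ S ↔ s + 1 ∈ S := by
    rw [show s + p + 1 = s + 1 + p by ring]
    exact h (s + 1) (by omega)
  have h2 : 2 ≤ s + p ↔ 2 ≤ s := ⟨fun _ => by omega, fun _ => by omega⟩
  classical
  rw [ChordConfig.shiftedSeries, coeff_mk, coeff_mk]
  exact if_congr (and_congr h1 h2) rfl rfl

end Periodic

end ChordConfig

namespace ChordConfig

theorem ne_zero_of_constantCoeff_eq_one {R : Type*} [CommRing R] [Nontrivial R] {f : R⟦X⟧}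
    (h : constantCoeff f = 1) : f ≠ 0 := by
  rintro rfl
  exact zero_ne_one ((map_zero _).symm.trans h)

/-! ### Rationality for partitions -/

section PartitionRational

variable {R : Type*} [CommRing R] [IsDomain R] [Algebra ℚ R]

/-- With B = XF the functional equation reads Q(B)(F - 1) = w P(B). It is linear in `w`, which can
be eliminated, and its derivative is linear in F'. -/
theorem genSeries_partition_rational {S : Set ℕ} (hne : S.Nonempty) (hS : 0 ∉ S)
    (hper : EventuallyPeriodic S) {w : R} (hw : w ≠ 0) (k : ℕ) :
    IsRationalFunctionOf (genSeries True S w k) ![genSeries True S w 0, X] := by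
  obtain ⟨P, Q, hQ0, hPQ⟩ := hper.indicatorSeries
  set F := genSeries True S w 0 with hF
  set g : Fin 2 → R⟦X⟧ := ![F, X] with hg
  have hFM : F ∈ rationalFunctions g := apply_mem_rationalFunctions g 0
  have hXM : X ∈ rationalFunctions g := apply_mem_rationalFunctions g 1
  set B := X * F with hB
  have hBM : B ∈ rationalFunctions g := mul_mem hXM hFM
  have hB0 : constantCoeff B = 0 := by simp [hB]
  have heq : F = 1 + PowerSeries.C w * (indicatorSeries S).subst B :=
    genSeries_partition_zero_eq hS w
  have hsub := subst_mul_eq hB0 hPQ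
  have hrel : Polynomial.aeval B Q * (F - 1) = PowerSeries.C w * Polynomial.aeval B P := by
    linear_combination Polynomial.aeval B Q * heq + PowerSeries.C w * hsub
  have hQc : constantCoeff (Polynomial.aeval B Q) = 1 := by
    rw [constantCoeff_aeval hB0, hQ0, map_one]
  -- Otherwise F = 1 and B = X, and the equation would make the size series of the nonempty set `S`
  -- vanish.
  have hPne : Polynomial.aeval B P ≠ 0 := by
    intro h0
    rw [h0, mul_zero] at hrel
    have hF1 : F = 1 := sub_eq_zero.1
      ((mul_eq_zero.1 hrel).resolve_left (ne_zero_of_constantCoeff_eq_one hQc))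
    have hBX : B = X := by rw [hB, hF1, mul_one]
    rw [hF1, left_eq_add, hBX] at heq
    have hzero := (mul_eq_zero.1 heq).resolve_left
      fun h => hw (by simpa using congrArg constantCoeff h)
    obtain ⟨s, hs⟩ := hne
    have hcoeff := congrArg (coeff s) hzero
    rw [coeff_subst_eq_sum (B := (X : R⟦X⟧)) (by simp) _ (Nat.lt_succ_self s),
      Finset.sum_eq_single s] at hcoeff
    · simp [indicatorSeries, hs, coeff_X_pow] at hcoeff
    · intro t _ hts
      rw [coeff_X_pow, if_neg (Ne.symm hts), smul_zero]
    · intro h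
      exact absurd (Finset.mem_range.2 (Nat.lt_succ_self s)) h
  have hwM : PowerSeries.C w ∈ rationalFunctions g :=
    mem_rationalFunctions_of_mul (polynomial_aeval_mem hBM P)
      (mul_mem (polynomial_aeval_mem hBM Q) (sub_mem hFM (one_mem _))) hPne
      (by rw [hrel, mul_comm])
  set D := ratDerivative R with hDdef
  have hDX : D X = 1 := derivative_X
  have hDw : D (PowerSeries.C w) = 0 := derivative_C
  have hDB : D B = F + X * D F := by
    rw [hB, D.leibniz, hDX, smul_eq_mul, smul_eq_mul]
    ring
  have hDrel := congrArg D hrel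
  rw [D.leibniz, D.leibniz, D.map_aeval, D.map_aeval, map_sub, D.map_one_eq_zero, hDw] at hDrel
  simp only [smul_eq_mul] at hDrel
  rw [hDB] at hDrel
  set E := Polynomial.aeval B (Polynomial.derivative Q) * (F - 1) -
    PowerSeries.C w * Polynomial.aeval B (Polynomial.derivative P) with hE
  have hEM : E ∈ rationalFunctions g :=
    sub_mem (mul_mem (polynomial_aeval_mem hBM _) (sub_mem hFM (one_mem _)))
      (mul_mem hwM (polynomial_aeval_mem hBM _))
  -- The factor of F' in the differentiated relation is Q(B) plus a multiple of X, so its constant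
  -- coefficient is 1 and it is nonzero.
  have hDF : D F ∈ rationalFunctions g := by
    refine mem_rationalFunctions_of_mul (a := Polynomial.aeval B Q + X * E) (b := -(F * E))
      (add_mem (polynomial_aeval_mem hBM Q) (mul_mem hXM hEM)) (neg_mem (mul_mem hFM hEM))
      (ne_zero_of_constantCoeff_eq_one (by simp [hQc])) ?_
    rw [hE]
    linear_combination hDrel
  refine mem_rationalFunctions.1 (genSeries_partition_mem (fun f hf => ?_) hXM hS hwM hFM k)
  refine derivation_mem_rationalFunctions D (fun i => ?_) hf
  fin_cases i
  · exact hDF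
  · have : D (g 1) = 1 := hDX
    exact this ▸ one_mem _

end PartitionRational

/-! ### Rationality for diagrams -/

section DiagramRational

variable {R : Type*} [CommRing R]

theorem two_le_of_mem_bigSizes {S : Set ℕ} : ∀ s ∈ bigSizes S, 2 ≤ s := fun _ h => h.2

/-- Singletons contribute one factor per point, which amounts to rescaling the variable in the
series without singletons. -/
theorem genSeries_diagram_zero_eq {S : Set ℕ} (hS : 0 ∉ S) (w : R) :
    genSeries False S w 0 = 1 + PowerSeries.C (pointFactor S w) * X *
      (1 + rescale (pointFactor S w) (polygonSeries (bigSizes S) w)) := by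
  have h : genSeries False S w 0 = rescale (pointFactor S w)
      (1 + X * (1 + polygonSeries (bigSizes S) w)) := by
    rw [one_add_polygonSeries two_le_of_mem_bigSizes]
    ext n
    rw [coeff_zero_genSeries_zero, ncSum_eq_pointFactor_mul hS, coeff_rescale]
    congr 1
    cases n with
    | zero => simp [ncSum_diagram_zero two_le_of_mem_bigSizes]
    | succ n => rw [map_add, coeff_succ_X_mul, coeff_mk, coeff_one,
        if_neg (Nat.succ_ne_zero n), zero_add]
  rw [h, map_add, map_mul, map_add, map_one, rescale_X]

theorem rescale_C_eq (u r : R) : rescale u (PowerSeries.C r) = PowerSeries.C r := by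
  ext n
  rw [coeff_rescale, coeff_C]
  split_ifs with h
  · rw [h, pow_zero, one_mul]
  · rw [mul_zero]

variable [Algebra ℚ R]

/-- The polynomial equation for the rescaled polygon series. -/
theorem rescale_polygonSeries_eq {S : Set ℕ} (hS : ∀ s ∈ S, 2 ≤ s) (w u : R)
    {P Q : Polynomial ℚ} (hPQ : (Q : ℚ⟦X⟧) * shiftedSeries S = P) {a : R⟦X⟧}
    (ha : a = rescale u (polygonSeries S w)) :
    PowerSeries.C (1 + chordWeight S w) * a * Polynomial.aeval a Q =
      (1 + a) * (PowerSeries.C (1 + chordWeight S w) *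
        (PowerSeries.C u * X * Polynomial.aeval a Q + PowerSeries.C w * Polynomial.aeval a P) +
        PowerSeries.C (chordWeight S w) * a * Polynomial.aeval a Q) := by
  have h1 := polygonSeries_eq hS w
  have h2 := subst_mul_eq (constantCoeff_polygonSeries S w) hPQ
  set A := polygonSeries S w
  have h3 : PowerSeries.C (1 + chordWeight S w) * A * Polynomial.aeval A Q =
      (1 + A) * (PowerSeries.C (1 + chordWeight S w) *
        (X * Polynomial.aeval A Q + PowerSeries.C w * Polynomial.aeval A P) +
        PowerSeries.C (chordWeight S w) * A * Polynomial.aeval A Q) := by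
    linear_combination Polynomial.aeval A Q * h1 +
      (1 + A) * PowerSeries.C (1 + chordWeight S w) * PowerSeries.C w * h2
  have haeval : ∀ T : Polynomial ℚ, rescale u (Polynomial.aeval A T) = Polynomial.aeval a T := by
    intro T
    have h := Polynomial.aeval_algHom_apply (rescale u).toRatAlgHom A T
    rw [RingHom.toRatAlgHom_apply, RingHom.toRatAlgHom_apply, ← ha] at h
    exact h.symm
  have h4 := congrArg (rescale u) h3
  simp only [map_mul, map_add, map_one, haeval, ← ha, rescale_X, rescale_C_eq] at h4
  simpa only [map_add, map_one] using h4

variable [IsDomain R]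

/-- By `hg` the generators are the noncrossing series, `X` and constants, so closure under the
derivative reduces to the derivative of the noncrossing series. The weight need only be a rational
function of the generators, which covers chord diagrams without `y`. -/
theorem genSeries_diagram_rational {ι : Type*} {g : ι → R⟦X⟧} {S : Set ℕ} (hS : 0 ∉ S)
    (hper : EventuallyPeriodic S) {w r : R} (hr : r * pointFactor S w = 1)
    (hg : ∀ i, g i = genSeries False S w 0 ∨ g i = X ∨ ∃ c, g i = PowerSeries.C c)
    (hF : genSeries False S w 0 ∈ rationalFunctions g) (hX : X ∈ rationalFunctions g)
    (hw : PowerSeries.C w ∈ rationalFunctions g) (k : ℕ) :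
    genSeries False S w k ∈ rationalFunctions g := by
  obtain ⟨P, Q, hQ0, hPQ⟩ := hper.bigSizes.shiftedSeries
  have hFa := genSeries_diagram_zero_eq hS w
  set u := pointFactor S w with hu
  set a := rescale u (polygonSeries (bigSizes S) w) with ha
  have hrel := rescale_polygonSeries_eq two_le_of_mem_bigSizes w u hPQ ha
  set χ := chordWeight (bigSizes S) w with hχ
  set F := genSeries False S w 0 with hFdef
  have huM : PowerSeries.C u ∈ rationalFunctions g := C_pointFactor_mem hw S
  have hχM : PowerSeries.C χ ∈ rationalFunctions g := C_chordWeight_mem hw _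
  have hEM : PowerSeries.C (1 + χ) ∈ rationalFunctions g := by
    rw [map_add, map_one]
    exact add_mem (one_mem _) hχM
  have hu0 : u ≠ 0 := right_ne_zero_of_mul_eq_one hr
  have hCu0 : (PowerSeries.C u : R⟦X⟧) ≠ 0 :=
    fun h => hu0 (by simpa using congrArg constantCoeff h)
  have haM : a ∈ rationalFunctions g := by
    refine mem_rationalFunctions_of_mul (a := PowerSeries.C u * X)
      (b := F - 1 - PowerSeries.C u * X) (mul_mem huM hX)
      (sub_mem (sub_mem hF (one_mem _)) (mul_mem huM hX)) (mul_ne_zero hCu0 X_ne_zero) ?_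
    rw [hFa]
    ring
  have ha0 : constantCoeff a = 0 := by
    rw [ha, ← coeff_zero_eq_constantCoeff_apply, coeff_rescale,
      coeff_zero_eq_constantCoeff_apply, constantCoeff_polygonSeries, mul_zero]
  -- The shifted series starts in degree two, hence so does `P`; this kills the constant
  -- coefficients of both P(a) and P'(a).
  have hPcoeff : ∀ i < 2, P.coeff i = 0 := by
    intro i hi
    have h2 : X ^ 2 ∣ (Q : ℚ⟦X⟧) * shiftedSeries (bigSizes S) := by
      refine Dvd.dvd.mul_left (X_pow_dvd_iff.2 fun m hm => ?_) _
      rw [shiftedSeries, coeff_mk, if_neg]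
      rintro ⟨-, h⟩
      omega
    rw [← Polynomial.coeff_coe, ← hPQ]
    exact X_pow_dvd_iff.1 h2 i hi
  have hq : constantCoeff (Polynomial.aeval a Q) = 1 := by
    rw [constantCoeff_aeval ha0, hQ0, map_one]
  have hp : constantCoeff (Polynomial.aeval a P) = 0 := by
    rw [constantCoeff_aeval ha0, hPcoeff 0 (by norm_num), map_zero]
  have hp' : constantCoeff (Polynomial.aeval a (Polynomial.derivative P)) = 0 := by
    rw [constantCoeff_aeval ha0, Polynomial.coeff_derivative, hPcoeff 1 (by norm_num), zero_mul,
      map_zero]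
  set D := ratDerivative R with hDdef
  have hDX : D X = 1 := derivative_X
  have hDC : ∀ c : R, D (PowerSeries.C c) = 0 := fun c => derivative_C
  have hDrel := congrArg D hrel
  simp only [D.leibniz, D.map_aeval, map_add D, D.map_one_eq_zero, hDC, hDX, smul_eq_mul] at hDrel
  set q := Polynomial.aeval a Q
  set p := Polynomial.aeval a P
  set q' := Polynomial.aeval a (Polynomial.derivative Q)
  set p' := Polynomial.aeval a (Polynomial.derivative P)
  have hqM : q ∈ rationalFunctions g := polynomial_aeval_mem haM _
  have hpM : p ∈ rationalFunctions g := polynomial_aeval_mem haM _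
  have hqM' : q' ∈ rationalFunctions g := polynomial_aeval_mem haM _
  have hpM' : p' ∈ rationalFunctions g := polynomial_aeval_mem haM _
  have h1a : 1 + a ∈ rationalFunctions g := add_mem (one_mem _) haM
  have huX : PowerSeries.C u * X ∈ rationalFunctions g := mul_mem huM hX
  have hDa : D a ∈ rationalFunctions g := by
    refine mem_rationalFunctions_of_mul
      (a := PowerSeries.C (1 + χ) * (q + a * q') - (PowerSeries.C (1 + χ) *
        (PowerSeries.C u * X * q + PowerSeries.C w * p) + PowerSeries.C χ * a * q) -
        (1 + a) * (PowerSeries.C (1 + χ) * (PowerSeries.C u * X * q' + PowerSeries.C w * p') +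
          PowerSeries.C χ * (q + a * q')))
      (b := (1 + a) * (PowerSeries.C (1 + χ) * (PowerSeries.C u * q))) ?_ ?_ ?_ ?_
    · exact sub_mem (sub_mem (mul_mem hEM (add_mem hqM (mul_mem haM hqM')))
        (add_mem (mul_mem hEM (add_mem (mul_mem huX hqM) (mul_mem hw hpM)))
          (mul_mem (mul_mem hχM haM) hqM)))
        (mul_mem h1a (add_mem (mul_mem hEM (add_mem (mul_mem huX hqM') (mul_mem hw hpM')))
          (mul_mem hχM (add_mem hqM (mul_mem haM hqM')))))
    · exact mul_mem h1a (mul_mem hEM (mul_mem huM hqM))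
    -- The constant coefficient is (1 + χ) - χ = 1, all other terms having a factor without constant
    -- term.
    · refine ne_zero_of_constantCoeff_eq_one ?_
      simp [ha0, hq, hp, hp']
    · linear_combination hDrel
  have hDF : D F ∈ rationalFunctions g := by
    rw [hFa]
    simp only [D.leibniz, map_add D, D.map_one_eq_zero, hDC, hDX, smul_eq_mul, mul_zero, mul_one,
      add_zero, zero_add]
    exact add_mem (mul_mem huX hDa) (mul_mem h1a huM)
  refine genSeries_diagram_mem (fun f hf => ?_) hX hS hr hw hF k
  refine derivation_mem_rationalFunctions D (fun i => ?_) hf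
  rcases hg i with h | h | ⟨c, h⟩
  · rw [h]
    exact hDF
  · rw [h, hDX]
    exact one_mem _
  · rw [h, hDC]
    exact zero_mem _

/-- For chord diagrams, the weight of a chord is a rational function of the generating function of
the noncrossing chord diagrams. -/
theorem C_mem_rationalFunctions_chord {ι : Type*} {g : ι → R⟦X⟧} {w : R}
    (hF : genSeries False {2} w 0 ∈ rationalFunctions g) (hX : X ∈ rationalFunctions g) :
    PowerSeries.C w ∈ rationalFunctions g := by
  have hS : ∀ s ∈ ({2} : Set ℕ), 2 ≤ s := fun s hs => hs.ge
  have hFa := genSeries_diagram_zero_eq (zero_notMem_of_two_le hS) w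
  have hPQ : ((1 : Polynomial ℚ) : ℚ⟦X⟧) * shiftedSeries {2} = (0 : Polynomial ℚ) := by
    rw [Polynomial.coe_one, one_mul, Polynomial.coe_zero]
    ext t
    rw [shiftedSeries, coeff_mk, if_neg, map_zero]
    rintro ⟨h, h'⟩
    have : t + 1 = 2 := h
    omega
  rw [bigSizes_eq_self hS, pointFactor_of_two_le hS] at hFa
  set a := rescale 1 (polygonSeries {2} w) with ha
  have hrel := rescale_polygonSeries_eq hS w 1 hPQ ha
  rw [chordWeight, if_pos (Set.mem_singleton 2)] at hrel
  simp only [map_one, map_zero, mul_one, one_mul, mul_zero, add_zero, map_add] at hrel hFa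
  have ha0 : constantCoeff a = 0 := by
    rw [ha, ← coeff_zero_eq_constantCoeff_apply, coeff_rescale,
      coeff_zero_eq_constantCoeff_apply, constantCoeff_polygonSeries, mul_zero]
  have haM : a ∈ rationalFunctions g := by
    refine mem_rationalFunctions_of_mul (b := genSeries False {2} w 0 - 1 - X) hX
      (sub_mem (sub_mem hF (one_mem _)) hX) X_ne_zero ?_
    rw [hFa]
    ring
  -- The relation is linear in the weight, and this is its solution. If the coefficient vanished,
  -- the relation would reduce to a(1 + a) = 0, so a = 0 and then X = 0.
  refine mem_rationalFunctions_of_mul (a := X + a * X + a ^ 2) (b := a - X - a * X)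
    (add_mem (add_mem hX (mul_mem haM hX)) (pow_mem haM 2))
    (sub_mem (sub_mem haM hX) (mul_mem haM hX)) (fun h0 => ?_) ?_
  · have h1 : a * (1 + a) = 0 := by
      linear_combination (1 + PowerSeries.C w) * h0 + hrel
    have h2 : (1 : R⟦X⟧) + a ≠ 0 := ne_zero_of_constantCoeff_eq_one (by simp [ha0])
    have h3 : a = 0 := (mul_eq_zero.1 h1).resolve_right h2
    rw [h3] at h0
    simp at h0
  · linear_combination -hrel

end DiagramRational

end ChordConfig

namespace ChordConfig

/-! ### The six families as fillings with prescribed sizes -/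

section Families

theorem mem_matchings (n : ℕ) (H : Configuration n) :
    H ∈ matchings n ↔ IsFilling True {2} Finset.univ H :=
  mem_partitionsSizes (S := {2}) (by simp)

theorem mem_partitions_iff (n : ℕ) (H : Configuration n) :
    H ∈ partitions n ↔ IsFilling True {s | 1 ≤ s} Finset.univ H := by
  rw [← mem_partitionsSizes (by simp)]
  exact (and_iff_left_of_imp fun h U hU =>
    Finset.card_pos.2 ((mem_partitions.1 h).1 U hU)).symm

theorem mem_chordDiagrams (n : ℕ) (H : Configuration n) :
    H ∈ chordDiagrams n ↔ IsFilling False {2} Finset.univ H := by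
  rw [isFilling_false]
  rfl

theorem mem_hyperchordDiagrams (n : ℕ) (H : Configuration n) :
    H ∈ hyperchordDiagrams n ↔ IsFilling False {s | 1 ≤ s} Finset.univ H := by
  rw [isFilling_false]
  exact forall₂_congr fun U _ => Finset.card_pos.symm

theorem eventuallyPeriodic_one_le : EventuallyPeriodic {s | 1 ≤ s} :=
  ⟨1, 1, le_refl 1, fun s hs => iff_of_true (Nat.le_add_left 1 s) hs⟩

theorem regionSeriesHyper_two (f : ℚ⟦X⟧⟦X⟧) (i j : ℕ) :
    regionSeriesHyper {2} f i j = regionSeriesPeaks f i j := by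
  have h : singletonFactor {2} = 1 := if_neg (by simp)
  rw [regionSeriesHyper, h, inv_one, one_pow, map_one, one_mul]

theorem regionSeriesHyper_one_le (f : ℚ⟦X⟧⟦X⟧) (i j : ℕ) :
    regionSeriesHyper {s | 1 ≤ s} f i j = regionSeriesHyper Set.univ f i j := by
  have h : singletonFactor {s | 1 ≤ s} = singletonFactor Set.univ :=
    by rw [singletonFactor, singletonFactor, if_pos (Set.mem_univ 1), if_pos (by simp)]
  rw [regionSeriesHyper, regionSeriesHyper, h]

theorem genFun_partition_rational {F : Family} {S : Set ℕ} (hS : 0 ∉ S) (hne : S.Nonempty)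
    (hper : EventuallyPeriodic S)
    (hF : ∀ n (H : Configuration n), H ∈ F n ↔ IsFilling True S Finset.univ H) (k : ℕ) :
    IsRationalFunctionOf (genFun F k) ![genFun F 0, xVar] := by
  rw [genFun_eq hF, genFun_eq hF]
  exact genSeries_partition_rational hne hS hper X_ne_zero k

theorem genFun_diagram_rational {F : Family} {S : Set ℕ} (hS : 0 ∉ S)
    (hper : EventuallyPeriodic S)
    (hF : ∀ n (H : Configuration n), H ∈ F n ↔ IsFilling False S Finset.univ H) (k : ℕ) :
    IsRationalFunctionOf (genFun F k) ![genFun F 0, xVar, yVar] := by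
  rw [genFun_eq hF, genFun_eq hF]
  set g : Fin 3 → ℚ⟦X⟧⟦X⟧ := ![genSeries False S (X : ℚ⟦X⟧) 0, xVar, yVar]
  have h0 : genSeries False S (X : ℚ⟦X⟧) 0 ∈ rationalFunctions g := apply_mem_rationalFunctions g 0
  have hX : X ∈ rationalFunctions g := apply_mem_rationalFunctions g 1
  have hY : PowerSeries.C X ∈ rationalFunctions g := apply_mem_rationalFunctions g 2
  refine mem_rationalFunctions.1 (genSeries_diagram_rational hS hper
    (inv_singletonFactor_mul S) (fun i => ?_) h0 hX hY k)
  fin_cases i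
  · exact Or.inl rfl
  · exact Or.inr (Or.inl rfl)
  · exact Or.inr (Or.inr ⟨X, rfl⟩)

theorem genFun_chord_rational (k : ℕ) :
    IsRationalFunctionOf (genFun chordDiagrams k) ![genFun chordDiagrams 0, xVar] := by
  rw [genFun_eq mem_chordDiagrams, genFun_eq mem_chordDiagrams]
  set g : Fin 2 → ℚ⟦X⟧⟦X⟧ := ![genSeries False {2} (X : ℚ⟦X⟧) 0, xVar]
  have hF : genSeries False {2} (X : ℚ⟦X⟧) 0 ∈ rationalFunctions g :=
    apply_mem_rationalFunctions g 0
  have hX : X ∈ rationalFunctions g := apply_mem_rationalFunctions g 1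
  refine mem_rationalFunctions.1 (genSeries_diagram_rational (by simp)
    (eventuallyPeriodic_of_finite (Set.finite_singleton 2)) (inv_singletonFactor_mul {2})
    (fun i => ?_) hF hX (C_mem_rationalFunctions_chord hF hX) k)
  fin_cases i
  · exact Or.inl rfl
  · exact Or.inr (Or.inl rfl)

end Families

end ChordConfig

theorem mainTheorem1 (k : ℕ) :
    -- perfect matchings, in one variable and in two variables
    ((1 ≤ k → (cores matchings k).Finite ∧
        genFunX matchings k =
          xDiff (MvPolynomial.aeval (regionSeries (genFunX matchings 0))
            (corePolynomialX matchings k))) ∧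
      IsRationalFunctionOf (genFunX matchings k) ![genFunX matchings 0, PowerSeries.X] ∧
      IsRationalFunctionOf (genFun matchings k) ![genFun matchings 0, xVar]) ∧
    -- partitions
    ((1 ≤ k → (cores partitions k).Finite ∧
        genFun partitions k =
          xDiff (substXY (corePolynomial partitions k) (regionSeries (genFun partitions 0)))) ∧
      IsRationalFunctionOf (genFun partitions k) ![genFun partitions 0, xVar]) ∧
    -- partitions with block sizes in `S`
    (∀ S : Set ℕ, S.Nonempty → 0 ∉ S →
      (1 ≤ k → (cores (partitionsSizes S) k).Finite ∧
        genFun (partitionsSizes S) k =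
          xDiff (substXY (corePolynomial (partitionsSizes S) k)
            (regionSeries (genFun (partitionsSizes S) 0)))) ∧
      (S.Finite ∨ UltimatelyPeriodic S →
        IsRationalFunctionOf (genFun (partitionsSizes S) k)
          ![genFun (partitionsSizes S) 0, xVar])) ∧
    -- chord diagrams
    ((1 ≤ k → (cores chordDiagrams k).Finite ∧
        genFun chordDiagrams k =
          xDiff (substXY (corePolynomialPeaks chordDiagrams k)
            (fun ij => regionSeriesPeaks (genFun chordDiagrams 0) ij.1 ij.2))) ∧
      IsRationalFunctionOf (genFun chordDiagrams k) ![genFun chordDiagrams 0, xVar]) ∧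
    -- hyperchord diagrams
    ((1 ≤ k → (cores hyperchordDiagrams k).Finite ∧
        genFun hyperchordDiagrams k =
          xDiff (substXY (corePolynomialPeaks hyperchordDiagrams k)
            (fun ij => regionSeriesHyper Set.univ (genFun hyperchordDiagrams 0) ij.1 ij.2))) ∧
      IsRationalFunctionOf (genFun hyperchordDiagrams k)
        ![genFun hyperchordDiagrams 0, xVar, yVar]) ∧
    -- hyperchord diagrams with hyperchord sizes in `S`
    (∀ S : Set ℕ, S.Nonempty → 0 ∉ S →
      (1 ≤ k → (cores (hyperchordDiagramsSizes S) k).Finite ∧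
        genFun (hyperchordDiagramsSizes S) k =
          xDiff (substXY (corePolynomialPeaks (hyperchordDiagramsSizes S) k)
            (fun ij =>
              regionSeriesHyper S (genFun (hyperchordDiagramsSizes S) 0) ij.1 ij.2))) ∧
      (S.Finite ∨ UltimatelyPeriodic S →
        IsRationalFunctionOf (genFun (hyperchordDiagramsSizes S) k)
          ![genFun (hyperchordDiagramsSizes S) 0, xVar, yVar])) := by
  have hsizes : ∀ {S : Set ℕ}, S.Finite ∨ UltimatelyPeriodic S → EventuallyPeriodic S :=
    fun h => h.elim eventuallyPeriodic_of_finite eventuallyPeriodic_of_ultimatelyPeriodic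
  have h2 : (0 : ℕ) ∉ ({2} : Set ℕ) := by simp
  have h1 : (0 : ℕ) ∉ {s : ℕ | 1 ≤ s} := by simp
  refine ⟨⟨fun hk => genFunX_partition_formula h2 mem_matchings hk, ?_, ?_⟩,
    ⟨fun hk => genFun_partition_formula h1 mem_partitions_iff hk, ?_⟩,
    fun S hne hS => ⟨fun hk => genFun_partition_formula hS
      (fun _ _ => mem_partitionsSizes hS) hk, fun h => ?_⟩,
    ⟨fun hk => ?_, ?_⟩, ⟨fun hk => ?_, ?_⟩,
    fun S hne hS => ⟨fun hk => genFun_diagram_formula hS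
      (fun _ _ => mem_hyperchordDiagramsSizes hS) hk, fun h => ?_⟩⟩
  -- The series in one variable is the instance with rational coefficients and weight 1.
  · rw [genFunX_eq mem_matchings, genFunX_eq mem_matchings]
    exact genSeries_partition_rational (Set.singleton_nonempty 2) h2
      (eventuallyPeriodic_of_finite (Set.finite_singleton 2)) one_ne_zero k
  · exact genFun_partition_rational h2 (Set.singleton_nonempty 2)
      (eventuallyPeriodic_of_finite (Set.finite_singleton 2)) mem_matchings k
  · exact genFun_partition_rational h1 ⟨1, le_refl 1⟩ eventuallyPeriodic_one_le
      mem_partitions_iff k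
  · exact genFun_partition_rational hS hne (hsizes h) (fun _ _ => mem_partitionsSizes hS) k
  -- Chord diagrams are hyperchord diagrams with sizes in `{2}`, for which the singleton factor is
  -- 1.
  · simp only [← regionSeriesHyper_two]
    exact genFun_diagram_formula h2 mem_chordDiagrams hk
  · exact genFun_chord_rational k
  · simp only [← regionSeriesHyper_one_le]
    exact genFun_diagram_formula h1 mem_hyperchordDiagrams hk
  · exact genFun_diagram_rational h1 eventuallyPeriodic_one_le mem_hyperchordDiagrams k
  · exact genFun_diagram_rational hS (hsizes h)
      (fun _ _ => mem_hyperchordDiagramsSizes hS) k
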